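/- There is a deterministic algorithm that solves the \emph{Balanced Connected Subgraph} (BCS) problem on permutation graphs in $O(n^6)$ time, where $n$ is the number of vertices. Definitions. A graph $G=(V,E)$ with $|V|=n$ is a \emph{permutation graph} if there are a bijection $f\colon V\to\{1,\dots,n\}$ and a permutation $\pi$ of $\{1,\dots,n\}$ such that for all $u,v\in V$: $uv\in E \iff (f(u)-f(v))\,(\pi(f(u))-\pi(f(v)))<0$. In the BCS problem one is given a graph $G$, each of whose vertices is colored red or blue, and has to find a set $S$ of vertices of maximum cardinality such that the induced subgraph $G[S]$ is (nonempty and) connected and $S$ contains equally many red and blue vertices; if no such set exists, the answer is $S=\emptyset$. Precisely: there are a single word-RAM program $P$, a constant $k$ and a function $T\colon\mathbb N\to\mathbb N$ with $T(n)=O(n^6)$ such that for every $n\ge 0$, every permutation graph $G$ with vertex set $\{0,\dots,n-1\}$ and every coloring of its vertices with red and blue, the program $P$, given $n$, the adjacency matrix of $G$ and the colors of the vertices (but neither $f$ nor $\pi$), halts after at most $T(n)$ steps and outputs a correct answer $S$ to the BCS problem on $G$. All machine words hold nonnegative integers below $(n+2)^k$, i.e. have $O(\log n)$ bits, and a result outside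 this range is an error; a step is an assignment of a constant or a register, an addition, truncated subtraction or multiplication of registers, a memory access with an address held in a register, a comparison of two registers, or an empty instruction. -/

import Mathlib

open Filter Asymptotics

/-! ### A word RAM with a step count -/

namespace RAM

/-- A machine state: registers and a random-access memory. A program is a finite text and mentions
only finitely many registers. -/
structure State where
  reg : ℕ → ℕ
  mem : ℕ → ℕ

/-- Right-hand sides of register assignments. The arguments name registers, except in `const`. -/
inductive Operation where
  | const (c : ℕ)
  | copy (a : ℕ)
  | add (a b : ℕ)
  | sub (a b : ℕ)
  | mul (a b : ℕ)
  | load (a : ℕ)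

/-- The value of an operation. Subtraction is truncated at `0`, and `load a` reads the memory cell
whose address is held in register `a`. -/
def Operation.eval (s : State) : Operation → ℕ
  | .const c => c
  | .copy a => s.reg a
  | .add a b => s.reg a + s.reg b
  | .sub a b => s.reg a - s.reg b
  | .mul a b => s.reg a * s.reg b
  | .load a => s.mem (s.reg a)

/-- Comparisons of two registers. -/
inductive Test where
  | lt (a b : ℕ)
  | eq (a b : ℕ)

/-- The comparison succeeds in the state `s`. -/
def Test.Holds (s : State) : Test → Prop
  | .lt a b => s.reg a < s.reg b
  | .eq a b => s.reg a = s.reg b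

/-- Programs: register assignments, writes to memory (`store a b` writes register `b` to the cell
whose address is held in register `a`), composition, branching and loops. -/
inductive Prog where
  | skip
  | assign (d : ℕ) (e : Operation)
  | store (a b : ℕ)
  | seq (p q : Prog)
  | ite (c : Test) (p q : Prog)
  | while (c : Test) (p : Prog)

/-- `Runs W p s t s'`: on a machine whose words hold the numbers below `W`, the program `p` started
in the state `s` halts in the state `s'` after exactly `t` steps. Every elementary instruction and
every evaluation of a test is one step. An assignment whose result is not a word (is not below `W`)
is an error: the machine is stuck and there is no halting run. -/
inductive Runs (W : ℕ) : Prog → State → ℕ → State → Prop where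
  | skip (s : State) : Runs W .skip s 1 s
  | assign (d : ℕ) (e : Operation) (s : State) (h : e.eval s < W) :
      Runs W (.assign d e) s 1 { s with reg := Function.update s.reg d (e.eval s) }
  | store (a b : ℕ) (s : State) :
      Runs W (.store a b) s 1 { s with mem := Function.update s.mem (s.reg a) (s.reg b) }
  | seq {p q : Prog} {s₁ s₂ s₃ : State} {t₁ t₂ : ℕ}
      (h₁ : Runs W p s₁ t₁ s₂) (h₂ : Runs W q s₂ t₂ s₃) : Runs W (.seq p q) s₁ (t₁ + t₂) s₃
  | ite_true {c : Test} {p q : Prog} {s s' : State} {t : ℕ} (hc : c.Holds s)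
      (h : Runs W p s t s') : Runs W (.ite c p q) s (t + 1) s'
  | ite_false {c : Test} {p q : Prog} {s s' : State} {t : ℕ} (hc : ¬ c.Holds s)
      (h : Runs W q s t s') : Runs W (.ite c p q) s (t + 1) s'
  | while_true {c : Test} {p : Prog} {s₁ s₂ s₃ : State} {t₁ t₂ : ℕ} (hc : c.Holds s₁)
      (h₁ : Runs W p s₁ t₁ s₂) (h₂ : Runs W (.while c p) s₂ t₂ s₃) :
      Runs W (.while c p) s₁ (t₁ + t₂ + 1) s₃
  | while_false {c : Test} {p : Prog} {s : State} (hc : ¬ c.Holds s) : Runs W (.while c p) s 1 s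

end RAM

/-! ### Permutation graphs and balanced connected subgraphs -/

/-- `G` is a permutation graph: for some numbering `f` of the vertices and some permutation `π`, two
vertices are adjacent exactly when `π` inverts the order of their numbers. -/
def IsPermutationGraph {V : Type*} (G : SimpleGraph V) : Prop :=
  ∃ (n : ℕ) (f : V ≃ Fin n) (π : Equiv.Perm (Fin n)), ∀ u v : V,
    G.Adj u v ↔ (((f u : ℕ) : ℤ) - ((f v : ℕ) : ℤ)) *
      (((π (f u) : ℕ) : ℤ) - ((π (f v) : ℕ) : ℤ)) < 0

/-- The two colors of vertices. -/
inductive VertexColor where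
  | red
  | blue

/-- The vertex set `S` induces a connected (in particular nonempty) subgraph of `G` with as many red
as blue vertices. -/
def IsBalancedConnected {V : Type*} (G : SimpleGraph V) (color : V → VertexColor)
    (S : Set V) : Prop :=
  (G.induce S).Connected ∧
    {v | v ∈ S ∧ color v = .red}.ncard = {v | v ∈ S ∧ color v = .blue}.ncard

/-- `S` is a correct answer to the balanced connected subgraph problem on the colored graph
`(G, color)`: the vertex set of a balanced connected induced subgraph with the maximum number of
vertices, or the empty set when there is no balanced connected induced subgraph. -/
def IsBCSSolution {V : Type*} (G : SimpleGraph V) (color : V → VertexColor) (S : Set V) : Prop :=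
  (IsBalancedConnected G color S ∧
    ∀ S' : Set V, IsBalancedConnected G color S' → S'.ncard ≤ S.ncard) ∨
  (S = ∅ ∧ ∀ S' : Set V, ¬ IsBalancedConnected G color S')

open Classical in
/-- The input of the machine: register `0` holds the number `n` of vertices, the memory cells
`0, …, n² - 1` hold the adjacency matrix row by row, the next `n` cells hold the colors (`1` for red,
`0` for blue), and all other cells and registers are `0`. -/
noncomputable def bcsInput {n : ℕ} (G : SimpleGraph (Fin n)) (color : Fin n → VertexColor) :
    RAM.State where
  reg := fun r => if r = 0 then n else 0
  mem := fun a =>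
    if (∃ i j : Fin n, a = (i : ℕ) * n + (j : ℕ) ∧ G.Adj i j) ∨
        (∃ i : Fin n, a = n * n + (i : ℕ) ∧ color i = .red) then 1 else 0

/-- The output of the machine: the vertex set whose indicator vector is in the `n` memory cells that
follow the input. -/
def bcsOutput (n : ℕ) (s : RAM.State) : Set (Fin n) :=
  {i | s.mem (n * n + n + (i : ℕ)) = 1}

/-!
# Balanced connected subgraphs of permutation graphs in time `O(n ^ 6)`

The complement of a permutation graph `G` has a transitive orientation `r` that refines a linear
order of the vertices (`IsPermutationGraph.exists_isCocomparability`). Let `S` be connected. A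
shortest path in `G[S]` from the first to the last vertex of `S` dominates `S`: a vertex that is
adjacent to none of its vertices would have the whole path on one side (`exists_chain`).
Conversely, if `P` is a path and `S` lies between `P` and the closed neighborhood of `P`, then
`G[S]` is connected (`Chain.connected`). So one looks for a path `P` and a number `a` such that
`P` has at most `a`, and its closed neighborhood at least `a`, vertices of each color, with `a` as
large as possible.

The decisive fact is that such paths can be built by looking at the last three vertices only. If
each vertex of a path is adjacent to the previous one and is not in the closed neighborhoods of
the two before that one (`Chain`), then the path is induced and, from the third vertex on,
proceeds in one direction of the order `r` or its converse (`Chain.direction`). Hence the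
neighbors of its last vertex `w` that are near neither of the two vertices `u, v` before `w` have
not been seen by any earlier vertex (`Chain.disjoint`), and the closed neighborhood of the path is
the disjoint union of its first vertex and the sets of new neighbors of its vertices, each of
which depends on a triple `u, v, w`. Since a coloring matters only through numbers of red and blue
vertices, there is a dynamic program over the number of vertices of the path, its last three
vertices, and the difference between the numbers of red and blue vertices selected so far; it
maximizes the number of selected vertices (`Attains`, `Attains.step`, `Attains.exists_of_succ`,
`RAM.LayerOK.succ`). The next vertex of the path is forced into the selection, and the other new
neighbors of `w` are free.

There are `O(n ^ 5)` states. Extending all states naively by all next vertices and all numbers of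
free vertices is too slow, so the two choices are separated. For each state and each color of the
next vertex (or none, for the last step) one finds the best numbers `i, j` of free red and blue
vertices. The outcome depends on the selected difference; for a given difference one may add
vertices of both colors until one color is exhausted, which leaves `2 * n + 1` pairs
(`RAM.freeSearch_spec`). Then each state of the next layer is a maximum over `n` predecessors
(`RAM.extendEntry_spec`). Both steps take time `O(n ^ 6)` in total. Paths are stored with each
state, and a maximum solution is written down by adding to the best path vertices of its closed
neighborhood until half of the optimal size is reached for both colors (`RAM.output_spec`).

The program is written in a loop language, whose commands are compiled to the word RAM
(`RAM.Cmd.compile_runs`). The running time of a command is a polynomial whose degree is the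
nesting depth of its loops (`RAM.Cmd.cost_le`), and no run is stuck on a value that is not a word
because stored values are cut off at `(n + 2) ^ 24`, a bound that correct runs do not reach.
Correctness is proved for the loop language, with a rule for nested loops that fill a table
(`RAM.Cmd.loops_rule`).
-/

/-! ### A loop language and its compilation to the word RAM -/

namespace RAM

/-- Arithmetic expressions over numbered variables, the input size and the memory. -/
inductive Expr where
  | num (c : ℕ)
  | size
  | var (x : ℕ)
  | add (a b : Expr)
  | sub (a b : Expr)
  | mul (a b : Expr)
  | load (a : Expr)

/-- The states of the loop language: the values of the variables and the memory. -/
structure Store where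
  var : ℕ → ℕ
  mem : ℕ → ℕ

/-- Overwrite one variable. -/
def Store.set (σ : Store) (x v : ℕ) : Store := { σ with var := Function.update σ.var x v }

/-- Overwrite one memory cell. -/
def Store.put (σ : Store) (a v : ℕ) : Store := { σ with mem := Function.update σ.mem a v }

@[simp] theorem Store.set_mem (σ : Store) (x v : ℕ) : (σ.set x v).mem = σ.mem := rfl

@[simp] theorem Store.put_var (σ : Store) (a v : ℕ) : (σ.put a v).var = σ.var := rfl

@[simp] theorem Store.set_var (σ : Store) (x v y : ℕ) :
    (σ.set x v).var y = if y = x then v else σ.var y := by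
  simp [Store.set, Function.update_apply]

@[simp] theorem Store.put_mem (σ : Store) (a v b : ℕ) :
    (σ.put a v).mem b = if b = a then v else σ.mem b := by
  simp [Store.put, Function.update_apply]

/-- The value of an expression when the input size is `n`. -/
def Expr.eval (n : ℕ) (σ : Store) : Expr → ℕ
  | .num c => c
  | .size => n
  | .var x => σ.var x
  | .add a b => a.eval n σ + b.eval n σ
  | .sub a b => a.eval n σ - b.eval n σ
  | .mul a b => a.eval n σ * b.eval n σ
  | .load a => σ.mem (a.eval n σ)

/-- Commands. `ite e c d` runs `c` if the value of `e` is not `0`; `loop x a b c` runs `c` for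
`x = 0, …, a * n + b - 1`, where `n` is the input size. -/
inductive Cmd where
  | skip
  | set (x : ℕ) (e : Expr)
  | store (a e : Expr)
  | seq (c d : Cmd)
  | ite (e : Expr) (c d : Cmd)
  | loop (x a b : ℕ) (c : Cmd)

/-- Apply `f 0`, …, `f (k - 1)` one after the other. -/
def iter (f : ℕ → Store → Store) : ℕ → Store → Store
  | 0, σ => σ
  | k + 1, σ => f k (iter f k σ)

/-- The effect of a command when the input size is `n`. Assigned and stored values are cut off at
`(n + 2) ^ J`, so that all values stay polynomially bounded whatever the command does. -/
def Cmd.exec (J n : ℕ) : Cmd → Store → Store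
  | .skip, σ => σ
  | .set x e, σ => σ.set x (min (e.eval n σ) ((n + 2) ^ J))
  | .store a e, σ => σ.put (a.eval n σ) (min (e.eval n σ) ((n + 2) ^ J))
  | .seq c d, σ => d.exec J n (c.exec J n σ)
  | .ite e c d, σ => if e.eval n σ = 0 then d.exec J n σ else c.exec J n σ
  | .loop x a b c, σ => iter (fun j s => c.exec J n (s.set x j)) (a * n + b) σ

/-- The register of the variable `x`. -/
def regVar (x : ℕ) : ℕ := 4 * x + 4

/-- The `t`-th scratch register of expression evaluation. -/
def regTmp (t : ℕ) : ℕ := 4 * t + 5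

/-- The hidden counter of a loop at nesting depth `d`. -/
def regCounter (d : ℕ) : ℕ := 4 * d + 6

/-- The register of the bound of a loop at nesting depth `d`. -/
def regBound (d : ℕ) : ℕ := 4 * d + 7

/-- Evaluate an expression into the scratch register `t`, using the scratch registers from `t` on.
-/
def Expr.compile : Expr → ℕ → Prog
  | .num c, t => .assign (regTmp t) (.const c)
  | .size, t => .assign (regTmp t) (.copy 0)
  | .var x, t => .assign (regTmp t) (.copy (regVar x))
  | .add a b, t => .seq (a.compile t) (.seq (b.compile (t + 1))
      (.assign (regTmp t) (.add (regTmp t) (regTmp (t + 1)))))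
  | .sub a b, t => .seq (a.compile t) (.seq (b.compile (t + 1))
      (.assign (regTmp t) (.sub (regTmp t) (regTmp (t + 1)))))
  | .mul a b, t => .seq (a.compile t) (.seq (b.compile (t + 1))
      (.assign (regTmp t) (.mul (regTmp t) (regTmp (t + 1)))))
  | .load a, t => .seq (a.compile t) (.assign (regTmp t) (.load (regTmp t)))

/-- The number of steps of the compiled expression. -/
def Expr.cost : Expr → ℕ
  | .num _ | .size | .var _ => 1
  | .add a b | .sub a b | .mul a b => a.cost + (b.cost + 1)
  | .load a => a.cost + 1

/-- An exponent `e` such that all intermediate values are at most `(n + 2) ^ e` if variables and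
memory are at most `(n + 2) ^ J`. -/
def Expr.deg (J : ℕ) : Expr → ℕ
  | .num c => c
  | .size => 1
  | .var _ => J
  | .add a b | .sub a b | .mul a b => a.deg J + b.deg J + 1
  | .load a => a.deg J + J

/-- The expression `(n + 2) ^ J`. -/
def Expr.bound : ℕ → Expr
  | 0 => .num 1
  | J + 1 => .mul (.bound J) (.add .size (.num 2))

/-- The minimum of `e` and `(n + 2) ^ J`, written with truncated subtraction. -/
def Expr.clip (J : ℕ) (e : Expr) : Expr := .sub e (.sub e (.bound J))

/-- Compilation of a command at loop nesting depth `d`. -/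
def Cmd.compile (J : ℕ) : Cmd → ℕ → Prog
  | .skip, _ => .skip
  | .set x e, _ => .seq ((e.clip J).compile 0) (.assign (regVar x) (.copy (regTmp 0)))
  | .store a e, _ => .seq (a.compile 0) (.seq ((e.clip J).compile 1) (.store (regTmp 0) (regTmp 1)))
  | .seq c c', d => .seq (c.compile J d) (c'.compile J d)
  | .ite e c c', d => .seq (e.compile 0) (.seq (.assign (regTmp 1) (.const 0))
      (.ite (.eq (regTmp 0) (regTmp 1)) (c'.compile J d) (c.compile J d)))
  | .loop x a b c, d =>
      .seq ((Expr.add (.mul (.num a) .size) (.num b)).compile 0)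
        (.seq (.assign (regBound d) (.copy (regTmp 0)))
        (.seq (.assign (regCounter d) (.const 0))
          (.while (.lt (regCounter d) (regBound d))
            (.seq (.assign (regVar x) (.copy (regCounter d)))
            (.seq (c.compile J (d + 1))
            (.seq (.assign (regTmp 0) (.const 1))
              (.assign (regCounter d) (.add (regCounter d) (regTmp 0)))))))))

/-- A bound on the number of steps of the compiled command. -/
def Cmd.cost (J n : ℕ) : Cmd → ℕ
  | .skip => 1
  | .set _ e => (e.clip J).cost + 1
  | .store a e => a.cost + ((e.clip J).cost + 1)
  | .seq c d => c.cost J n + d.cost J n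
  | .ite e c d => e.cost + (1 + (c.cost J n + d.cost J n + 1))
  | .loop _ a b c => 8 + (a * n + b) * (c.cost J n + 4)

/-- The degree of `Cmd.cost` as a polynomial in the input size: the nesting depth of the loops
whose number of iterations is not constant. -/
def Cmd.depth : Cmd → ℕ
  | .skip | .set _ _ | .store _ _ => 0
  | .seq c d | .ite _ c d => max c.depth d.depth
  | .loop _ a _ c => (if a = 0 then 0 else 1) + c.depth

/-- The largest exponent that occurs in the evaluation of the expressions of a command. -/
def Cmd.deg (J : ℕ) : Cmd → ℕ
  | .skip => 0
  | .set _ e => (e.clip J).deg J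
  | .store a e => a.deg J + (e.clip J).deg J
  | .seq c d => c.deg J + d.deg J
  | .ite e c d => e.deg J + (c.deg J + d.deg J)
  | .loop _ a b c => a + b + 3 + c.deg J

/-- An exponent that bounds the numbers of iterations of all loops. -/
def Cmd.slope : Cmd → ℕ
  | .skip | .set _ _ | .store _ _ => 0
  | .seq c d | .ite _ c d => max c.slope d.slope
  | .loop _ a b c => max (a + b + 1) c.slope

/-- The variables that a command may change. -/
def Cmd.writes : Cmd → List ℕ
  | .skip | .store _ _ => []
  | .set x _ => [x]
  | .seq c d | .ite _ c d => c.writes ++ d.writes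
  | .loop x _ _ c => x :: c.writes

/-- The command does not write to the memory. -/
def Cmd.pure : Cmd → Bool
  | .skip | .set _ _ => true
  | .store _ _ => false
  | .seq c d | .ite _ c d => c.pure && d.pure
  | .loop _ _ _ c => c.pure

/-- A command changes only the variables that it mentions as targets. -/
theorem Cmd.exec_frame (J n : ℕ) {y : ℕ} (c : Cmd) (σ : Store) (h : y ∉ c.writes) :
    (c.exec J n σ).var y = σ.var y := by
  induction c generalizing σ with
  | skip => rfl
  | set x e => simp [Cmd.writes] at h; simp [Cmd.exec, h]
  | store a e => simp [Cmd.exec]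
  | seq c d hc hd =>
    simp [Cmd.writes] at h
    simp [Cmd.exec, hc _ h.1, hd _ h.2]
  | ite e c d hc hd =>
    simp [Cmd.writes] at h
    simp only [Cmd.exec]
    split_ifs
    · exact hd _ h.2
    · exact hc _ h.1
  | loop x a b c hc =>
    simp [Cmd.writes] at h
    simp only [Cmd.exec]
    generalize a * n + b = k
    induction k with
    | zero => rfl
    | succ k ih => simp [iter, hc _ h.2, ih, h.1]

theorem Cmd.exec_pure (J n : ℕ) (c : Cmd) (σ : Store) (h : c.pure = true) :
    (c.exec J n σ).mem = σ.mem := by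
  induction c generalizing σ with
  | skip => rfl
  | set x e => simp [Cmd.exec]
  | store a e => simp [Cmd.pure] at h
  | seq c d hc hd =>
    simp [Cmd.pure] at h
    simp [Cmd.exec, hc _ h.1, hd _ h.2]
  | ite e c d hc hd =>
    simp [Cmd.pure] at h
    simp only [Cmd.exec]
    split_ifs
    · exact hd _ h.2
    · exact hc _ h.1
  | loop x a b c hc =>
    simp [Cmd.pure] at h
    simp only [Cmd.exec]
    generalize a * n + b = k
    induction k with
    | zero => rfl
    | succ k ih => simp [iter, hc _ h, ih]

/-- All values in the store are at most `(n + 2) ^ J`. -/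
def Store.Bounded (J n : ℕ) (σ : Store) : Prop :=
  (∀ x, σ.var x ≤ (n + 2) ^ J) ∧ ∀ a, σ.mem a ≤ (n + 2) ^ J

/-- The machine state `s` represents the store `σ`. Scratch registers, loop counters and loop
bounds are not restricted. -/
def Represents (n : ℕ) (σ : Store) (s : State) : Prop :=
  s.reg 0 = n ∧ (∀ x, s.reg (regVar x) = σ.var x) ∧ s.mem = σ.mem

theorem Expr.eval_le {J n : ℕ} {σ : Store} (hσ : σ.Bounded J n) (e : Expr) :
    e.eval n σ ≤ (n + 2) ^ e.deg J := by
  have mono : ∀ {i j : ℕ}, i ≤ j → (n + 2) ^ i ≤ (n + 2) ^ j := fun h =>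
    Nat.pow_le_pow_right (by omega) h
  induction e with
  | num c => exact (Nat.lt_pow_self (by omega)).le
  | size => simp [Expr.eval, Expr.deg]
  | var x => exact hσ.1 x
  | add a b ha hb =>
    simp only [Expr.eval, Expr.deg]
    have h1 := ha.trans (mono (Nat.le_add_right (a.deg J) (b.deg J)))
    have h2 := hb.trans (mono (Nat.le_add_left (b.deg J) (a.deg J)))
    rw [pow_succ]
    nlinarith
  | sub a b ha hb =>
    simp only [Expr.eval, Expr.deg]
    exact (Nat.sub_le _ _).trans (ha.trans (mono (by omega)))
  | mul a b ha hb =>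
    simp only [Expr.eval, Expr.deg]
    refine (Nat.mul_le_mul ha hb).trans ?_
    rw [← pow_add]
    exact mono (by omega)
  | load a ha => exact (hσ.2 _).trans (mono (by simp [Expr.deg]))

theorem Expr.eval_bound (n : ℕ) (σ : Store) (J : ℕ) : (Expr.bound J).eval n σ = (n + 2) ^ J := by
  induction J with
  | zero => rfl
  | succ J ih => simp [Expr.bound, Expr.eval, ih, pow_succ]

theorem Expr.eval_clip (n : ℕ) (σ : Store) (J : ℕ) (e : Expr) :
    (e.clip J).eval n σ = min (e.eval n σ) ((n + 2) ^ J) := by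
  simp only [Expr.clip, Expr.eval, Expr.eval_bound]
  omega

/-- The program `p t` computes the value `v` into the scratch register `t` in `cost` steps and
changes nothing but the scratch registers from `t` on. -/
def Evaluates (n k : ℕ) (σ : Store) (p : ℕ → Prog) (cost v : ℕ) : Prop :=
  ∀ t s, Represents n σ s → ∃ s', Runs ((n + 2) ^ k) (p t) s cost s' ∧ s'.reg (regTmp t) = v ∧
    s'.mem = s.mem ∧ ∀ r, (∀ i, t ≤ i → r ≠ regTmp i) → s'.reg r = s.reg r

theorem Represents.of_frame {n : ℕ} {σ : Store} {s s' : State} {t : ℕ} (hs : Represents n σ s)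
    (hm : s'.mem = s.mem) (hr : ∀ r, (∀ i, t ≤ i → r ≠ regTmp i) → s'.reg r = s.reg r) :
    Represents n σ s' := by
  refine ⟨?_, fun x => ?_, hm.trans hs.2.2⟩
  · rw [hr 0 (fun i _ => by simp [regTmp]), hs.1]
  · rw [hr _ (fun i _ => by simp only [regTmp, regVar]; omega), hs.2.1]

theorem Evaluates.leaf {n k : ℕ} {σ : Store} {op : Operation} {v : ℕ}
    (hv : ∀ s, Represents n σ s → op.eval s = v) (hlt : v < (n + 2) ^ k) :
    Evaluates n k σ (fun t => .assign (regTmp t) op) 1 v := by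
  intro t s hs
  refine ⟨_, Runs.assign _ _ _ (by rw [hv s hs]; exact hlt), by simp [hv s hs], rfl,
    fun r hr => ?_⟩
  simp [Function.update_of_ne (hr t le_rfl)]

theorem Evaluates.binary {n k : ℕ} {σ : Store} {p q : ℕ → Prog} {c d v w : ℕ}
    (ha : Evaluates n k σ p c v) (hb : Evaluates n k σ q d w) (op : ℕ → ℕ → Operation)
    (g : ℕ → ℕ → ℕ) (hop : ∀ s x y, (op x y).eval s = g (s.reg x) (s.reg y))
    (hg : g v w < (n + 2) ^ k) :
    Evaluates n k σ (fun t => .seq (p t) (.seq (q (t + 1))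
      (.assign (regTmp t) (op (regTmp t) (regTmp (t + 1)))))) (c + (d + 1)) (g v w) := by
  intro t s hs
  obtain ⟨s₁, r₁, e₁, m₁, f₁⟩ := ha t s hs
  obtain ⟨s₂, r₂, e₂, m₂, f₂⟩ := hb (t + 1) s₁ (hs.of_frame m₁ f₁)
  have e₃ : s₂.reg (regTmp t) = v := by
    rw [f₂ _ (fun i hi => by simp only [regTmp]; omega), e₁]
  have e₄ : (op (regTmp t) (regTmp (t + 1))).eval s₂ = g v w := by rw [hop, e₃, e₂]
  refine ⟨_, r₁.seq (r₂.seq (Runs.assign _ _ _ (by rw [e₄]; exact hg))), ?_, ?_, ?_⟩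
  · simp [e₄]
  · simp [m₂, m₁]
  · intro r hr
    simp only [Function.update_of_ne (hr t le_rfl)]
    rw [f₂ r (fun i hi => hr i (by omega)), f₁ r hr]

/-- Compiled expressions compute the value of the expression, on words with more than `e.deg J`
digits to the base `n + 2`. -/
theorem Expr.compile_evaluates {J n k : ℕ} {σ : Store} (hσ : σ.Bounded J n) (e : Expr)
    (hk : e.deg J < k) : Evaluates n k σ e.compile e.cost (e.eval n σ) := by
  have hW : e.eval n σ < (n + 2) ^ k :=
    (e.eval_le hσ).trans_lt (Nat.pow_lt_pow_right (by omega) hk)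
  induction e with
  | num c => exact .leaf (fun _ _ => rfl) hW
  | size => exact .leaf (fun _ hs => hs.1) hW
  | var x => exact .leaf (fun _ hs => hs.2.1 x) hW
  | add a b ha hb | sub a b ha hb | mul a b ha hb =>
    simp only [Expr.deg] at hk
    have ha := ha (by omega) ((a.eval_le hσ).trans_lt (Nat.pow_lt_pow_right (by omega) (by omega)))
    have hb := hb (by omega) ((b.eval_le hσ).trans_lt (Nat.pow_lt_pow_right (by omega) (by omega)))
    first
      | exact ha.binary hb .add (· + ·) (fun _ _ _ => rfl) hW
      | exact ha.binary hb .sub (· - ·) (fun _ _ _ => rfl) hW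
      | exact ha.binary hb .mul (· * ·) (fun _ _ _ => rfl) hW
  | load a ha =>
    simp only [Expr.deg] at hk
    have ha := ha (by omega) ((a.eval_le hσ).trans_lt (Nat.pow_lt_pow_right (by omega) (by omega)))
    intro t s hs
    obtain ⟨s₁, r₁, e₁, m₁, f₁⟩ := ha t s hs
    have e₂ : (Operation.load (regTmp t)).eval s₁ = (Expr.load a).eval n σ := by
      simp only [Operation.eval, Expr.eval, e₁, m₁, hs.2.2]
    refine ⟨_, r₁.seq (Runs.assign _ _ _ (by rw [e₂]; exact hW)), ?_, ?_, ?_⟩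
    · simp [e₂]
    · simp [m₁]
    · intro r hr
      simp only [Function.update_of_ne (hr t le_rfl)]
      rw [f₁ r hr]

/-- The loop counters and loop bounds at depths below `d` are the same in both states. -/
def SameLoops (d : ℕ) (s s' : State) : Prop :=
  ∀ i < d, s'.reg (regCounter i) = s.reg (regCounter i) ∧ s'.reg (regBound i) = s.reg (regBound i)

theorem SameLoops.trans {d : ℕ} {s s' s'' : State} (h : SameLoops d s s')
    (h' : SameLoops d s' s'') :
    SameLoops d s s'' := fun i hi => ⟨(h' i hi).1.trans (h i hi).1, (h' i hi).2.trans (h i hi).2⟩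

theorem SameLoops.of_frame {s s' : State} {t : ℕ}
    (hr : ∀ r, (∀ i, t ≤ i → r ≠ regTmp i) → s'.reg r = s.reg r) (d : ℕ) : SameLoops d s s' :=
  fun i _ => ⟨hr _ (fun j _ => by simp only [regTmp, regCounter]; omega),
    hr _ (fun j _ => by simp only [regTmp, regBound]; omega)⟩

/-- A bounded number of iterations stays below the cut-off. -/
theorem linear_le_pow (a b n J : ℕ) (h : a + b + 1 ≤ J) : a * n + b ≤ (n + 2) ^ J := by
  have h1 : a + b ≤ (n + 2) ^ (a + b) := (Nat.lt_pow_self (by omega)).le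
  have h2 : (n + 2) ^ (a + b + 1) ≤ (n + 2) ^ J := Nat.pow_le_pow_right (by omega) h
  have h3 : (a + b) * (n + 2) ≤ (n + 2) ^ (a + b + 1) := by
    rw [pow_succ]; exact Nat.mul_le_mul_right _ h1
  nlinarith

theorem Store.Bounded.set {J n : ℕ} {σ : Store} (hσ : σ.Bounded J n) (x : ℕ) {v : ℕ}
    (hv : v ≤ (n + 2) ^ J) : (σ.set x v).Bounded J n := by
  refine ⟨fun y => ?_, hσ.2⟩
  rw [Store.set_var]
  split_ifs
  exacts [hv, hσ.1 y]

theorem Store.Bounded.put {J n : ℕ} {σ : Store} (hσ : σ.Bounded J n) (x : ℕ) {v : ℕ}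
    (hv : v ≤ (n + 2) ^ J) : (σ.put x v).Bounded J n := by
  refine ⟨hσ.1, fun y => ?_⟩
  rw [Store.put_mem]
  split_ifs
  exacts [hv, hσ.2 y]

/-- Compiled commands have the effect described by `Cmd.exec`, within `Cmd.cost` steps. -/
theorem Cmd.compile_runs {J n k : ℕ} (c : Cmd) (hk : c.deg J < k) (hJ : c.slope ≤ J) (d : ℕ)
    (σ : Store) (s : State) (hσ : σ.Bounded J n) (hs : Represents n σ s) :
    ∃ t s', Runs ((n + 2) ^ k) (c.compile J d) s t s' ∧ t ≤ c.cost J n ∧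
      Represents n (c.exec J n σ) s' ∧ (c.exec J n σ).Bounded J n ∧ SameLoops d s s' := by
  induction c generalizing d σ s with
  | skip => exact ⟨1, s, .skip s, le_rfl, hs, hσ, fun _ _ => ⟨rfl, rfl⟩⟩
  | set x e =>
    obtain ⟨s₁, r₁, e₁, m₁, f₁⟩ := (e.clip J).compile_evaluates hσ hk 0 s hs
    have hs₁ := hs.of_frame m₁ f₁
    rw [Expr.eval_clip] at e₁
    have hlt : s₁.reg (regTmp 0) < (n + 2) ^ k := by
      rw [e₁, ← Expr.eval_clip]
      exact (Expr.eval_le hσ _).trans_lt (Nat.pow_lt_pow_right (by omega) hk)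
    refine ⟨_, _, r₁.seq (Runs.assign _ _ _ hlt), le_rfl, ⟨?_, fun y => ?_, ?_⟩,
      hσ.set x (min_le_right _ _), ?_⟩
    · simp [regVar, hs₁.1]
    · have := hs₁.2.1 y
      by_cases hy : y = x
      · simp [hy, Cmd.exec, Operation.eval, e₁]
      · have : regVar y ≠ regVar x := by simp only [regVar]; omega
        simp [hy, this, Cmd.exec, hs₁.2.1 y]
    · simp [Cmd.exec, hs₁.2.2]
    · refine (SameLoops.of_frame f₁ d).trans fun i _ => ?_
      have h1 : regCounter i ≠ regVar x := by simp only [regVar, regCounter]; omega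
      have h2 : regBound i ≠ regVar x := by simp only [regVar, regBound]; omega
      simp [h1, h2]
  | store a e =>
    simp only [Cmd.deg] at hk
    obtain ⟨s₁, r₁, e₁, m₁, f₁⟩ := a.compile_evaluates (k := k) hσ (by omega) 0 s hs
    have hs₁ := hs.of_frame m₁ f₁
    obtain ⟨s₂, r₂, e₂, m₂, f₂⟩ := (e.clip J).compile_evaluates (k := k) hσ (by omega) 1 s₁ hs₁
    have hs₂ := hs₁.of_frame m₂ f₂
    rw [Expr.eval_clip] at e₂
    have e₃ : s₂.reg (regTmp 0) = a.eval n σ := by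
      rw [f₂ _ (fun i hi => by simp only [regTmp]; omega), e₁]
    refine ⟨_, _, r₁.seq (r₂.seq (Runs.store _ _ _)), le_rfl, ⟨hs₂.1, hs₂.2.1, ?_⟩,
      hσ.put _ (min_le_right _ _), ?_⟩
    · simp [Cmd.exec, Store.put, e₂, e₃, hs₂.2.2]
    · exact (SameLoops.of_frame f₁ d).trans (SameLoops.of_frame f₂ d)
  | seq c c' hc hc' =>
    simp only [Cmd.deg, Cmd.slope] at hk hJ
    obtain ⟨t₁, s₁, r₁, l₁, h₁, b₁, f₁⟩ := hc (by omega) (by omega) d σ s hσ hs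
    obtain ⟨t₂, s₂, r₂, l₂, h₂, b₂, f₂⟩ := hc' (by omega) (by omega) d _ s₁ b₁ h₁
    exact ⟨_, _, r₁.seq r₂, add_le_add l₁ l₂, h₂, b₂, f₁.trans f₂⟩
  | ite e c c' hc hc' =>
    simp only [Cmd.deg, Cmd.slope] at hk hJ
    obtain ⟨s₁, r₁, e₁, m₁, f₁⟩ := e.compile_evaluates (k := k) hσ (by omega) 0 s hs
    obtain ⟨s₂, r₂, e₂, m₂, f₂⟩ := Evaluates.leaf (n := n) (k := k) (σ := σ) (op := .const 0)
      (fun _ _ => rfl) (by positivity) 1 s₁ (hs.of_frame m₁ f₁)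
    have hs₂ := (hs.of_frame m₁ f₁).of_frame m₂ f₂
    have e₃ : s₂.reg (regTmp 0) = e.eval n σ := by
      rw [f₂ _ (fun i hi => by simp only [regTmp]; omega), e₁]
    have f₃ := (SameLoops.of_frame f₁ d).trans (SameLoops.of_frame f₂ d)
    simp only [Cmd.exec, Cmd.cost, Cmd.compile]
    split_ifs with h0
    · obtain ⟨t, s', r, l, h, b, f⟩ := hc' (by omega) (by omega) d σ s₂ hσ hs₂
      exact ⟨_, _, r₁.seq (r₂.seq (Runs.ite_true (by simp [Test.Holds, e₃, e₂, h0]) r)),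
        by omega, h, b, f₃.trans f⟩
    · obtain ⟨t, s', r, l, h, b, f⟩ := hc (by omega) (by omega) d σ s₂ hσ hs₂
      exact ⟨_, _, r₁.seq (r₂.seq (Runs.ite_false (by simp [Test.Holds, e₃, e₂, h0]) r)),
        by omega, h, b, f₃.trans f⟩
  | loop x a b c hc =>
    simp only [Cmd.deg, Cmd.slope] at hk hJ
    have hlin : a * n + b ≤ (n + 2) ^ J := linear_le_pow a b n J (by omega)
    have hlin' : a * n + b < (n + 2) ^ k :=
      (linear_le_pow a b n (a + b + 1) le_rfl).trans_lt (Nat.pow_lt_pow_right (by omega) (by omega))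
    obtain ⟨s₁, r₁, e₁, m₁, f₁⟩ := (Expr.add (.mul (.num a) .size) (.num b)).compile_evaluates
      (k := k) hσ (by simp only [Expr.deg]; omega) 0 s hs
    have hs₁ := hs.of_frame m₁ f₁
    simp only [Expr.eval] at e₁
    -- the loop proper, from the state in which `i` iterations have been done
    have main : ∀ m i, i + m = a * n + b → ∀ s, s.reg (regBound d) = a * n + b →
        s.reg (regCounter d) = i →
        Represents n (iter (fun j s => c.exec J n (s.set x j)) i σ) s →
        (iter (fun j s => c.exec J n (s.set x j)) i σ).Bounded J n →
        ∃ t s', Runs ((n + 2) ^ k) (.while (.lt (regCounter d) (regBound d))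
            (.seq (.assign (regVar x) (.copy (regCounter d)))
            (.seq (c.compile J (d + 1))
            (.seq (.assign (regTmp 0) (.const 1))
              (.assign (regCounter d) (.add (regCounter d) (regTmp 0))))))) s t s' ∧
          t ≤ 1 + m * (c.cost J n + 4) ∧
          Represents n (iter (fun j s => c.exec J n (s.set x j)) (a * n + b) σ) s' ∧
          (iter (fun j s => c.exec J n (s.set x j)) (a * n + b) σ).Bounded J n ∧
          SameLoops d s s' := by
      intro m
      induction m with
      | zero =>
        intro i hi s hb hc hs hσ
        obtain rfl : i = a * n + b := by omega
        exact ⟨1, s, Runs.while_false (by simp [Test.Holds, hb, hc]), by simp, hs, hσ,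
          fun _ _ => ⟨rfl, rfl⟩⟩
      | succ m ih =>
        intro i hi s hb hcnt hs hσ
        have hi' : i < a * n + b := by omega
        obtain ⟨t₂, s₂, r₂, l₂, h₂, b₂, f₂⟩ := hc (by omega) (by omega) (d + 1)
          ((iter (fun j s => c.exec J n (s.set x j)) i σ).set x i)
          { s with reg := Function.update s.reg (regVar x) i } (hσ.set x (by omega))
          ⟨by simp [regVar, hs.1], fun y => by
            have h := hs.2.1 y
            by_cases hy : y = x
            · simp [hy]
            · have h' : regVar y ≠ regVar x := by simp only [regVar]; omega
              simp [hy, h', h], hs.2.2⟩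
        have hcv : ∀ i, regCounter i ≠ regVar x := fun i => by
          simp only [regVar, regCounter]; omega
        have hbv : ∀ i, regBound i ≠ regVar x := fun i => by
          simp only [regVar, regBound]; omega
        have c₂ : s₂.reg (regCounter d) = i := by
          rw [(f₂ d (by omega)).1]; simp [hcv, hcnt]
        have d₂ : s₂.reg (regBound d) = a * n + b := by
          rw [(f₂ d (by omega)).2]; simp [hbv, hb]
        have hct : regCounter d ≠ regTmp 0 := by simp only [regTmp, regCounter]; omega
        have htc : regTmp 0 ≠ regCounter d := hct.symm
        let s₃ : State := { s₂ with reg := Function.update s₂.reg (regTmp 0) 1 }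
        let s₄ : State := { s₃ with reg := Function.update s₃.reg (regCounter d) (i + 1) }
        have r₃ : Runs ((n + 2) ^ k) (.assign (regTmp 0) (.const 1)) s₂ 1 s₃ :=
          Runs.assign _ _ _ (by simp only [Operation.eval]; omega)
        have e₃ : (Operation.add (regCounter d) (regTmp 0)).eval s₃ = i + 1 := by
          simp [s₃, Operation.eval, hct, c₂]
        have r₄ : Runs ((n + 2) ^ k)
            (.assign (regCounter d) (.add (regCounter d) (regTmp 0))) s₃ 1 s₄ := by
          have := Runs.assign (W := (n + 2) ^ k) (regCounter d)
            (.add (regCounter d) (regTmp 0)) s₃ (by rw [e₃]; omega)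
          rwa [e₃] at this
        have h0c : (0 : ℕ) ≠ regCounter d := by simp only [regCounter]; omega
        have h0t : (0 : ℕ) ≠ regTmp 0 := by simp only [regTmp]; omega
        have hbc : regBound d ≠ regCounter d := by simp only [regBound, regCounter]; omega
        have hbt : regBound d ≠ regTmp 0 := by simp only [regBound, regTmp]; omega
        obtain ⟨t₅, s₅, r₅, l₅, h₅, b₅, f₅⟩ := ih (i + 1) (by omega) s₄
          (by simp [s₄, s₃, hbc, hbt, d₂]) (by simp [s₄])
          ⟨by simp [s₄, s₃, h0c, h0t, h₂.1], fun y => by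
            have h1 : regVar y ≠ regCounter d := by simp only [regVar, regCounter]; omega
            have h2 : regVar y ≠ regTmp 0 := by simp only [regVar, regTmp]; omega
            simp [s₄, s₃, h1, h2, iter, h₂.2.1], h₂.2.2⟩ b₂
        have r₁ : Runs ((n + 2) ^ k) (.assign (regVar x) (.copy (regCounter d))) s 1
            { s with reg := Function.update s.reg (regVar x) i } := by
          have := Runs.assign (W := (n + 2) ^ k) (regVar x) (.copy (regCounter d)) s
            (by simp only [Operation.eval]; omega)
          simpa only [Operation.eval, hcnt] using this
        refine ⟨_, s₅, Runs.while_true (by simp [Test.Holds, hb, hcnt, hi'])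
          (r₁.seq (r₂.seq (r₃.seq r₄))) r₅, ?_, h₅, b₅, SameLoops.trans (fun e he => ?_) f₅⟩
        · rw [Nat.succ_mul]; omega
        · have h1 : regCounter e ≠ regCounter d := by simp only [regCounter]; omega
          have h2 : regBound e ≠ regCounter d := by simp only [regBound, regCounter]; omega
          have h3 : regCounter e ≠ regTmp 0 := by simp only [regTmp, regCounter]; omega
          have h4 : regBound e ≠ regTmp 0 := by simp only [regBound, regTmp]; omega
          have := f₂ e (by omega)
          simp only [Function.update_of_ne (hcv e), Function.update_of_ne (hbv e)] at this
          simp [s₄, s₃, h1, h2, h3, h4, this]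
    let s₂ : State := { s₁ with reg := Function.update s₁.reg (regBound d) (a * n + b) }
    let s₃ : State := { s₂ with reg := Function.update s₂.reg (regCounter d) 0 }
    have r₂ : Runs ((n + 2) ^ k) (.assign (regBound d) (.copy (regTmp 0))) s₁ 1 s₂ := by
      have := Runs.assign (W := (n + 2) ^ k) (regBound d) (.copy (regTmp 0)) s₁
        (by simp only [Operation.eval]; omega)
      simpa only [Operation.eval, e₁] using this
    have r₃ : Runs ((n + 2) ^ k) (.assign (regCounter d) (.const 0)) s₂ 1 s₃ :=
      Runs.assign _ _ _ (by simp only [Operation.eval]; omega)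
    have h0c : (0 : ℕ) ≠ regCounter d := by simp only [regCounter]; omega
    have h0b : (0 : ℕ) ≠ regBound d := by simp only [regBound]; omega
    have hbc : regBound d ≠ regCounter d := by simp only [regBound, regCounter]; omega
    obtain ⟨t, s', r, l, h, b, f⟩ := main (a * n + b) 0 (by omega) s₃
      (by simp [s₃, s₂, hbc]) (by simp [s₃])
      ⟨by simp [s₃, s₂, h0c, h0b, hs₁.1], fun y => by
        have h1 : regVar y ≠ regCounter d := by simp only [regVar, regCounter]; omega
        have h2 : regVar y ≠ regBound d := by simp only [regVar, regBound]; omega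
        simp [s₃, s₂, h1, h2, hs₁.2.1, iter], hs₁.2.2⟩ hσ
    refine ⟨_, s', r₁.seq (r₂.seq (r₃.seq r)), ?_, h, b,
      ((SameLoops.of_frame f₁ d).trans fun e he => ?_).trans f⟩
    · simp only [Expr.cost, Cmd.cost]; omega
    · have h1 : regCounter e ≠ regCounter d := by simp only [regCounter]; omega
      have h2 : regBound e ≠ regCounter d := by simp only [regBound, regCounter]; omega
      have h3 : regCounter e ≠ regBound d := by simp only [regBound, regCounter]; omega
      have h4 : regBound e ≠ regBound d := by simp only [regBound]; omega
      simp [s₃, s₂, h1, h2, h3, h4]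

/-- The running time is polynomial, of the degree `Cmd.depth`. -/
theorem Cmd.cost_le (J : ℕ) (c : Cmd) : ∃ C, ∀ n, c.cost J n ≤ C * (n + 1) ^ c.depth := by
  have mono : ∀ {n i j : ℕ}, i ≤ j → (n + 1) ^ i ≤ (n + 1) ^ j := fun h =>
    Nat.pow_le_pow_right (by omega) h
  have two : ∀ {c d : Cmd} {C D : ℕ} (n : ℕ), c.cost J n ≤ C * (n + 1) ^ c.depth →
      d.cost J n ≤ D * (n + 1) ^ d.depth →
      c.cost J n + d.cost J n ≤ (C + D) * (n + 1) ^ max c.depth d.depth := by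
    intro c d C D n h h'
    rw [add_mul]
    exact add_le_add (h.trans (Nat.mul_le_mul_left _ (mono (le_max_left _ _))))
      (h'.trans (Nat.mul_le_mul_left _ (mono (le_max_right _ _))))
  have one : ∀ n i : ℕ, 1 ≤ (n + 1) ^ i := fun n i => Nat.one_le_pow _ _ (by omega)
  induction c with
  | skip => exact ⟨1, fun n => by simp [Cmd.cost, Cmd.depth]⟩
  | set x e => exact ⟨(e.clip J).cost + 1, fun n => by simp [Cmd.cost, Cmd.depth]⟩
  | store a e => exact ⟨a.cost + ((e.clip J).cost + 1), fun n => by simp [Cmd.cost, Cmd.depth]⟩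
  | seq c d hc hd =>
    obtain ⟨C, hC⟩ := hc
    obtain ⟨D, hD⟩ := hd
    exact ⟨C + D, fun n => two n (hC n) (hD n)⟩
  | ite e c d hc hd =>
    obtain ⟨C, hC⟩ := hc
    obtain ⟨D, hD⟩ := hd
    refine ⟨(C + D) + (e.cost + 2), fun n => ?_⟩
    have h := two n (hC n) (hD n)
    have h1 := Nat.mul_le_mul_left (e.cost + 2) (one n (max c.depth d.depth))
    simp only [Cmd.cost, Cmd.depth, add_mul _ (e.cost + 2)]
    omega
  | loop x a b c hc =>
    obtain ⟨C, hC⟩ := hc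
    refine ⟨8 + (a + b) * (C + 4), fun n => ?_⟩
    have h1 : c.cost J n + 4 ≤ (C + 4) * (n + 1) ^ c.depth := by
      have := Nat.mul_le_mul_left 4 (one n c.depth)
      rw [add_mul]
      exact add_le_add (hC n) (by simpa using this)
    have h2 : a * n + b ≤ (a + b) * (n + 1) ^ (if a = 0 then 0 else 1) := by
      split_ifs with h
      · simp [h]
      · nlinarith
    simp only [Cmd.cost, Cmd.depth]
    have h3 := Nat.mul_le_mul h2 h1
    have h4 := Nat.mul_le_mul_left 8 (one n ((if a = 0 then 0 else 1) + c.depth))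
    rw [mul_one] at h4
    rw [add_mul 8]
    refine add_le_add h4 (h3.trans (le_of_eq ?_))
    rw [pow_add]
    ring

theorem iter_inv {f : ℕ → Store → Store} {I : ℕ → Store → Prop} {k : ℕ} {σ : Store} (h0 : I 0 σ)
    (hs : ∀ j s, j < k → I j s → I (j + 1) (f j s)) : I k (iter f k σ) := by
  induction k with
  | zero => exact h0
  | succ k ih => exact hs k _ (by omega) (ih fun j s hj => hs j s (by omega))

/-- The rule for a single loop with the invariant `I`, which must not depend on the loop variable.
-/
theorem Cmd.loop_rule {J n x a b : ℕ} {c : Cmd} {σ : Store} (I : ℕ → Store → Prop)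
    (hI : ∀ j s v, I j s → I j (s.set x v)) (h0 : I 0 σ)
    (hs : ∀ j s, j < a * n + b → s.var x = j →
      (∀ y, y ≠ x → y ∉ c.writes → s.var y = σ.var y) → (c.pure = true → s.mem = σ.mem) →
      I j s → I (j + 1) (c.exec J n s)) :
    I (a * n + b) ((Cmd.loop x a b c).exec J n σ) := by
  simp only [Cmd.exec]
  refine (iter_inv (I := fun j s => (∀ y, y ≠ x → y ∉ c.writes → s.var y = σ.var y) ∧
    (c.pure = true → s.mem = σ.mem) ∧ I j s) ⟨fun _ _ _ => rfl, fun _ => rfl, h0⟩ ?_).2.2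
  rintro j s hj ⟨hf, hm, h⟩
  have hf' : ∀ y, y ≠ x → y ∉ c.writes → (s.set x j).var y = σ.var y := fun y hy hy' => by
    rw [Store.set_var, if_neg hy, hf y hy hy']
  refine ⟨fun y hy hy' => ?_, fun hp => ?_, hs j _ hj (by simp) hf' hm (hI _ _ _ h)⟩
  · rw [Cmd.exec_frame _ _ _ _ hy', hf' y hy hy']
  · rw [Cmd.exec_pure _ _ _ _ hp, Store.set_mem, hm hp]

/-- Nested loops, the outermost first, each given by its variable and the two coefficients of its
number of iterations. -/
def Cmd.loops : List (ℕ × ℕ × ℕ) → Cmd → Cmd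
  | [], c => c
  | p :: L, c => .loop p.1 p.2.1 p.2.2 (.loops L c)

/-- The list consists of possible values of the variables of the nested loops `L`. -/
def InRange (n : ℕ) : List (ℕ × ℕ × ℕ) → List ℕ → Prop
  | [], l => l = []
  | p :: L, l => ∃ i l', l = i :: l' ∧ i < p.2.1 * n + p.2.2 ∧ InRange n L l'

theorem Cmd.mem_writes_loops {y : ℕ} {c : Cmd} (L : List (ℕ × ℕ × ℕ)) :
    y ∈ (Cmd.loops L c).writes ↔ y ∈ L.map Prod.fst ∨ y ∈ c.writes := by
  induction L with
  | nil => simp [Cmd.loops]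
  | cons p L ih => simp [Cmd.loops, Cmd.writes, ih, or_assoc]

/-- The rule for nested loops: if the body maintains the invariant `I`, establishes the property `Q`
for its own index tuple and maintains it for all others, then `Q` holds for all index tuples at the
end. -/
theorem Cmd.loops_rule {J n : ℕ} (L : List (ℕ × ℕ × ℕ)) (c : Cmd) (σ : Store) (I : Store → Prop)
    (Q : List ℕ → Store → Prop)
    (hI : ∀ s x v, x ∈ L.map Prod.fst → I s → I (s.set x v))
    (hQ : ∀ l s x v, x ∈ L.map Prod.fst → Q l s → Q l (s.set x v))
    (hn : (L.map Prod.fst).Nodup) (hw : ∀ x ∈ L.map Prod.fst, x ∉ c.writes)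
    (hc : ∀ l s, InRange n L l → L.map (fun p => s.var p.1) = l →
      (∀ y, y ∉ L.map Prod.fst → y ∉ c.writes → s.var y = σ.var y) → I s →
      I (c.exec J n s) ∧ Q l (c.exec J n s) ∧
        ∀ l', InRange n L l' → l' ≠ l → Q l' s → Q l' (c.exec J n s))
    (h0 : I σ) :
    I ((Cmd.loops L c).exec J n σ) ∧ ∀ l, InRange n L l → Q l ((Cmd.loops L c).exec J n σ) := by
  induction L generalizing σ I Q with
  | nil =>
    have h := hc [] σ rfl rfl (fun _ _ _ => rfl) h0
    refine ⟨h.1, fun l hl => ?_⟩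
    obtain rfl : l = [] := hl
    exact h.2.1
  | cons p L ih =>
    obtain ⟨x, a, b⟩ := p
    simp only [List.map_cons, List.nodup_cons, List.mem_cons] at hI hQ hn hw hc
    simp only [Cmd.loops, Cmd.exec]
    have key : ∀ s', s' = iter (fun j s => (Cmd.loops L c).exec J n (s.set x j)) (a * n + b) σ →
        I s' ∧ (∀ y, y ≠ x → y ∉ L.map Prod.fst → y ∉ c.writes → s'.var y = σ.var y) ∧
          ∀ i < a * n + b, ∀ l, InRange n L l → Q (i :: l) s' := by
      rintro _ rfl
      refine iter_inv (I := fun j s => I s ∧ (∀ y, y ≠ x → y ∉ L.map Prod.fst → y ∉ c.writes →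
          s.var y = σ.var y) ∧ ∀ i < j, ∀ l, InRange n L l → Q (i :: l) s)
        ⟨h0, fun _ _ _ _ => rfl, fun i hi => absurd hi (by omega)⟩ ?_
      rintro j s hj ⟨hs, hf, hq⟩
      have := ih (s.set x j) (fun s => I s ∧ ∀ i < j, ∀ l, InRange n L l → Q (i :: l) s)
        (fun l s => Q (j :: l) s)
        (fun s x v hx h => ⟨hI s x v (.inr hx) h.1,
          fun i hi l hl => hQ _ _ _ _ (.inr hx) (h.2 i hi l hl)⟩)
        (fun l s x v hx h => hQ _ _ _ _ (.inr hx) h) hn.2 (fun x hx => hw x (.inr hx))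
        (fun l s' hl hv hf' hI' => ?_)
        ⟨hI _ _ _ (.inl rfl) hs, fun i hi l hl => hQ _ _ _ _ (.inl rfl) (hq i hi l hl)⟩
      · refine ⟨this.1.1, fun y hy hy' hy'' => ?_, fun i hi l hl => ?_⟩
        · rw [Cmd.exec_frame _ _ _ _ (by rw [Cmd.mem_writes_loops]; tauto)]
          simp [hy, hf y hy hy' hy'']
        · rcases Nat.lt_succ_iff_lt_or_eq.1 hi with hi | rfl
          · exact this.1.2 i hi l hl
          · exact this.2 l hl
      · have hx : s'.var x = j := by
          rw [hf' x hn.1 (hw x (.inl rfl))]; simp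
        have := hc (j :: l) s' ⟨j, l, rfl, hj, hl⟩ (by simp [hx, hv])
          (fun y hy hy' => by
            rw [not_or] at hy
            rw [hf' y hy.2 hy', Store.set_var, if_neg hy.1, hf y hy.1 hy.2 hy']) hI'.1
        refine ⟨⟨this.1, fun i hi l' hl' => this.2.2 _ ⟨i, l', rfl, hi.trans hj, hl'⟩ ?_
          (hI'.2 i hi l' hl')⟩, this.2.1, fun l' hl' hne h => this.2.2 _ ⟨j, l', rfl, hj, hl'⟩ ?_ h⟩
        · simp; omega
        · simpa using hne
    replace key := key _ rfl
    refine ⟨key.1, fun l hl => ?_⟩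
    obtain ⟨i, l', rfl, hi, hl'⟩ := hl
    exact key.2.2 i hi l' hl'

end RAM

/-! ### Induced paths in permutation graphs -/

section Graph

variable {V : Type*} {G : SimpleGraph V}

/-- A transitive orientation `r` of the complement of `G`: two distinct vertices are adjacent
exactly when they are incomparable. -/
structure IsCocomparability (G : SimpleGraph V) (r : V → V → Prop) : Prop where
  irrefl : ∀ u, ¬ r u u
  trans : ∀ u v w, r u v → r v w → r u w
  adj_iff : ∀ u v, G.Adj u v ↔ u ≠ v ∧ ¬ r u v ∧ ¬ r v u

theorem IsCocomparability.flip {r : V → V → Prop} (h : IsCocomparability G r) :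
    IsCocomparability G (fun u v => r v u) where
  irrefl := h.irrefl
  trans u v w h₁ h₂ := h.trans w v u h₂ h₁
  adj_iff u v := by rw [h.adj_iff]; tauto

/-- A pair is oriented when the permutation keeps its order; the numbering `f` is a linear
extension. -/
theorem IsPermutationGraph.exists_isCocomparability (h : IsPermutationGraph G) :
    ∃ (r : V → V → Prop) (f : V → ℕ), IsCocomparability G r ∧
      ∀ u v, r u v → f u < f v := by
  obtain ⟨n, f, π, h⟩ := h
  refine ⟨fun u v => f u < f v ∧ π (f u) < π (f v), fun v => f v, ⟨fun u hu => lt_irrefl _ hu.1,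
    fun u v w h₁ h₂ => ⟨h₁.1.trans h₂.1, h₁.2.trans h₂.2⟩, fun u v => ?_⟩,
    fun u v huv => huv.1⟩
  rw [h, mul_neg_iff]
  have h1 : (f u : ℕ) = f v → u = v := fun h => f.injective (Fin.ext h)
  have h2 : (π (f u) : ℕ) = π (f v) → u = v := fun h =>
    f.injective (π.injective (Fin.ext h))
  have h3 : u = v → (f u : ℕ) = f v := fun h => by rw [h]
  simp only [Fin.lt_def]
  by_cases huv : u = v
  · simp [huv]
  · simp only [huv, imp_false] at h1 h2
    simp only [ne_eq, huv, not_false_eq_true, true_and]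
    omega

/-- `v` is in the closed neighborhood of `u`. -/
def Near (G : SimpleGraph V) (u v : V) : Prop := u = v ∨ G.Adj u v

theorem IsCocomparability.not_near {r : V → V → Prop} (h : IsCocomparability G r) {u v : V} :
    ¬ Near G u v ↔ r u v ∨ r v u := by
  have := h.adj_iff u v
  have h1 := h.irrefl u
  constructor
  · intro hn; simp only [Near] at hn; tauto
  · rintro hr (rfl | ha)
    · tauto
    · tauto

/-- `z` is a neighbor of `w` that is in the closed neighborhood neither of `u` nor of `v`. Here
`u, v, w` are the last three vertices of a path; when the path has fewer vertices, the first one is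
repeated, and conditions on a repeated `w` are void. -/
def NewNbr (G : SimpleGraph V) (u v w z : V) : Prop :=
  G.Adj w z ∧ (u = w ∨ ¬ Near G u z) ∧ (v = w ∨ ¬ Near G v z)

/-- `Chain G k P N u v w`: there is a path with `k + 1` vertices and vertex set `P` ending with
`u, v, w` (the first vertex being repeated when there are fewer than three), each of whose vertices
is adjacent to the previous one but not in the closed neighborhoods of the two before that one.
The set `N` consists of the first vertex and the neighbors of all vertices but the last one. -/
inductive Chain (G : SimpleGraph V) : ℕ → Set V → Set V → V → V → V → Prop where
  | single (a : V) : Chain G 0 {a} {a} a a a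
  | step {k : ℕ} {P N : Set V} {u v w x : V} (h : Chain G k P N u v w) (hx : NewNbr G u v w x) :
      Chain G (k + 1) (insert x P) (N ∪ {z | NewNbr G u v w z}) v w x

namespace Chain

variable {k : ℕ} {P N : Set V} {u v w : V}

/-- The local condition makes a chain an induced path that runs monotonically through the diagram of
a permutation graph. Hence what its vertices but the last three see lies before its last vertex. -/
theorem direction {r : V → V → Prop} (hr : IsCocomparability G r) (h : Chain G k P N u v w) :
    (u = w ∧ v = w ∧ N = {w}) ∨ (u = v ∧ G.Adj v w ∧ ∀ z ∈ N, Near G v z) ∨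
      ∃ r, IsCocomparability G r ∧ G.Adj u v ∧ G.Adj v w ∧ r u w ∧
        ∀ z ∈ N, Near G u z ∨ Near G v z ∨ r z w := by
  induction h with
  | single a => exact .inl ⟨rfl, rfl, rfl⟩
  | @step k P N u v w x h hx ih =>
    right
    rcases ih with ⟨rfl, rfl, rfl⟩ | ⟨rfl, hvw, hN⟩ | ⟨r, hr, huv, hvw, huw, hN⟩
    · refine .inl ⟨rfl, hx.1, ?_⟩
      rintro z (hz | hz)
      exacts [.inl (Set.mem_singleton_iff.1 hz).symm, .inr hz.1]
    · right
      have hN' : ∀ r : V → V → Prop, ∀ z ∈ N ∪ {z | NewNbr G u u w z},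
          Near G u z ∨ Near G w z ∨ r z x := by
        rintro r z (hz | hz)
        exacts [.inl (hN z hz), .inr (.inl (.inr hz.1))]
      rcases hr.not_near.1 (hx.2.1.resolve_left hvw.ne) with h | h
      exacts [⟨r, hr, hvw, hx.1, h, hN' r⟩, ⟨_, hr.flip, hvw, hx.1, h, hN' fun u v => r v u⟩]
    · right
      have hne : u ≠ w := fun h => hr.irrefl w (h ▸ huw)
      have hux := hr.not_near.1 (hx.2.1.resolve_left hne)
      have hvx := hr.not_near.1 (hx.2.2.resolve_left hvw.ne)
      have hwx := (hr.adj_iff w x).1 hx.1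
      have huv' := (hr.adj_iff u v).1 huv
      have hvw' := (hr.adj_iff v w).1 hvw
      have ux : r u x := hux.resolve_right fun h => hwx.2.2 (hr.trans _ _ _ h huw)
      have vx : r v x := hvx.resolve_right fun h => huv'.2.1 (hr.trans _ _ _ ux h)
      refine ⟨r, hr, hvw, hx.1, vx, ?_⟩
      rintro z (hz | hz)
      · by_cases hv : Near G v z
        · exact .inl hv
        by_cases hw : Near G w z
        · exact .inr (.inl hw)
        right; right
        have hv' := hr.not_near.1 hv
        have hw' := hr.not_near.1 hw
        refine hr.trans _ _ _ (hv'.resolve_left fun hvz => ?_) vx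
        have hwz : r w z := hw'.resolve_right fun h => hvw'.2.1 (hr.trans _ _ _ hvz h)
        rcases hN z hz with h | h | h
        · exact hr.not_near.2 (.inl (hr.trans _ _ _ huw hwz)) h
        · exact hv h
        · exact hr.irrefl _ (hr.trans _ _ _ hwz h)
      · exact .inr (.inl (.inr hz.1))

/-- No vertex is counted twice: the new neighbors of the last vertex have not been seen before. -/
theorem disjoint {r : V → V → Prop} (hr : IsCocomparability G r) (h : Chain G k P N u v w) :
    Disjoint N {z | NewNbr G u v w z} := by
  rw [Set.disjoint_left]
  rintro z hz ⟨hwz, hu, hv⟩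
  rcases h.direction hr with ⟨rfl, rfl, rfl⟩ | ⟨rfl, hvw, hN⟩ | ⟨r, hr, huv, hvw, huw, hN⟩
  · exact hwz.ne (Set.mem_singleton_iff.1 hz).symm
  · exact hv.resolve_left hvw.ne (hN z hz)
  · have hne : u ≠ w := fun h => hr.irrefl w (h ▸ huw)
    rcases hN z hz with h | h | h
    · exact hu.resolve_left hne h
    · exact hv.resolve_left hvw.ne h
    · exact ((hr.adj_iff w z).1 hwz).2.2 h

theorem subset (h : Chain G k P N u v w) : P ⊆ N := by
  induction h with
  | single a => exact subset_rfl
  | step h hx ih => exact Set.insert_subset (.inr hx) (ih.trans Set.subset_union_left)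

theorem notMem {r : V → V → Prop} (hr : IsCocomparability G r) (h : Chain G k P N u v w) {x : V}
    (hx : NewNbr G u v w x) : x ∉ P := fun hP =>
  Set.disjoint_left.1 (h.disjoint hr) (h.subset hP) hx

theorem last_mem (h : Chain G k P N u v w) : u ∈ P ∧ v ∈ P ∧ w ∈ P := by
  induction h with
  | single a => simp
  | step h hx ih => exact ⟨.inr ih.2.1, .inr ih.2.2, .inl rfl⟩

/-- Together with `near_mem`: the set `N` and the new neighbors of the last vertex make up the
closed neighborhood of the chain. -/
theorem exists_near (h : Chain G k P N u v w) :
    ∀ z ∈ N ∪ {z | NewNbr G u v w z}, ∃ p ∈ P, Near G p z := by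
  have aux : ∀ z ∈ N, ∃ p ∈ P, Near G p z := by
    induction h with
    | single a => exact fun z hz => ⟨a, rfl, .inl (Set.mem_singleton_iff.1 hz).symm⟩
    | step h hx ih =>
      rintro z (hz | hz)
      · obtain ⟨p, hp, hpz⟩ := ih z hz
        exact ⟨p, .inr hp, hpz⟩
      · exact ⟨_, .inr h.last_mem.2.2, .inr hz.1⟩
  rintro z (hz | hz)
  exacts [aux z hz, ⟨w, h.last_mem.2.2, .inr hz.1⟩]

theorem near_mem (h : Chain G k P N u v w) {p z : V} (hp : p ∈ P) (hpz : Near G p z) :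
    z ∈ N ∪ {z | NewNbr G u v w z} := by
  have last : ∀ {k : ℕ} {P N : Set V} {u v w : V}, Chain G k P N u v w →
      (∀ p ∈ P, p ≠ w → ∀ z, Near G p z → z ∈ N) → ∀ z, Near G w z →
      z ∈ N ∪ {z | NewNbr G u v w z} := by
    rintro k P N u v w h ih z (rfl | hz)
    · exact .inl (h.subset h.last_mem.2.2)
    · by_cases hu : u ≠ w ∧ Near G u z
      · exact .inl (ih u h.last_mem.1 hu.1 z hu.2)
      by_cases hv : v ≠ w ∧ Near G v z
      · exact .inl (ih v h.last_mem.2.1 hv.1 z hv.2)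
      · exact .inr ⟨hz, by tauto, by tauto⟩
  have aux : ∀ p ∈ P, p ≠ w → ∀ z, Near G p z → z ∈ N := by
    clear hp hpz
    induction h with
    | single a => exact fun p hp hne => absurd (Set.mem_singleton_iff.1 hp) hne
    | @step k P N u v w x h hx ih =>
      rintro p (rfl | hp) hne z hz
      · exact absurd rfl hne
      · by_cases hpw : p = w
        · exact last h ih z (hpw ▸ hz)
        · exact .inl (ih p hp hpw z hz)
  by_cases hpw : p = w
  · exact last h aux z (hpw ▸ hpz)
  · exact .inl (aux p hp hpw z hpz)

/-- All sets between a chain and its closed neighborhood are connected. -/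
theorem connected (h : Chain G k P N u v w) {S : Set V} (hP : P ⊆ S)
    (hS : S ⊆ N ∪ {z | NewNbr G u v w z}) : (G.induce S).Connected := by
  have reach : ∀ p (hp : p ∈ P), (G.induce S).Reachable ⟨p, hP hp⟩ ⟨w, hP h.last_mem.2.2⟩ := by
    clear hS
    induction h with
    | single a =>
      intro p hp
      obtain rfl := Set.mem_singleton_iff.1 hp
      exact .refl _
    | @step k P N u v w x h hx ih =>
      rintro p (rfl | hp)
      · exact .refl _
      · refine (ih (fun y hy => hP (.inr hy)) p hp).trans (SimpleGraph.Adj.reachable ?_)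
        exact hx.1
  have all : ∀ z : S, (G.induce S).Reachable z ⟨w, hP h.last_mem.2.2⟩ := by
    rintro ⟨z, hz⟩
    obtain ⟨p, hp, rfl | hpz⟩ := h.exists_near z (hS hz)
    · exact reach _ hp
    · refine SimpleGraph.Reachable.trans (SimpleGraph.Adj.reachable ?_) (reach p hp)
      exact hpz.symm
  exact (SimpleGraph.connected_iff _).2
    ⟨fun x y => (all x).trans (all y).symm, ⟨⟨w, hP h.last_mem.2.2⟩⟩⟩

theorem ncard_eq [Finite V] {r : V → V → Prop} (hr : IsCocomparability G r)
    (h : Chain G k P N u v w) : P.ncard = k + 1 := by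
  induction h with
  | single a => simp
  | step h hx ih => rw [Set.ncard_insert_of_notMem (h.notMem hr hx), ih]

end Chain

/-- A connected set contains a chain that dominates it: a shortest path from its leftmost to its
rightmost vertex in the order `f`. A vertex that is not dominated would lie on one side of the whole
path. -/
theorem exists_chain [Finite V] {r : V → V → Prop} {f : V → ℕ} (hr : IsCocomparability G r)
    (hrf : ∀ u v, r u v → f u < f v) {S : Set V}
    (hS : (G.induce S).Connected) :
    ∃ k P N u v w, Chain G k P N u v w ∧ P ⊆ S ∧ S ⊆ N ∪ {z | NewNbr G u v w z} := by
  obtain ⟨⟨s, hs⟩⟩ := hS.nonempty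
  obtain ⟨a, ha, hmin⟩ := S.toFinite.exists_minimalFor f S ⟨s, hs⟩
  obtain ⟨b, hb, hmax⟩ := S.toFinite.exists_maximalFor f S ⟨s, hs⟩
  obtain ⟨p, hp⟩ := hS.exists_walk_length_eq_dist ⟨a, ha⟩ ⟨b, hb⟩
  have dist_eq : ∀ i ≤ p.length, (G.induce S).dist ⟨a, ha⟩ (p.getVert i) = i := by
    intro i hi
    have h1 := SimpleGraph.dist_le (p.take i)
    have h2 := SimpleGraph.dist_le (p.drop i)
    have h3 := hS.dist_triangle (u := ⟨a, ha⟩) (v := p.getVert i) (w := ⟨b, hb⟩)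
    rw [SimpleGraph.Walk.take_length] at h1
    rw [SimpleGraph.Walk.drop_length] at h2
    omega
  have far : ∀ i j, i + 2 ≤ j → j ≤ p.length →
      ¬ Near G (p.getVert i : V) (p.getVert j : V) := by
    intro i j hij hj hn
    have h1 := dist_eq i (by omega)
    have h2 := dist_eq j hj
    rcases hn with h | h
    · rw [Subtype.ext h] at h1; omega
    · have h3 := hS.dist_triangle (u := ⟨a, ha⟩) (v := p.getVert i) (w := p.getVert j)
      have h4 : (G.induce S).dist (p.getVert i) (p.getVert j) = 1 :=
        SimpleGraph.dist_eq_one_iff_adj.2 h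
      omega
  have chain : ∀ i ≤ p.length, ∃ P N, Chain G i P N (p.getVert (i - 2) : V)
      (p.getVert (i - 1) : V) (p.getVert i : V) ∧ P ⊆ S ∧ ∀ j ≤ i, (p.getVert j : V) ∈ P := by
    intro i
    induction i with
    | zero =>
      refine fun _ => ⟨_, _, .single _, ?_, ?_⟩
      · exact Set.singleton_subset_iff.2 (Subtype.coe_prop _)
      · intro j hj
        obtain rfl : j = 0 := by omega
        rfl
    | succ i ih =>
      intro hi
      obtain ⟨P, N, h, hP, hq⟩ := ih (by omega)
      have hadj : G.Adj (p.getVert i : V) (p.getVert (i + 1) : V) :=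
        p.adj_getVert_succ (by omega)
      refine ⟨_, _, h.step (x := (p.getVert (i + 1) : V)) ⟨hadj, ?_, ?_⟩,
        Set.insert_subset (Subtype.coe_prop _) hP, fun j hj => ?_⟩
      · rcases Nat.eq_zero_or_pos i with rfl | h0
        exacts [.inl rfl, .inr (far _ _ (by omega) hi)]
      · rcases Nat.eq_zero_or_pos i with rfl | h0
        exacts [.inl rfl, .inr (far _ _ (by omega) hi)]
      · rcases Nat.le_succ_iff.1 hj with hj | rfl
        exacts [.inr (hq j hj), .inl rfl]
  obtain ⟨P, N, h, hP, hq⟩ := chain _ le_rfl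
  refine ⟨_, P, N, _, _, _, h, hP, fun z hz => ?_⟩
  by_contra hzN
  have left : ∀ i ≤ p.length, r (p.getVert i : V) z := by
    intro i
    induction i with
    | zero =>
      intro hi
      refine (hr.not_near.1 fun hn => hzN (h.near_mem (hq 0 hi) hn)).resolve_right fun hza => ?_
      rw [SimpleGraph.Walk.getVert_zero] at hza
      have h1 := hrf _ _ hza
      exact absurd (hmin hz h1.le) (by simpa using h1)
    | succ i ih =>
      intro hi
      refine (hr.not_near.1 fun hn => hzN (h.near_mem (hq _ hi) hn)).resolve_right fun hza => ?_
      have hadj : G.Adj (p.getVert i : V) (p.getVert (i + 1) : V) :=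
        p.adj_getVert_succ (by omega)
      exact ((hr.adj_iff _ _).1 hadj).2.1 (hr.trans _ _ _ (ih (by omega)) hza)
  have h1 := left _ le_rfl
  rw [SimpleGraph.Walk.getVert_length] at h1
  have h2 := hrf _ _ h1
  exact absurd (hmax hz h2.le) (by simpa using h2)

/-! ### The recurrence for balanced sets along a chain -/

/-- The number of vertices of color `c` in `X`. -/
noncomputable def colorCount (color : V → VertexColor) (c : VertexColor) (X : Set V) : ℕ :=
  {v | v ∈ X ∧ color v = c}.ncard

theorem colorCount_mono [Finite V] (color : V → VertexColor) (c : VertexColor) {X Y : Set V}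
    (h : X ⊆ Y) : colorCount color c X ≤ colorCount color c Y :=
  Set.ncard_le_ncard (fun _ hv => ⟨h hv.1, hv.2⟩) (Set.toFinite _)

theorem colorCount_union [Finite V] (color : V → VertexColor) (c : VertexColor) {X Y : Set V}
    (h : Disjoint X Y) :
    colorCount color c (X ∪ Y) = colorCount color c X + colorCount color c Y := by
  unfold colorCount
  rw [← Set.ncard_union_eq (h.mono (fun _ h => h.1) (fun _ h => h.1)) (Set.toFinite _)
    (Set.toFinite _)]
  congr 1
  ext v
  simp only [Set.mem_union, Set.mem_ofPred_eq]
  tauto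

open Classical in
theorem colorCount_singleton (color : V → VertexColor) (c : VertexColor) (x : V) :
    colorCount color c {x} = if color x = c then 1 else 0 := by
  unfold colorCount
  split_ifs with h
  · rw [show {v | v ∈ ({x} : Set V) ∧ color v = c} = {x} by ext v; simp; rintro rfl; exact h]
    simp
  · rw [show {v | v ∈ ({x} : Set V) ∧ color v = c} = ∅ by ext v; simp; rintro rfl; exact h]
    simp

open Classical in
theorem colorCount_insert [Finite V] (color : V → VertexColor) (c : VertexColor) {x : V} {X : Set V}
    (h : x ∉ X) : colorCount color c (insert x X) =
      colorCount color c X + if color x = c then 1 else 0 := by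
  rw [Set.insert_eq, Set.union_comm, colorCount_union _ _ (Set.disjoint_singleton_right.2 h),
    colorCount_singleton]

theorem colorCount_add [Finite V] (color : V → VertexColor) (X : Set V) :
    colorCount color .red X + colorCount color .blue X = X.ncard := by
  unfold colorCount
  rw [← Set.ncard_union_eq _ (Set.toFinite _) (Set.toFinite _)]
  · congr 1
    ext v
    simp only [Set.mem_union, Set.mem_ofPred_eq]
    cases color v <;> simp
  · rw [Set.disjoint_left]
    rintro v ⟨_, h⟩ ⟨_, h'⟩
    rw [h] at h'
    cases h'

/-- Some chain with vertex set `P` ending with `u, v, w` can be completed, by vertices seen by its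
vertices but the last one, to a set with `m` vertices whose numbers of red and blue vertices differ
by `d - K`. -/
def Attains (G : SimpleGraph V) (color : V → VertexColor) (K k : ℕ) (u v w : V) (P : Set V)
    (d m : ℕ) : Prop :=
  ∃ N r b, Chain G k P N u v w ∧
    colorCount color .red P ≤ r ∧ r ≤ colorCount color .red N ∧
    colorCount color .blue P ≤ b ∧ b ≤ colorCount color .blue N ∧ d + b = K + r ∧ m = r + b

/-- `1` for vertices of color `c` and `0` for the others. -/
def isColor (color : V → VertexColor) (c : VertexColor) (x : V) : ℕ :=
  match color x, c with
  | .red, .red => 1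
  | .blue, .blue => 1
  | _, _ => 0

open Classical in
theorem isColor_eq (color : V → VertexColor) (c : VertexColor) (x : V) :
    isColor color c x = if color x = c then 1 else 0 := by
  unfold isColor
  cases color x <;> cases c <;> simp

/-- The number of vertices of color `c` among the new neighbors. -/
noncomputable def newCount (G : SimpleGraph V) (color : V → VertexColor) (c : VertexColor)
    (u v w : V) : ℕ :=
  colorCount color c {z | NewNbr G u v w z}

section

variable [Finite V] {color : V → VertexColor} {K k d m : ℕ} {u v w : V} {P : Set V}

theorem Attains.le (h : Attains G color K k u v w P d m) : m ≤ Nat.card V ∧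
    d ≤ K + Nat.card V ∧ K ≤ d + Nat.card V := by
  obtain ⟨N, r, b, -, -, h1, -, h2, h3, h4⟩ := h
  have := colorCount_add color N
  have : N.ncard ≤ Nat.card V := Set.ncard_le_card N
  omega

theorem Attains.pos (h : Attains G color K k u v w P d m) : 0 < m := by
  obtain ⟨N, r, b, hc, h1, -, h2, -, h3, h4⟩ := h
  have := colorCount_add color P
  have : 0 < P.ncard := Set.ncard_pos (Set.toFinite _) |>.2 ⟨_, hc.last_mem.1⟩
  omega

open Classical in
theorem newCount_pos {x : V} (hx : NewNbr G u v w x) (c : VertexColor) :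
    isColor color c x ≤ newCount G color c u v w := by
  rw [isColor_eq, ← colorCount_singleton]
  exact colorCount_mono _ _ (Set.singleton_subset_iff.2 hx)

/-- Extending a chain: its new last vertex `x` is forced, while the other new neighbors of `w` are
free. -/
theorem Attains.step {r : V → V → Prop} (hr : IsCocomparability G r)
    (h : Attains G color K k u v w P d m) {x : V} (hx : NewNbr G u v w x) {i j e : ℕ}
    (hi : i ≤ newCount G color .red u v w - isColor color .red x)
    (hj : j ≤ newCount G color .blue u v w - isColor color .blue x)
    (he : d + i + isColor color .red x = e + j + isColor color .blue x) :
    Attains G color K (k + 1) v w x (insert x P) e (m + i + j + 1) := by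
  obtain ⟨N, a, b, hc, h1, h2, h3, h4, h5, h6⟩ := h
  refine ⟨_, a + i + isColor color .red x, b + j + isColor color .blue x, hc.step hx, ?_⟩
  have hd := hc.disjoint hr
  rw [colorCount_union _ _ hd, colorCount_union _ _ hd, colorCount_insert _ _ (hc.notMem hr hx),
    colorCount_insert _ _ (hc.notMem hr hx), ← isColor_eq, ← isColor_eq]
  have hp := newCount_pos (color := color) hx .red
  have hq := newCount_pos (color := color) hx .blue
  have hs : isColor color .red x + isColor color .blue x = 1 := by
    unfold isColor; cases color x <;> rfl
  unfold newCount at *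
  omega

/-- The converse of `Attains.step`: every completed chain with more than one vertex arises in this
way. -/
theorem Attains.exists_of_succ {r : V → V → Prop} (hr : IsCocomparability G r) {x : V} {P' : Set V}
    (h : Attains G color K (k + 1) v w x P' d m) (hK : Nat.card V ≤ K) :
    ∃ u P d' m' i j, Attains G color K k u v w P d' m' ∧ NewNbr G u v w x ∧
      i ≤ newCount G color .red u v w - isColor color .red x ∧
      j ≤ newCount G color .blue u v w - isColor color .blue x ∧
      d' + i + isColor color .red x = d + j + isColor color .blue x ∧ m = m' + i + j + 1 := by
  obtain ⟨N', a, b, hc, h1, h2, h3, h4, h5, h6⟩ := h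
  cases hc with
  | @step _ P N u _ _ _ hc hx =>
  have hd := hc.disjoint hr
  rw [colorCount_union _ _ hd] at h2 h4
  rw [colorCount_insert _ _ (hc.notMem hr hx), ← isColor_eq] at h1 h3
  have hp := newCount_pos (color := color) hx .red
  have hq := newCount_pos (color := color) hx .blue
  have hP := colorCount_mono color .red hc.subset
  have hP' := colorCount_mono color .blue hc.subset
  have hN := colorCount_add color N
  have : N.ncard ≤ Nat.card V := Set.ncard_le_card N
  have hs : isColor color .red x + isColor color .blue x = 1 := by
    unfold isColor; cases color x <;> rfl
  have split : ∀ c q lo hi y : ℕ, lo + q ≤ y → y ≤ hi + c → lo ≤ hi → q ≤ c →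
      ∃ y' i, i ≤ c - q ∧ lo ≤ y' ∧ y' ≤ hi ∧ y = y' + i + q := by
    intro c q lo hi y h1 h2 h3 h4
    exact ⟨y - q - min (c - q) (y - q - lo), min (c - q) (y - q - lo), by omega, by omega,
      by omega, by omega⟩
  obtain ⟨a', i, hi, h7, h8, rfl⟩ := split _ _ _ _ _ h1 h2 hP hp
  obtain ⟨b', j, hj, h9, h10, rfl⟩ := split _ _ _ _ _ h3 h4 hP' hq
  exact ⟨u, P, K + a' - b', a' + b', i, j, ⟨N, a', b', hc, h7, h8, h9, h10, by omega, rfl⟩, hx,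
    hi, hj, by omega, by omega⟩

/-- Closing a chain: all new neighbors of its last vertex are free. -/
theorem Attains.exists_final {r : V → V → Prop} (hr : IsCocomparability G r)
    (h : Attains G color K k u v w P d m) {i j : ℕ} (hi : i ≤ newCount G color .red u v w)
    (hj : j ≤ newCount G color .blue u v w) (he : d + i = K + j) :
    ∃ N a, Chain G k P N u v w ∧ m + i + j = 2 * a ∧
      ∀ c, colorCount color c P ≤ a ∧ a ≤ colorCount color c (N ∪ {z | NewNbr G u v w z}) := by
  obtain ⟨N, a, b, hc, h1, h2, h3, h4, h5, h6⟩ := h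
  refine ⟨N, a + i, hc, by omega, fun c => ?_⟩
  rw [colorCount_union _ _ (hc.disjoint hr)]
  unfold newCount at hi hj
  cases c <;> omega

/-- The converse of `Attains.exists_final`: every balanced set between a chain and its closed
neighborhood arises in this way. -/
theorem Chain.exists_attains {r : V → V → Prop} (hr : IsCocomparability G r) {N : Set V}
    (h : Chain G k P N u v w) {S : Set V} (hP : P ⊆ S) (hS : S ⊆ N ∪ {z | NewNbr G u v w z})
    (hb : colorCount color .red S = colorCount color .blue S) (hK : Nat.card V ≤ K) :
    ∃ d m i j, Attains G color K k u v w P d m ∧ i ≤ newCount G color .red u v w ∧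
      j ≤ newCount G color .blue u v w ∧ d + i = K + j ∧ m + i + j = S.ncard := by
  have h1 := colorCount_mono color .red hP
  have h2 := colorCount_mono color .blue hP
  have h3 := colorCount_mono color .red hS
  have h4 := colorCount_mono color .blue hS
  have h5 := colorCount_mono color .red h.subset
  have h6 := colorCount_mono color .blue h.subset
  rw [colorCount_union _ _ (h.disjoint hr)] at h3 h4
  have hN := colorCount_add color N
  have : N.ncard ≤ Nat.card V := Set.ncard_le_card N
  rw [← colorCount_add color S]
  have split : ∀ c lo hi y : ℕ, lo ≤ y → y ≤ hi + c → lo ≤ hi →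
      ∃ y' i, i ≤ c ∧ lo ≤ y' ∧ y' ≤ hi ∧ y = y' + i := by
    intro c lo hi y h1 h2 h3
    exact ⟨y - min c (y - lo), min c (y - lo), by omega, by omega, by omega, by omega⟩
  obtain ⟨a, i, hi, h7, h8, e1⟩ := split _ _ _ _ h1 h3 h5
  obtain ⟨b, j, hj, h9, h10, e2⟩ := split _ _ _ _ h2 h4 h6
  exact ⟨K + a - b, a + b, i, j, ⟨N, a, b, h, h7, h8, h9, h10, by omega, rfl⟩, hi, hj,
    by omega, by omega⟩

end

end Graph

/-! ### Expressions, blocks of commands and table addresses -/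

namespace RAM

instance : Add Expr := ⟨.add⟩
instance : Sub Expr := ⟨.sub⟩
instance : Mul Expr := ⟨.mul⟩

section Eval

variable (n : ℕ) (σ : Store) (a b : Expr)

@[simp] theorem Expr.eval_num (c : ℕ) : (Expr.num c).eval n σ = c := rfl
@[simp] theorem Expr.eval_size : Expr.size.eval n σ = n := rfl
@[simp] theorem Expr.eval_var (x : ℕ) : (Expr.var x).eval n σ = σ.var x := rfl
@[simp] theorem Expr.eval_add : (a + b).eval n σ = a.eval n σ + b.eval n σ := rfl
@[simp] theorem Expr.eval_sub : (a - b).eval n σ = a.eval n σ - b.eval n σ := rfl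
@[simp] theorem Expr.eval_mul : (a * b).eval n σ = a.eval n σ * b.eval n σ := rfl
@[simp] theorem Expr.eval_load : (Expr.load a).eval n σ = σ.mem (a.eval n σ) := rfl

end Eval

/-- Run a list of commands one after the other. -/
def Cmd.block : List Cmd → Cmd
  | [] => .skip
  | c :: L => .seq c (.block L)

/-- Assignment of a value below the cut-off. -/
theorem Cmd.exec_set_cons {J n x v : ℕ} {e : Expr} {L : List Cmd} {σ : Store}
    (h : e.eval n σ = v) (hv : v ≤ (n + 2) ^ J) :
    (block (.set x e :: L)).exec J n σ = (block L).exec J n (σ.set x v) := by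
  simp [block, exec, h, hv]

theorem Cmd.exec_set_cons_min {J n x v : ℕ} {e : Expr} {L : List Cmd} {σ : Store}
    (h : min (e.eval n σ) ((n + 2) ^ J) = v) :
    (block (.set x e :: L)).exec J n σ = (block L).exec J n (σ.set x v) := by
  simp [block, exec, h]

theorem Cmd.exec_store_cons {J n a v : ℕ} {e e' : Expr} {L : List Cmd} {σ : Store}
    (h' : e'.eval n σ = a) (h : e.eval n σ = v) (hv : v ≤ (n + 2) ^ J) :
    (block (.store e' e :: L)).exec J n σ = (block L).exec J n (σ.put a v) := by
  simp [block, exec, h, h', hv]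

theorem Cmd.exec_cons {J n : ℕ} {c : Cmd} {L : List Cmd} {σ : Store} :
    (block (c :: L)).exec J n σ = (block L).exec J n (c.exec J n σ) := rfl

theorem Cmd.exec_nil {J n : ℕ} {σ : Store} : (block []).exec J n σ = σ := rfl

/-- A polynomial pairing function. -/
def pairing (a b : ℕ) : ℕ := (a + b) * (a + b) + a

theorem pairing_inj {a b c d : ℕ} : pairing a b = pairing c d ↔ a = c ∧ b = d := by
  refine ⟨fun h => ?_, by rintro ⟨rfl, rfl⟩; rfl⟩
  unfold pairing at h
  have : a + b = c + d := by
    rcases lt_trichotomy (a + b) (c + d) with h' | h' | h'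
    · nlinarith
    · exact h'
    · nlinarith
  rw [this] at h
  omega

/-- The address of an entry of one of the tables of the program, which are stored behind the input
and the output. The table has number `t`, its entries are indexed by six numbers. -/
def cell (n t l u v w d z : ℕ) : ℕ :=
  n * n + (n + n) + pairing (pairing (pairing t l) (pairing u v)) (pairing (pairing w d) z)

theorem cell_inj {n t l u v w d z t' l' u' v' w' d' z' : ℕ} :
    cell n t l u v w d z = cell n t' l' u' v' w' d' z' ↔
      t = t' ∧ l = l' ∧ u = u' ∧ v = v' ∧ w = w' ∧ d = d' ∧ z = z' := by
  simp [cell, pairing_inj, and_assoc]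

theorem le_cell (n t l u v w d z : ℕ) : n * n + (n + n) ≤ cell n t l u v w d z :=
  Nat.le_add_right _ _

namespace Expr

/-- The expression for `RAM.pairing`. -/
def pairing (a b : Expr) : Expr := (a + b) * (a + b) + a

/-- The expression for the address `RAM.cell`. -/
def cell (t : ℕ) (l u v w d z : Expr) : Expr :=
  size * size + (size + size) +
    pairing (pairing (pairing (num t) l) (pairing u v)) (pairing (pairing w d) z)

@[simp] theorem eval_cell (n : ℕ) (σ : Store) (t : ℕ) (l u v w d z : Expr) :
    (cell t l u v w d z).eval n σ = RAM.cell n t (l.eval n σ) (u.eval n σ) (v.eval n σ)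
      (w.eval n σ) (d.eval n σ) (z.eval n σ) := rfl

/-- Equality as a truth value; nonzero numbers stand for true. -/
def eq (a b : Expr) : Expr := num 1 - ((a - b) + (b - a))

/-- `a < b` as a truth value: the truncated difference `b - a`. -/
def lt (a b : Expr) : Expr := b - a

@[simp] theorem eval_eq (n : ℕ) (σ : Store) (a b : Expr) :
    (eq a b).eval n σ = if a.eval n σ = b.eval n σ then 1 else 0 := by
  simp only [eq, eval_sub, eval_add, eval_num]
  split_ifs <;> omega

@[simp] theorem eval_lt (n : ℕ) (σ : Store) (a b : Expr) :
    (lt a b).eval n σ = b.eval n σ - a.eval n σ := rfl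

/-- The entry of the adjacency matrix. -/
def adj (a b : Expr) : Expr := load (a * size + b)

/-- `1` for red vertices and `0` for blue ones. -/
def color (a : Expr) : Expr := load (size * size + a)

/-- The truth value of `Near`. -/
def near (a b : Expr) : Expr := eq a b + adj a b

/-- The truth value of `NewNbr`. -/
def newNbr (u v w z : Expr) : Expr :=
  adj w z * (eq u w + (num 1 - near u z)) * (eq v w + (num 1 - near v z))

/-- The address of the output bit of a vertex. -/
def out (a : Expr) : Expr := size * size + size + a

end Expr

/-! ### Choosing free vertices

The tables of the program, all of them in the addressing `RAM.cell n t l u v w d z`: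

* Table `0` holds values, indexed by the layer `l`, the last three vertices `u, v, w` of the chain
  and the difference `d` of the numbers of red and blue selected vertices, shifted by `2 * n + 1`
  so that it is a natural number below `4 * n + 3`. The value is the maximum number of selected
  vertices; `0` means that there is no such chain.
* Table `1` holds for the same indices, and for each vertex `z`, whether `z` is on a chain that
  attains the value.
* Table `2` holds the values after the choice of free vertices. Its last index is the color of the
  next vertex of the chain, `1` for red and `0` for blue, or `2` when the chain ends.
* Table `3` holds the difference before that choice.
* Table `4` holds the numbers of new neighbors, indexed by the color and `u, v, w`.
-/

-- The layer, the last three vertices of a chain, the next vertex, the difference, and the color of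
-- the next vertex.
local notation "varL" => 0
local notation "varU" => 1
local notation "varV" => 2
local notation "varW" => 3
local notation "varX" => 4
local notation "varD" => 5
local notation "varC" => 6
-- The counter of the search for free vertices, and a vertex.
local notation "varT" => 7
local notation "varZ" => 8
-- The best value of a search, where it was found, and counters of red and blue vertices.
local notation "varBest" => 9
local notation "varSrc" => 10
local notation "varRed" => 11
local notation "varBlue" => 12
-- Numbers of free vertices, the difference before the choice, and a value; `I` also holds the
-- difference of the predecessor of a chain.
local notation "varI" => 13
local notation "varJ" => 14
local notation "varE" => 15
local notation "varVal" => 16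
-- The size of the best solution, and the indices of its chain in table `1`.
local notation "varGoal" => 17
local notation "varFoundL" => 18
local notation "varFoundU" => 19
local notation "varFoundV" => 20
local notation "varFoundW" => 21
local notation "varFoundD" => 22

open RAM.Expr RAM.Cmd

/-- The entry of table `0`. -/
def valueE (l u v w d : Expr) : Expr := load (Expr.cell 0 l u v w d (num 0))

/-- The entry of table `2`. -/
def freeE (l u v w d c : Expr) : Expr := load (Expr.cell 2 l u v w d c)

/-- The entry of table `3`. -/
def sourceE (l u v w d c : Expr) : Expr := load (Expr.cell 3 l u v w d c)

/-- The entry of table `4`. -/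
def countE (c u v w : Expr) : Expr := load (Expr.cell 4 c u v w (num 0) (num 0))

/-- Try the choice number `T`: all but `T - n` of the free red vertices and all but `n - T` of the
free blue ones. -/
def freeStep : Cmd := block [
  set varI (var varRed - (var varT - size)),
  set varJ (var varBlue - (size - var varT)),
  set varE (var varD + var varJ - var varI),
  set varVal (valueE (var varL) (var varU) (var varV) (var varW) (var varE)),
  ite (Expr.lt (var varE) (num 4 * size + num 3) * var varVal *
      Expr.lt (var varBest) (var varVal + var varI + var varJ))
    (block [set varBest (var varVal + var varI + var varJ), set varSrc (var varE)])
    skip]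

/-- Search for the best way to add free new neighbors of `w`. At least one color is used up, so
there are only `2 * n + 1` cases. -/
def freeSearch : Cmd := loop varT 2 1 freeStep

/-- Compute the entries of tables `2` and `3` for one chain end, color and difference. -/
def freeEntry : Cmd := block [
  set varBest (num 0),
  set varSrc (num 0),
  set varRed (countE (num 1) (var varU) (var varV) (var varW) - Expr.eq (var varC) (num 1)),
  set varBlue (countE (num 0) (var varU) (var varV) (var varW) - Expr.eq (var varC) (num 0)),
  freeSearch,
  store (Expr.cell 2 (var varL) (var varU) (var varV) (var varW) (var varD) (var varC))
    (var varBest),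
  store (Expr.cell 3 (var varL) (var varU) (var varV) (var varW) (var varD) (var varC))
    (var varSrc)]

/-- Compute a layer of tables `2` and `3`. -/
def freeTable : Cmd :=
  loops [(varU, 1, 0), (varV, 1, 0), (varW, 1, 0), (varC, 0, 3), (varD, 4, 3)] freeEntry

/-- The numbers that the program stores are at most `10 * n + 10`, hence below the cut-off. -/
theorem cutoff (n : ℕ) : 10 * n + 10 ≤ (n + 2) ^ 24 := linear_le_pow 10 10 n 24 (by omega)

theorem freeStep_exec {n : ℕ} (s : Store) (f : ℕ → ℕ)
    (hf : ∀ e, s.mem (cell n 0 (s.var varL) (s.var varU) (s.var varV) (s.var varW) e 0) = f e)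
    (hR : s.var varRed ≤ n) (hB : s.var varBlue ≤ n) (hD : s.var varD < 4 * n + 3)
    {i j e : ℕ} (hi : i = s.var varRed - (s.var varT - n))
    (hj : j = s.var varBlue - (n - s.var varT)) (he : e = s.var varD + j - i)
    (hle : e < 4 * n + 3 → f e ≤ n) :
    (e < 4 * n + 3 ∧ f e ≠ 0 ∧ s.var varBest < f e + i + j ∧
      (freeStep.exec 24 n s).var varBest = f e + i + j ∧ (freeStep.exec 24 n s).var varSrc = e) ∨
    (¬ (e < 4 * n + 3 ∧ f e ≠ 0 ∧ s.var varBest < f e + i + j) ∧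
      (freeStep.exec 24 n s).var varBest = s.var varBest ∧
      (freeStep.exec 24 n s).var varSrc = s.var varSrc) := by
  have hc := cutoff n
  rw [freeStep, exec_set_cons (v := i) (by simp [hi]) (by omega),
    exec_set_cons (v := j) (by simp [hj]) (by omega),
    exec_set_cons (v := e) (by simp [he]) (by omega),
    exec_set_cons_min (v := min (f e) ((n + 2) ^ 24)) (by simp [valueE, hf]), exec_cons, exec_nil]
  by_cases h : e < 4 * n + 3 ∧ f e ≠ 0 ∧ s.var varBest < f e + i + j
  · left
    have hfe := hle h.1
    rw [min_eq_left (by omega)]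
    refine ⟨h.1, h.2.1, h.2.2, ?_⟩
    rw [exec, if_neg (by simp; omega), exec_set_cons (v := f e + i + j) (by simp) (by omega),
      exec_set_cons (v := e) (by simp) (by omega), exec_nil]
    simp
  · right
    refine ⟨h, ?_⟩
    rw [exec, if_pos]
    · simp [exec]
    · by_cases he' : e < 4 * n + 3
      · rw [min_eq_left ((hle he').trans (by omega))]
        simp
        omega
      · simp
        omega

/-- The search computes the maximum of `f e + i + j` over all admissible `e`, `i` and `j`, and
where it is attained. Here `f` is the relevant row of table `0`. -/
theorem freeSearch_spec {n : ℕ} (σ : Store) (f : ℕ → ℕ)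
    (hf : ∀ e, σ.mem (cell n 0 (σ.var varL) (σ.var varU) (σ.var varV) (σ.var varW) e 0) = f e)
    (hle : ∀ e < 4 * n + 3, f e ≤ n) (hzero : f 0 = 0) (hR : σ.var varRed ≤ n)
    (hB : σ.var varBlue ≤ n) (hD : σ.var varD < 4 * n + 3) (h0 : σ.var varBest = 0)
    (hS : σ.var varSrc = 0) {τ : Store} (hτ : τ = freeSearch.exec 24 n σ) :
    τ.var varBest ≤ 3 * n ∧ τ.var varSrc < 4 * n + 3 ∧
      (τ.var varBest ≠ 0 → f (τ.var varSrc) ≠ 0 ∧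
        ∃ i j, i ≤ σ.var varRed ∧ j ≤ σ.var varBlue ∧ τ.var varSrc + i = σ.var varD + j ∧
          τ.var varBest = f (τ.var varSrc) + i + j) ∧
      ∀ e < 4 * n + 3, f e ≠ 0 → ∀ i j, i ≤ σ.var varRed → j ≤ σ.var varBlue →
        e + i = σ.var varD + j → f e + i + j ≤ τ.var varBest := by
  have key := loop_rule (J := 24) (n := n) (x := varT) (a := 2) (b := 1) (c := freeStep) (σ := σ)
    (fun t s => s.var varBest ≤ 3 * n ∧ s.var varSrc < 4 * n + 3 ∧
      (s.var varBest ≠ 0 → f (s.var varSrc) ≠ 0 ∧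
        ∃ i j, i ≤ σ.var varRed ∧ j ≤ σ.var varBlue ∧ s.var varSrc + i = σ.var varD + j ∧
          s.var varBest = f (s.var varSrc) + i + j) ∧
      ∀ t' < t, ∀ e < 4 * n + 3, f e ≠ 0 →
        e = σ.var varD + (σ.var varBlue - (n - t')) - (σ.var varRed - (t' - n)) →
        f e + (σ.var varRed - (t' - n)) + (σ.var varBlue - (n - t')) ≤ s.var varBest)
    (fun j s v h => by simpa using h)
    ⟨by omega, by omega, fun h => absurd h0 h, fun _ h => by omega⟩ ?_
  · rw [← freeSearch, ← hτ] at key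
    refine ⟨key.1, key.2.1, key.2.2.1, fun e he hfe i j hi hj h => ?_⟩
    -- adding the same number of vertices of both colors exhausts one of them
    rcases Nat.le_total (σ.var varRed - i) (σ.var varBlue - j) with h' | h'
    · have := key.2.2.2 (n - (σ.var varBlue - j - (σ.var varRed - i))) (by omega) e he hfe
        (by omega)
      omega
    · have := key.2.2.2 (n + (σ.var varRed - i - (σ.var varBlue - j))) (by omega) e he hfe
        (by omega)
      omega
  · rintro t s ht hT hfr hm ⟨hb, hb', hs, hc⟩
    have hL := hfr varL (by decide) (by decide)
    have hU := hfr varU (by decide) (by decide)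
    have hV := hfr varV (by decide) (by decide)
    have hW := hfr varW (by decide) (by decide)
    have hRd := hfr varRed (by decide) (by decide)
    have hBl := hfr varBlue (by decide) (by decide)
    have hDd := hfr varD (by decide) (by decide)
    obtain ⟨i, hi⟩ : ∃ i, i = σ.var varRed - (t - n) := ⟨_, rfl⟩
    obtain ⟨j, hj⟩ : ∃ j, j = σ.var varBlue - (n - t) := ⟨_, rfl⟩
    obtain ⟨e, he⟩ : ∃ e, e = σ.var varD + j - i := ⟨_, rfl⟩
    have hfe := hle e
    rcases freeStep_exec (n := n) (i := i) (j := j) (e := e) s f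
      (by rw [hm (by rfl), hL, hU, hV, hW]; exact hf) (by omega) (by omega) (by omega)
      (by rw [hRd, hT]; exact hi) (by rw [hBl, hT]; exact hj)
      (by rw [hDd]; exact he) hfe with ⟨h1, h2, h3, h4, h5⟩ | ⟨h1, h4, h5⟩
    · rw [h4, h5]
      refine ⟨by omega, h1, fun _ => ⟨h2, i, j, by omega, by omega, ?_, rfl⟩,
        fun t' ht' e' he' hfe' hh => ?_⟩
      · by_contra hne
        exact h2 (by rw [show e = 0 by omega]; exact hzero)
      · rcases Nat.lt_succ_iff_lt_or_eq.1 ht' with ht' | rfl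
        · have := hc t' ht' e' he' hfe' hh
          omega
        · rw [← hi, ← hj, ← he] at hh
          subst hh
          omega
    · rw [h4, h5]
      refine ⟨hb, hb', hs, fun t' ht' e' he' hfe' hh => ?_⟩
      rcases Nat.lt_succ_iff_lt_or_eq.1 ht' with ht' | rfl
      · exact hc t' ht' e' he' hfe' hh
      · rw [← hi, ← hj, ← he] at hh
        subst hh
        rw [← hi, ← hj]
        omega

/-- The memories `m` and `m'` agree on the input, on the output and on the layers `l` of the tables
`t` that do not satisfy `T t l`. -/
def AgreeOff (n : ℕ) (T : ℕ → ℕ → Prop) (m m' : ℕ → ℕ) : Prop :=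
  (∀ a < n * n + (n + n), m' a = m a) ∧
    ∀ t l u v w d z, ¬ T t l → m' (cell n t l u v w d z) = m (cell n t l u v w d z)

theorem AgreeOff.refl {n : ℕ} {T : ℕ → ℕ → Prop} (m : ℕ → ℕ) : AgreeOff n T m m :=
  ⟨fun _ _ => rfl, fun _ _ _ _ _ _ _ _ => rfl⟩

theorem AgreeOff.put {n : ℕ} {T : ℕ → ℕ → Prop} {m : ℕ → ℕ} {s : Store}
    (h : AgreeOff n T m s.mem) {t l u v w d z : ℕ} (hT : T t l) (x : ℕ) :
    AgreeOff n T m (s.put (cell n t l u v w d z) x).mem := by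
  refine ⟨fun a ha => ?_, fun t' l' u' v' w' d' z' hT' => ?_⟩
  · have := le_cell n t l u v w d z
    rw [Store.put_mem, if_neg (by omega), h.1 a ha]
  · rw [Store.put_mem, if_neg, h.2 _ _ _ _ _ _ _ hT']
    rw [cell_inj]
    rintro ⟨rfl, rfl, -⟩
    exact hT' hT

/-- The entries of the tables `2` and `3` for `l, u, v, w, d, c` are an optimal choice of free new
neighbors of `w` and the difference before that choice. For `c = 1` and `c = 0` one red or blue new
neighbor has to be left over. -/
def FreeOK (n l u v w c d : ℕ) (m : ℕ → ℕ) : Prop :=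
  (m (cell n 2 l u v w d c) ≠ 0 → m (cell n 3 l u v w d c) < 4 * n + 3 ∧
      m (cell n 0 l u v w (m (cell n 3 l u v w d c)) 0) ≠ 0 ∧
      ∃ i j, i ≤ m (cell n 4 1 u v w 0 0) - (if c = 1 then 1 else 0) ∧
        j ≤ m (cell n 4 0 u v w 0 0) - (if c = 0 then 1 else 0) ∧
        m (cell n 3 l u v w d c) + i = d + j ∧
        m (cell n 2 l u v w d c) = m (cell n 0 l u v w (m (cell n 3 l u v w d c)) 0) + i + j) ∧
    ∀ e < 4 * n + 3, m (cell n 0 l u v w e 0) ≠ 0 →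
      ∀ i j, i ≤ m (cell n 4 1 u v w 0 0) - (if c = 1 then 1 else 0) →
        j ≤ m (cell n 4 0 u v w 0 0) - (if c = 0 then 1 else 0) → e + i = d + j →
        m (cell n 0 l u v w e 0) + i + j ≤ m (cell n 2 l u v w d c)

theorem freeTable_spec {n l : ℕ} (σ : Store) (hl : σ.var varL = l)
    (hle : ∀ u < n, ∀ v < n, ∀ w < n, ∀ e < 4 * n + 3,
      σ.mem (cell n 0 l u v w e 0) ≤ n)
    (hzero : ∀ u < n, ∀ v < n, ∀ w < n, σ.mem (cell n 0 l u v w 0 0) = 0)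
    (hc : ∀ u < n, ∀ v < n, ∀ w < n, σ.mem (cell n 4 1 u v w 0 0) ≤ n ∧
      σ.mem (cell n 4 0 u v w 0 0) ≤ n) :
    AgreeOff n (fun t k => (t = 2 ∨ t = 3) ∧ k = l) σ.mem
      (freeTable.exec 24 n σ).mem ∧
    ∀ u < n, ∀ v < n, ∀ w < n, ∀ c < 3, ∀ d < 4 * n + 3,
      FreeOK n l u v w c d (freeTable.exec 24 n σ).mem := by
  have hcut := cutoff n
  have key := loops_rule (J := 24) (n := n)
    [(varU, 1, 0), (varV, 1, 0), (varW, 1, 0), (varC, 0, 3), (varD, 4, 3)] freeEntry σ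
    (fun s => AgreeOff n (fun t k => (t = 2 ∨ t = 3) ∧ k = l) σ.mem s.mem)
    (fun idx s => match idx with
      | [u, v, w, c, d] => FreeOK n l u v w c d s.mem
      | _ => True)
    (fun s x v _ h => h) (fun l s x v _ h => h) (by decide) (by decide) ?_ (.refl _)
  · refine ⟨key.1, fun u hu v hv w hw c hc d hd => key.2 [u, v, w, c, d] ?_⟩
    simp [InRange, hu, hv, hw, hc, hd]
  · rintro _ s hr rfl hfr hI
    simp only [List.map_cons, List.map_nil] at hr ⊢
    have hL := hfr varL (by decide) (by decide)
    obtain ⟨u, hu⟩ : ∃ u, u = s.var varU := ⟨_, rfl⟩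
    obtain ⟨v, hv⟩ : ∃ u, u = s.var varV := ⟨_, rfl⟩
    obtain ⟨w, hw⟩ : ∃ u, u = s.var varW := ⟨_, rfl⟩
    obtain ⟨c, hcc⟩ : ∃ u, u = s.var varC := ⟨_, rfl⟩
    obtain ⟨d, hd⟩ : ∃ u, u = s.var varD := ⟨_, rfl⟩
    rw [hl] at hL
    simp only [← hu, ← hv, ← hw, ← hcc, ← hd] at hr ⊢
    have hr' : u < n ∧ v < n ∧ w < n ∧ c < 3 ∧ d < 4 * n + 3 := by simpa [InRange] using hr
    obtain ⟨hun, hvn, hwn, hc3, hdn⟩ := hr'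
    have h41 : s.mem (cell n 4 1 u v w 0 0) ≤ n := by
      rw [hI.2 _ _ _ _ _ _ _ (by simp)]
      exact (hc u hun v hvn w hwn).1
    have h40 : s.mem (cell n 4 0 u v w 0 0) ≤ n := by
      rw [hI.2 _ _ _ _ _ _ _ (by simp)]
      exact (hc u hun v hvn w hwn).2
    obtain ⟨pr, hpr⟩ : ∃ x, s.mem (cell n 4 1 u v w 0 0) - (if c = 1 then 1 else 0) = x := ⟨_, rfl⟩
    obtain ⟨pb, hpb⟩ : ∃ x, s.mem (cell n 4 0 u v w 0 0) - (if c = 0 then 1 else 0) = x := ⟨_, rfl⟩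
    obtain ⟨τ, hτ⟩ : ∃ τ, τ = freeSearch.exec 24 n
      ((((s.set varBest 0).set varSrc 0).set varRed pr).set varBlue pb) := ⟨_, rfl⟩
    have hσ' : ((((s.set varBest 0).set varSrc 0).set varRed pr).set varBlue pb).mem = s.mem := rfl
    have hmem : τ.mem = s.mem := by rw [hτ, exec_pure _ _ _ _ (by rfl), hσ']
    have hτL : τ.var varL = l := by rw [hτ, exec_frame _ _ _ _ (by decide)]; simpa using hL
    have hτU : τ.var varU = u := by rw [hτ, exec_frame _ _ _ _ (by decide)]; simp [hu]
    have hτV : τ.var varV = v := by rw [hτ, exec_frame _ _ _ _ (by decide)]; simp [hv]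
    have hτW : τ.var varW = w := by rw [hτ, exec_frame _ _ _ _ (by decide)]; simp [hw]
    have hτC : τ.var varC = c := by rw [hτ, exec_frame _ _ _ _ (by decide)]; simp [hcc]
    have hτD : τ.var varD = d := by rw [hτ, exec_frame _ _ _ _ (by decide)]; simp [hd]
    have hV : ∀ e, s.mem (cell n 0 l u v w e 0) = σ.mem (cell n 0 l u v w e 0) := fun e =>
      hI.2 _ _ _ _ _ _ _ (by simp)
    have spec := freeSearch_spec (n := n)
      ((((s.set varBest 0).set varSrc 0).set varRed pr).set varBlue pb)
      (fun e => s.mem (cell n 0 l u v w e 0)) (by simp [hL, ← hu, ← hv, ← hw])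
      (fun e he => by rw [hV]; exact hle u hun v hvn w hwn e he)
      (by rw [hV]; exact hzero u hun v hvn w hwn) (by simp; omega) (by simp; omega)
      (by simp [← hd, hdn]) (by simp) (by simp) hτ
    simp only [Store.set_var, reduceIte, Nat.reduceEqDiff, ← hd] at spec
    obtain ⟨hbest, hsrc, hsound, hcomp⟩ := spec
    have hrun : freeEntry.exec 24 n s =
        (τ.put (cell n 2 l u v w d c) (τ.var varBest)).put (cell n 3 l u v w d c)
          (τ.var varSrc) := by
      rw [freeEntry, exec_set_cons (v := 0) (by simp) (by omega),
        exec_set_cons (v := 0) (by simp) (by omega),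
        exec_set_cons (v := pr) (by simp [countE, ← hu, ← hv, ← hw, ← hcc, ← hpr]) (by omega),
        exec_set_cons (v := pb) (by simp [countE, ← hu, ← hv, ← hw, ← hcc, ← hpb]) (by omega),
        exec_cons, ← hτ,
        exec_store_cons (a := cell n 2 l u v w d c) (v := τ.var varBest)
          (by simp [hτL, hτU, hτV, hτW, hτC, hτD]) (by simp) (by omega),
        exec_store_cons (a := cell n 3 l u v w d c) (v := τ.var varSrc)
          (by simp [hτL, hτU, hτV, hτW, hτC, hτD]) (by simp) (by omega), exec_nil]
    rw [hrun]
    refine ⟨?_, ?_, ?_⟩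
    · rw [← hmem] at hI
      exact (hI.put (by simp) _).put (by simp) _
    · have := And.intro hsound hcomp
      simpa [FreeOK, cell_inj, hmem, hpr, hpb, hsrc] using this
    · intro l' hl' hne h
      simp only [InRange] at hl'
      obtain ⟨u', _, rfl, -, v', _, rfl, -, w', _, rfl, -, c', _, rfl, -, d', _, rfl, -, rfl⟩ := hl'
      simp only at h ⊢
      have hne' : ¬ (u' = u ∧ v' = v ∧ w' = w ∧ d' = d ∧ c' = c) := by
        rintro ⟨rfl, rfl, rfl, rfl, rfl⟩
        exact hne rfl
      simpa [FreeOK, Store.put_mem, cell_inj, hmem, hne'] using h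

/-! ### Reading the input and counting new neighbors -/

/-- The memory `m` contains the graph and the colors as in `bcsInput`. -/
def HasInput {n : ℕ} (G : SimpleGraph (Fin n)) (color : Fin n → VertexColor) (m : ℕ → ℕ) : Prop :=
  (∀ i j : Fin n, (G.Adj i j → m (i * n + j) = 1) ∧ (¬ G.Adj i j → m (i * n + j) = 0)) ∧
    ∀ i : Fin n, m (n * n + i) = isColor color .red i

theorem mul_add_lt_mul_self {n : ℕ} (i j : Fin n) : (i : ℕ) * n + j < n * n := by
  have := i.2
  have := j.2
  nlinarith

theorem HasInput.of_agreeOff {n : ℕ} {G : SimpleGraph (Fin n)} {color : Fin n → VertexColor}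
    {T : ℕ → ℕ → Prop} {m m' : ℕ → ℕ} (h : HasInput G color m) (h' : AgreeOff n T m m') :
    HasInput G color m' := by
  refine ⟨fun i j => ?_, fun i => ?_⟩
  · rw [h'.1 _ (by have := mul_add_lt_mul_self i j; omega)]
    exact h.1 i j
  · rw [h'.1 _ (by omega)]
    exact h.2 i

theorem hasInput_bcsInput {n : ℕ} (G : SimpleGraph (Fin n)) (color : Fin n → VertexColor) :
    HasInput G color (bcsInput G color).mem := by
  have inj : ∀ i j i' j' : Fin n, (i : ℕ) * n + j = i' * n + j' → i = i' ∧ j = j' := by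
    intro i j i' j' h
    have h1 := i.2
    have h2 := j.2
    have h3 := j'.2
    have : (i : ℕ) = i' := by
      rcases lt_trichotomy (i : ℕ) i' with h' | h' | h'
      · nlinarith
      · exact h'
      · nlinarith
    rw [this] at h
    exact ⟨Fin.ext this, Fin.ext (by omega)⟩
  refine ⟨fun i j => ⟨fun h => if_pos (.inl ⟨i, j, rfl, h⟩), fun h => if_neg ?_⟩, fun i => ?_⟩
  · rintro (⟨i', j', h', ha⟩ | ⟨k, hk, -⟩)
    · obtain ⟨rfl, rfl⟩ := inj _ _ _ _ h'
      exact h ha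
    · have := mul_add_lt_mul_self i j
      omega
  · simp only [bcsInput, isColor_eq]
    by_cases hc : color i = .red
    · rw [if_pos hc]
      exact if_pos (.inr ⟨i, rfl, hc⟩)
    · rw [if_neg hc]
      refine if_neg ?_
      rintro (⟨k, l, hk, -⟩ | ⟨k, hk, hk'⟩)
      · have := mul_add_lt_mul_self k l
        omega
      · rw [show i = k from Fin.ext (by omega)] at hc
        exact hc hk'

theorem bcsInput_eq_zero {n : ℕ} (G : SimpleGraph (Fin n)) (color : Fin n → VertexColor) {a : ℕ}
    (ha : n * n + n ≤ a) : (bcsInput G color).mem a = 0 := by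
  simp only [bcsInput]
  refine if_neg ?_
  rintro (⟨i, j, h, -⟩ | ⟨i, h, -⟩)
  · have := mul_add_lt_mul_self i j
    omega
  · omega

section Graph

variable {n : ℕ} {G : SimpleGraph (Fin n)} {color : Fin n → VertexColor} {σ : Store}

theorem eval_near (h : HasInput G color σ.mem) {a b : Expr} {u v : Fin n}
    (ha : a.eval n σ = u) (hb : b.eval n σ = v) : (near a b).eval n σ = 0 ↔ ¬ Near G u v := by
  have := h.1 u v
  simp only [near, adj, eval_add, eval_eq, eval_load, eval_mul, eval_size, ha, hb, Near,
    Fin.val_inj]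
  by_cases h1 : u = v <;> by_cases h2 : G.Adj u v <;> simp [h1, h2] at this ⊢ <;> simp [this]

theorem eval_newNbr (h : HasInput G color σ.mem) {a b c d : Expr} {u v w z : Fin n}
    (ha : a.eval n σ = u) (hb : b.eval n σ = v) (hc : c.eval n σ = w) (hd : d.eval n σ = z) :
    (newNbr a b c d).eval n σ = 0 ↔ ¬ NewNbr G u v w z := by
  have h1 := eval_near h ha hd
  have h2 := eval_near h hb hd
  have h3 := h.1 w z
  simp only [newNbr, adj, eval_add, eval_sub, eval_num, eval_eq, eval_load, eval_mul, eval_size,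
    ha, hb, hc, hd, NewNbr, Fin.val_inj]
  have e1 : (1 - (near a d).eval n σ = 0) ↔ Near G u z := by
    rw [← not_iff_not, ← h1]; omega
  have e2 : (1 - (near b d).eval n σ = 0) ↔ Near G v z := by
    rw [← not_iff_not, ← h2]; omega
  have e3 : (σ.mem (w * n + z) = 0) ↔ ¬ G.Adj w z := by
    by_cases h : G.Adj w z <;> simp [h, h3]
  rw [Nat.mul_eq_zero, Nat.mul_eq_zero, Nat.add_eq_zero_iff, Nat.add_eq_zero_iff, e1, e2, e3]
  have e4 : ∀ p : Prop, [Decidable p] → ((if p then 1 else 0) = 0 ↔ ¬ p) := fun p _ => by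
    split_ifs with h <;> simp [h]
  rw [e4, e4]
  tauto

theorem eval_color (h : HasInput G color σ.mem) {a : Expr} {u : Fin n} (ha : a.eval n σ = u) :
    (Expr.color a).eval n σ = isColor color .red u := by
  simp only [Expr.color, eval_load, eval_add, eval_mul, eval_size, ha, h.2]

end Graph

/-- Count the vertex `Z` if it is a new neighbor. -/
def countStep : Cmd :=
  ite (newNbr (var varU) (var varV) (var varW) (var varZ))
    (ite (Expr.color (var varZ)) (set varRed (var varRed + num 1))
      (set varBlue (var varBlue + num 1)))
    skip

/-- Compute the two entries of table `4` for one triple. -/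
def countEntry : Cmd := block [
  set varRed (num 0),
  set varBlue (num 0),
  loop varZ 1 0 countStep,
  store (Expr.cell 4 (num 1) (var varU) (var varV) (var varW) (num 0) (num 0)) (var varRed),
  store (Expr.cell 4 (num 0) (var varU) (var varV) (var varW) (num 0) (num 0)) (var varBlue)]

/-- Count the new neighbors of each color for all triples. -/
def countTable : Cmd := loops [(varU, 1, 0), (varV, 1, 0), (varW, 1, 0)] countEntry

section Count

variable {n : ℕ} {G : SimpleGraph (Fin n)} {color : Fin n → VertexColor}

theorem colorCount_le (c : VertexColor) (X : Set (Fin n)) : colorCount color c X ≤ n := by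
  have h1 := colorCount_add color X
  have h2 : X.ncard ≤ Nat.card (Fin n) := Set.ncard_le_card X
  rw [Nat.card_fin] at h2
  cases c <;> omega

/-- Counting vertex by vertex. -/
theorem colorCount_succ (c : VertexColor) (p : Fin n → Prop) (j : Fin n) :
    (p j → colorCount color c {z | (z : ℕ) < j + 1 ∧ p z} =
      colorCount color c {z | (z : ℕ) < j ∧ p z} + isColor color c j) ∧
    (¬ p j → colorCount color c {z | (z : ℕ) < j + 1 ∧ p z} =
      colorCount color c {z | (z : ℕ) < j ∧ p z}) := by
  constructor
  · intro hp
    rw [isColor_eq, ← colorCount_insert _ _ (by simp)]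
    congr 1
    ext z
    simp only [Set.mem_ofPred_eq, Set.mem_insert_iff, Fin.ext_iff]
    constructor
    · rintro ⟨h1, h2⟩
      by_cases h : (z : ℕ) = j
      · exact .inl h
      · exact .inr ⟨by omega, h2⟩
    · rintro (h | ⟨h1, h2⟩)
      · rw [Fin.ext h]; exact ⟨by omega, hp⟩
      · exact ⟨by omega, h2⟩
  · intro hp
    congr 1
    ext z
    simp only [Set.mem_ofPred_eq]
    constructor
    · rintro ⟨h1, h2⟩
      refine ⟨lt_of_le_of_ne (by omega) fun h => hp ?_, h2⟩
      rwa [← Fin.ext h]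
    · rintro ⟨h1, h2⟩
      exact ⟨by omega, h2⟩

theorem countTable_spec (σ : Store) (hin : HasInput G color σ.mem) :
    AgreeOff n (fun t _ => t = 4) σ.mem (countTable.exec 24 n σ).mem ∧
    ∀ u v w : Fin n,
      (countTable.exec 24 n σ).mem (cell n 4 1 u v w 0 0) = newCount G color .red u v w ∧
      (countTable.exec 24 n σ).mem (cell n 4 0 u v w 0 0) = newCount G color .blue u v w := by
  have hcut := cutoff n
  have key := loops_rule (J := 24) (n := n)
    [(varU, 1, 0), (varV, 1, 0), (varW, 1, 0)] countEntry σ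
    (fun s => AgreeOff n (fun t _ => t = 4) σ.mem s.mem)
    (fun idx s => ∀ u v w : Fin n, idx = [(u : ℕ), (v : ℕ), (w : ℕ)] →
      s.mem (cell n 4 1 u v w 0 0) = newCount G color .red u v w ∧
      s.mem (cell n 4 0 u v w 0 0) = newCount G color .blue u v w)
    (fun s x v _ h => h) (fun l s x v _ h => h) (by decide) (by decide) ?_ (.refl _)
  · exact ⟨key.1, fun u v w => key.2 [u, v, w] (by simp [InRange]) u v w rfl⟩
  · rintro _ s hr rfl hfr hI
    simp only [List.map_cons, List.map_nil] at hr ⊢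
    have hr' : s.var varU < n ∧ s.var varV < n ∧ s.var varW < n := by simpa [InRange] using hr
    obtain ⟨u, hu⟩ : ∃ u : Fin n, s.var varU = u := ⟨⟨_, hr'.1⟩, rfl⟩
    obtain ⟨v, hv⟩ : ∃ u : Fin n, s.var varV = u := ⟨⟨_, hr'.2.1⟩, rfl⟩
    obtain ⟨w, hw⟩ : ∃ u : Fin n, s.var varW = u := ⟨⟨_, hr'.2.2⟩, rfl⟩
    simp only [hu, hv, hw] at hr ⊢
    obtain ⟨τ, hτ⟩ : ∃ τ, τ = (loop varZ 1 0 countStep).exec 24 n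
      ((s.set varRed 0).set varBlue 0) := ⟨_, rfl⟩
    have hmem : τ.mem = s.mem := by rw [hτ, exec_pure _ _ _ _ (by rfl)]; rfl
    have hτU : τ.var varU = u := by rw [hτ, exec_frame _ _ _ _ (by decide)]; simp [hu]
    have hτV : τ.var varV = v := by rw [hτ, exec_frame _ _ _ _ (by decide)]; simp [hv]
    have hτW : τ.var varW = w := by rw [hτ, exec_frame _ _ _ _ (by decide)]; simp [hw]
    have spec : τ.var varRed = newCount G color .red u v w ∧
        τ.var varBlue = newCount G color .blue u v w := by
      have := loop_rule (J := 24) (n := n) (x := varZ) (a := 1) (b := 0) (c := countStep)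
        (σ := (s.set varRed 0).set varBlue 0)
        (fun j s => s.var varRed = colorCount color .red {z | (z : ℕ) < j ∧ NewNbr G u v w z} ∧
          s.var varBlue = colorCount color .blue {z | (z : ℕ) < j ∧ NewNbr G u v w z})
        (fun j s v h => by simpa using h) (by simp [colorCount]) ?_
      · rw [← hτ] at this
        simpa [newCount] using this
      · rintro j t hj hZ hfr' hm ⟨hR, hB⟩
        have hin' : HasInput G color t.mem := by
          rw [hm (by rfl)]
          exact hin.of_agreeOff hI
        obtain ⟨z, rfl⟩ : ∃ z : Fin n, j = z := ⟨⟨j, by omega⟩, rfl⟩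
        have hnew := eval_newNbr (a := var varU) (b := var varV) (c := var varW) (d := var varZ)
          (u := u) (v := v) (w := w) (z := z) hin'
          (by simp [hfr' varU (by decide) (by decide), hu])
          (by simp [hfr' varV (by decide) (by decide), hv])
          (by simp [hfr' varW (by decide) (by decide), hw]) (by simp [hZ])
        have hcol := eval_color (a := var varZ) (u := z) hin' (by simp [hZ])
        have s1 := colorCount_succ (color := color) .red (NewNbr G u v w) z
        have s2 := colorCount_succ (color := color) .blue (NewNbr G u v w) z
        have b1 := colorCount_le (color := color) .red {y | (y : ℕ) < z ∧ NewNbr G u v w y}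
        have b2 := colorCount_le (color := color) .blue {y | (y : ℕ) < z ∧ NewNbr G u v w y}
        simp only [countStep, exec]
        by_cases hN : NewNbr G u v w z
        · rw [if_neg (by rw [hnew]; exact not_not.2 hN), s1.1 hN, s2.1 hN, hcol]
          rcases hc : color z with _ | _
          · simp [isColor, hc, hR, hB, -Fin.val_fin_lt]; omega
          · simp [isColor, hc, hR, hB, -Fin.val_fin_lt]; omega
        · rw [if_pos (hnew.2 hN), s1.2 hN, s2.2 hN]
          exact ⟨hR, hB⟩
    have b1 : newCount G color .red u v w ≤ n := colorCount_le _ _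
    have b2 : newCount G color .blue u v w ≤ n := colorCount_le _ _
    have hrun : countEntry.exec 24 n s =
        (τ.put (cell n 4 1 u v w 0 0) (newCount G color .red u v w)).put (cell n 4 0 u v w 0 0)
          (newCount G color .blue u v w) := by
      rw [countEntry, exec_set_cons (v := 0) (by simp) (by omega),
        exec_set_cons (v := 0) (by simp) (by omega), exec_cons, ← hτ,
        exec_store_cons (a := cell n 4 1 u v w 0 0) (v := newCount G color .red u v w)
          (by simp [hτU, hτV, hτW]) (by simp [spec.1]) (by omega),
        exec_store_cons (a := cell n 4 0 u v w 0 0) (v := newCount G color .blue u v w)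
          (by simp [hτU, hτV, hτW]) (by simp [spec.2]) (by omega), exec_nil]
    rw [hrun]
    refine ⟨?_, ?_, ?_⟩
    · rw [← hmem] at hI
      exact (hI.put (by simp) _).put (by simp) _
    · intro u' v' w' h
      simp only [List.cons.injEq, Fin.val_inj, and_true] at h
      obtain ⟨rfl, rfl, rfl⟩ := h
      simp [cell_inj]
    · intro l' hl' hne h u' v' w' h'
      have := h u' v' w' h'
      have hne' : ¬ ((u' : ℕ) = u ∧ (v' : ℕ) = v ∧ (w' : ℕ) = w) := by
        rintro ⟨h1, h2, h3⟩
        rw [h', h1, h2, h3] at hne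
        exact hne rfl
      simpa [cell_inj, hmem, hne'] using this

end Count

/-! ### Extending chains -/

/-- Try the predecessor `U` of the chain end `V, W, X`. -/
def extendStep : Cmd := block [
  set varVal (freeE (var varL) (var varU) (var varV) (var varW) (var varE) (var varC)),
  ite (newNbr (var varU) (var varV) (var varW) (var varX) *
      (Expr.lt (var varE) (num 4 * size + num 3) * var varVal *
        Expr.lt (var varBest) (var varVal + num 1)))
    (block [set varBest (var varVal + num 1), set varSrc (var varU)])
    skip]

/-- Copy the bit for `Z` of the chain of the best predecessor, adding the vertex `X`. -/
def copyStep : Cmd :=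
  store (Expr.cell 1 (var varL + num 1) (var varV) (var varW) (var varX) (var varD) (var varZ))
    (load (Expr.cell 1 (var varL) (var varSrc) (var varV) (var varW) (var varI) (var varZ)) +
      Expr.eq (var varZ) (var varX))

/-- Compute the entries of tables `0` and `1` for one chain end and difference in the next layer. -/
def extendEntry : Cmd := block [
  set varBest (num 0),
  set varSrc (num 0),
  set varC (Expr.color (var varX)),
  set varE (var varD + num 1 - num 2 * var varC),
  loop varU 1 0 extendStep,
  store (Expr.cell 0 (var varL + num 1) (var varV) (var varW) (var varX) (var varD) (num 0))
    (var varBest),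
  set varI (sourceE (var varL) (var varSrc) (var varV) (var varW) (var varE) (var varC)),
  loop varZ 1 0 copyStep]

/-- Extend the chains of the current layer by one more vertex. -/
def extendTable : Cmd :=
  loops [(varV, 1, 0), (varW, 1, 0), (varX, 1, 0), (varD, 4, 3)] extendEntry

variable {n : ℕ} {G : SimpleGraph (Fin n)} {color : Fin n → VertexColor}

/-- The properties of `best` and `src` after the predecessors `u < j` have been tried, where `f u`
is the value that `u` offers. -/
def BestPred (G : SimpleGraph (Fin n)) (v w x : Fin n) (e : ℕ) (f : ℕ → ℕ)
    (j best src : ℕ) : Prop :=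
  best ≤ 3 * n + 1 ∧ src ≤ n ∧
    (best ≠ 0 → ∃ u : Fin n, src = u ∧ NewNbr G u v w x ∧ e < 4 * n + 3 ∧ f u ≠ 0 ∧
      best = f u + 1) ∧
    ∀ u : Fin n, (u : ℕ) < j → NewNbr G u v w x → e < 4 * n + 3 → f u ≠ 0 → f u + 1 ≤ best

theorem extendStep_exec (s : Store) (hin : HasInput G color s.mem) {l e c best src : ℕ}
    {u v w x : Fin n} {f : ℕ → ℕ} (hl : s.var varL = l) (hu : s.var varU = u) (hv : s.var varV = v)
    (hw : s.var varW = w) (hx : s.var varX = x) (he : s.var varE = e) (hc : s.var varC = c)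
    (hb : s.var varBest = best) (hs : s.var varSrc = src)
    (hf : s.mem (cell n 2 l u v w e c) = f u) (hle : e < 4 * n + 3 → f u ≤ 3 * n)
    (h : BestPred G v w x e f u best src) :
    BestPred G v w x e f (u + 1) ((extendStep.exec 24 n s).var varBest)
      ((extendStep.exec 24 n s).var varSrc) := by
  have hcut := cutoff n
  obtain ⟨h1, h2, h3, h4⟩ := h
  obtain ⟨k, hk⟩ : ∃ k, k = min (f u) ((n + 2) ^ 24) := ⟨_, rfl⟩
  rw [extendStep, exec_set_cons_min (v := k) (by simp [freeE, hl, hu, hv, hw, he, hc, hf, hk]),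
    exec_cons, exec_nil, exec]
  have hnew := eval_newNbr (σ := s.set varVal k) (a := var varU) (b := var varV) (c := var varW)
    (d := var varX) (u := u) (v := v) (w := w) (z := x) hin (by simp [hu]) (by simp [hv])
    (by simp [hw]) (by simp [hx])
  have hlast : ∀ b, (∀ y : Fin n, (y : ℕ) < u → NewNbr G y v w x → e < 4 * n + 3 → f y ≠ 0 →
      f y + 1 ≤ b) → (NewNbr G u v w x → e < 4 * n + 3 → f u ≠ 0 → f u + 1 ≤ b) →
      ∀ y : Fin n, (y : ℕ) < u + 1 → NewNbr G y v w x → e < 4 * n + 3 → f y ≠ 0 → f y + 1 ≤ b := by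
    intro b hb1 hb2 y hy
    rcases Nat.lt_succ_iff_lt_or_eq.1 hy with hy | hy
    · exact hb1 y hy
    · rw [Fin.ext hy]; exact hb2
  by_cases hcond : NewNbr G u v w x ∧ e < 4 * n + 3 ∧ f u ≠ 0 ∧ best < f u + 1
  · obtain ⟨c1, c2, c3, c4⟩ := hcond
    have hfu := hle c2
    rw [min_eq_left (by omega)] at hk
    have hu' := u.2
    rw [if_neg, exec_set_cons (v := f u + 1) (by simp [hk]) (by omega),
      exec_set_cons (v := u) (by simp [hu]) (by omega), exec_nil]
    · simp only [Store.set_var, reduceIte, Nat.reduceEqDiff]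
      refine ⟨by omega, by omega, fun _ => ⟨u, rfl, c1, c2, c3, rfl⟩, hlast _ (fun y hy a b c => ?_)
        fun _ _ _ => le_rfl⟩
      have := h4 y hy a b c
      omega
    · rw [eval_mul, Nat.mul_eq_zero, hnew]
      simp [he, hb, hk, c1]
      omega
  · rw [if_pos]
    · simp only [exec, Store.set_var, reduceIte, Nat.reduceEqDiff, hb, hs]
      refine ⟨h1, h2, h3, hlast _ h4 fun a b c => ?_⟩
      by_contra hlt
      exact hcond ⟨a, b, c, by omega⟩
    · rw [eval_mul, Nat.mul_eq_zero, hnew]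
      by_cases c1 : NewNbr G u v w x
      · right
        by_cases c2 : e < 4 * n + 3
        · have hfu := hle c2
          rw [min_eq_left (by omega)] at hk
          simp [he, hb, hk]
          by_contra hne
          exact hcond ⟨c1, c2, by omega, by omega⟩
        · simp [he, hb]
          omega
      · exact .inl c1

/-- The entry of table `0` for `l + 1, v, w, x, d` is the best value that a predecessor `u`
offers, and table `1` holds the path of that predecessor extended by `x`. -/
def ExtendOK (G : SimpleGraph (Fin n)) (color : Fin n → VertexColor) (l : ℕ) (v w x : Fin n) (d : ℕ)
    (m : ℕ → ℕ) : Prop :=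
  ∃ e, e = d + 1 - 2 * isColor color .red x ∧
    (m (cell n 0 (l + 1) v w x d 0) ≠ 0 → ∃ u : Fin n, NewNbr G u v w x ∧ e < 4 * n + 3 ∧
      m (cell n 2 l u v w e (isColor color .red x)) ≠ 0 ∧
      m (cell n 0 (l + 1) v w x d 0) = m (cell n 2 l u v w e (isColor color .red x)) + 1 ∧
      ∀ z : Fin n, m (cell n 1 (l + 1) v w x d z) ≠ 0 ↔
        m (cell n 1 l u v w (m (cell n 3 l u v w e (isColor color .red x))) z) ≠ 0 ∨ z = x) ∧
    ∀ u : Fin n, NewNbr G u v w x → e < 4 * n + 3 →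
      m (cell n 2 l u v w e (isColor color .red x)) ≠ 0 →
      m (cell n 2 l u v w e (isColor color .red x)) + 1 ≤ m (cell n 0 (l + 1) v w x d 0)

theorem copyLoop_spec (σ : Store) {l v w x d src i : ℕ} (hl : σ.var varL = l) (hv : σ.var varV = v)
    (hw : σ.var varW = w) (hx : σ.var varX = x) (hd : σ.var varD = d) (hs : σ.var varSrc = src)
    (hi : σ.var varI = i) {τ : Store} (hτ : τ = (loop varZ 1 0 copyStep).exec 24 n σ) :
    (∀ a, (∀ z, a ≠ cell n 1 (l + 1) v w x d z) → τ.mem a = σ.mem a) ∧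
      ∀ z < n, τ.mem (cell n 1 (l + 1) v w x d z) ≠ 0 ↔
        σ.mem (cell n 1 l src v w i z) ≠ 0 ∨ z = x := by
  have hcut := cutoff n
  have := loops_rule (J := 24) (n := n) [(varZ, 1, 0)] copyStep σ
    (fun s => ∀ a, (∀ z, a ≠ cell n 1 (l + 1) v w x d z) → s.mem a = σ.mem a)
    (fun idx s => ∀ z, idx = [z] → (s.mem (cell n 1 (l + 1) v w x d z) ≠ 0 ↔
        σ.mem (cell n 1 l src v w i z) ≠ 0 ∨ z = x))
    (fun s x v _ h => h) (fun l s x v _ h => h) (by decide) (by decide) ?_ (fun _ _ => rfl)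
  · simp only [loops] at this
    rw [← hτ] at this
    exact ⟨this.1, fun z hz => this.2 [z] (by simp [InRange, hz]) z rfl⟩
  · rintro _ s hr rfl hfr hI
    obtain ⟨k, hk⟩ : ∃ k, k = s.var varZ := ⟨_, rfl⟩
    simp only [List.map_cons, List.map_nil, ← hk] at hr ⊢
    have hL := hfr varL (by decide) (by decide)
    have hV := hfr varV (by decide) (by decide)
    have hW := hfr varW (by decide) (by decide)
    have hX := hfr varX (by decide) (by decide)
    have hD := hfr varD (by decide) (by decide)
    have hS := hfr varSrc (by decide) (by decide)
    have hi' := hfr varI (by decide) (by decide)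
    have hread : s.mem (cell n 1 l src v w i k) = σ.mem (cell n 1 l src v w i k) :=
      hI _ fun z => by rw [Ne, cell_inj]; omega
    have hrun : copyStep.exec 24 n s = s.put (cell n 1 (l + 1) v w x d k)
        (min (σ.mem (cell n 1 l src v w i k) + if k = x then 1 else 0) ((n + 2) ^ 24)) := by
      simp [copyStep, exec, hL, hV, hW, hX, hD, hS, hi', hl, hv, hw, hx, hd, hs, hi, ← hk, hread]
    rw [hrun]
    refine ⟨fun a ha => ?_, ?_, ?_⟩
    · rw [Store.put_mem, if_neg (ha k)]
      exact hI a ha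
    · intro z hz
      obtain rfl : k = z := by simpa using hz
      rw [Store.put_mem, if_pos rfl]
      split_ifs with h <;> simp [h]
    · intro l' _ hne h z hz
      have hzk : z ≠ k := fun h => hne (by rw [hz, h])
      have := h z hz
      simpa [cell_inj, hzk] using this

theorem extendEntry_spec (s : Store) (hin : HasInput G color s.mem) {l d : ℕ} {v w x : Fin n}
    (hl : s.var varL = l) (hv : s.var varV = v) (hw : s.var varW = w) (hx : s.var varX = x)
    (hd : s.var varD = d) (hdn : d < 4 * n + 3)
    (hle : ∀ u : Fin n, ∀ c < 3, ∀ e < 4 * n + 3, s.mem (cell n 2 l u v w e c) ≤ 3 * n ∧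
      (s.mem (cell n 2 l u v w e c) ≠ 0 → s.mem (cell n 3 l u v w e c) < 4 * n + 3)) :
    (∀ a, a ≠ cell n 0 (l + 1) v w x d 0 → (∀ z, a ≠ cell n 1 (l + 1) v w x d z) →
      (extendEntry.exec 24 n s).mem a = s.mem a) ∧
    ExtendOK G color l v w x d (extendEntry.exec 24 n s).mem := by
  have hcut := cutoff n
  obtain ⟨c, hc⟩ : ∃ c, c = isColor color .red x := ⟨_, rfl⟩
  have hc1 : c ≤ 1 := by rw [hc]; unfold isColor; cases color x <;> simp
  obtain ⟨e, he⟩ : ∃ e, e = d + 1 - 2 * c := ⟨_, rfl⟩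
  have hcol := eval_color (σ := (s.set varBest 0).set varSrc 0) (a := var varX) (u := x) hin
    (by simp [hx])
  obtain ⟨σ, hσ⟩ : ∃ σ, σ = (((s.set varBest 0).set varSrc 0).set varC c).set varE e := ⟨_, rfl⟩
  have hσm : σ.mem = s.mem := by rw [hσ]; rfl
  obtain ⟨τ, hτ⟩ : ∃ τ, τ = (loop varU 1 0 extendStep).exec 24 n σ := ⟨_, rfl⟩
  have hτm : τ.mem = s.mem := by rw [hτ, exec_pure _ _ _ _ (by rfl), hσm]
  have hτL : τ.var varL = l := by rw [hτ, exec_frame _ _ _ _ (by decide), hσ]; simp [hl]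
  have hτV : τ.var varV = v := by rw [hτ, exec_frame _ _ _ _ (by decide), hσ]; simp [hv]
  have hτW : τ.var varW = w := by rw [hτ, exec_frame _ _ _ _ (by decide), hσ]; simp [hw]
  have hτX : τ.var varX = x := by rw [hτ, exec_frame _ _ _ _ (by decide), hσ]; simp [hx]
  have hτD : τ.var varD = d := by rw [hτ, exec_frame _ _ _ _ (by decide), hσ]; simp [hd]
  have hτC : τ.var varC = c := by rw [hτ, exec_frame _ _ _ _ (by decide), hσ]; simp
  have hτE : τ.var varE = e := by rw [hτ, exec_frame _ _ _ _ (by decide), hσ]; simp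
  have hbest : BestPred G v w x e (fun u => s.mem (cell n 2 l u v w e c)) n (τ.var varBest)
      (τ.var varSrc) := by
    have := loop_rule (J := 24) (n := n) (x := varU) (a := 1) (b := 0) (c := extendStep) (σ := σ)
      (fun j s' => BestPred G v w x e (fun u => s.mem (cell n 2 l u v w e c)) j (s'.var varBest)
        (s'.var varSrc)) (fun j s v h => by simpa using h)
      (by simp [hσ, BestPred]) ?_
    · rw [← hτ] at this
      simpa using this
    · rintro j t hj hU hfr hm h
      obtain ⟨u, rfl⟩ : ∃ u : Fin n, j = u := ⟨⟨j, by omega⟩, rfl⟩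
      have hm' : t.mem = s.mem := by rw [hm (by rfl), hσm]
      exact extendStep_exec t (by rw [hm']; exact hin) (l := l) (e := e) (c := c)
        (by rw [hfr varL (by decide) (by decide), hσ]; simp [hl]) hU
        (by rw [hfr varV (by decide) (by decide), hσ]; simp [hv])
        (by rw [hfr varW (by decide) (by decide), hσ]; simp [hw])
        (by rw [hfr varX (by decide) (by decide), hσ]; simp [hx])
        (by rw [hfr varE (by decide) (by decide), hσ]; simp)
        (by rw [hfr varC (by decide) (by decide), hσ]; simp) rfl rfl (by rw [hm'])
        (fun he => (hle u c (by omega) e he).1) h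
  obtain ⟨i, hi⟩ : ∃ i, i = min (s.mem (cell n 3 l (τ.var varSrc) v w e c)) ((n + 2) ^ 24) :=
    ⟨_, rfl⟩
  obtain ⟨h1, h2, h3, h4⟩ := hbest
  obtain ⟨ρ, hρ⟩ : ∃ ρ, ρ = (loop varZ 1 0 copyStep).exec 24 n
    ((τ.put (cell n 0 (l + 1) v w x d 0) (τ.var varBest)).set varI i) := ⟨_, rfl⟩
  have hcopy := copyLoop_spec (n := n) (l := l) (v := v) (w := w) (x := x) (d := d)
    (src := τ.var varSrc) (i := i) _ (by simp [hτL]) (by simp [hτV]) (by simp [hτW])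
    (by simp [hτX]) (by simp [hτD]) (by simp) (by simp) hρ
  have hrun : extendEntry.exec 24 n s = ρ := by
    rw [extendEntry, exec_set_cons (v := 0) (by simp) (by omega),
      exec_set_cons (v := 0) (by simp) (by omega),
      exec_set_cons (v := c) (by rw [hcol, hc]) (by omega),
      exec_set_cons (v := e) (by simp [hd, he]) (by omega), ← hσ, exec_cons, ← hτ,
      exec_store_cons (a := cell n 0 (l + 1) v w x d 0) (v := τ.var varBest)
        (by simp [hτL, hτV, hτW, hτX, hτD]) (by simp) (by omega),
      exec_set_cons_min (v := i), exec_cons, ← hρ, exec_nil]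
    rw [hi]
    simp [sourceE, hτL, hτV, hτW, hτE, hτC, cell_inj, hτm]
  rw [hrun]
  simp only [Store.set_mem, Store.put_mem, cell_inj, hτm] at hcopy
  have keep : ∀ a, a ≠ cell n 0 (l + 1) v w x d 0 → (∀ z, a ≠ cell n 1 (l + 1) v w x d z) →
      ρ.mem a = s.mem a := fun a h0 h1 => by rw [hcopy.1 a h1, if_neg h0]
  have e0 : ρ.mem (cell n 0 (l + 1) v w x d 0) = τ.var varBest := by
    rw [hcopy.1 _ (fun z => by simp [cell_inj]), if_pos rfl]
  have e2 : ∀ u, ρ.mem (cell n 2 l u v w e c) = s.mem (cell n 2 l u v w e c) := fun u =>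
    keep _ (by simp [cell_inj]) (by simp [cell_inj])
  have e3 : ∀ u, ρ.mem (cell n 3 l u v w e c) = s.mem (cell n 3 l u v w e c) := fun u =>
    keep _ (by simp [cell_inj]) (by simp [cell_inj])
  have e1 : ∀ u i z, ρ.mem (cell n 1 l u v w i z) = s.mem (cell n 1 l u v w i z) := fun u i z =>
    keep _ (by simp [cell_inj]) (by simp [cell_inj])
  refine ⟨keep, e, by rw [he, hc], ?_, ?_⟩
  · rw [← hc, e0]
    intro hne
    obtain ⟨u, hu, hu1, hu2, hu3, hu4⟩ := h3 hne
    refine ⟨u, hu1, hu2, by rw [e2]; exact hu3, by rw [e2]; exact hu4, fun z => ?_⟩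
    rw [e3, e1, hcopy.2 z z.2]
    have := (hle u c (by omega) e hu2).2 hu3
    rw [hu, min_eq_left (by omega)] at hi
    simp [hi, hu, Fin.ext_iff]
  · rw [← hc, e0]
    intro u hu1 hu2 hu3
    rw [e2] at hu3 ⊢
    exact h4 u u.2 hu1 hu2 hu3

theorem extendTable_spec (σ : Store) (hin : HasInput G color σ.mem) {l : ℕ} (hl : σ.var varL = l)
    (hle : ∀ u v w : Fin n, ∀ c < 3, ∀ e < 4 * n + 3, σ.mem (cell n 2 l u v w e c) ≤ 3 * n ∧
      (σ.mem (cell n 2 l u v w e c) ≠ 0 → σ.mem (cell n 3 l u v w e c) < 4 * n + 3)) :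
    AgreeOff n (fun t k => (t = 0 ∨ t = 1) ∧ k = l + 1) σ.mem (extendTable.exec 24 n σ).mem ∧
    ∀ v w x : Fin n, ∀ d < 4 * n + 3, ExtendOK G color l v w x d (extendTable.exec 24 n σ).mem := by
  have key := loops_rule (J := 24) (n := n)
    [(varV, 1, 0), (varW, 1, 0), (varX, 1, 0), (varD, 4, 3)] extendEntry σ
    (fun s => AgreeOff n (fun t k => (t = 0 ∨ t = 1) ∧ k = l + 1) σ.mem s.mem)
    (fun idx s => ∀ (v w x : Fin n) d, idx = [(v : ℕ), (w : ℕ), (x : ℕ), d] →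
      ExtendOK G color l v w x d s.mem)
    (fun s x v _ h => h) (fun l s x v _ h => h) (by decide) (by decide) ?_ (.refl _)
  · exact ⟨key.1, fun v w x d hd => key.2 [v, w, x, d] (by simp [InRange, hd]) v w x d rfl⟩
  · rintro _ s hr rfl hfr hI
    simp only [List.map_cons, List.map_nil] at hr ⊢
    have hr' : s.var varV < n ∧ s.var varW < n ∧ s.var varX < n ∧ s.var varD < 4 * n + 3 := by
      simpa [InRange] using hr
    obtain ⟨v, hv⟩ : ∃ u : Fin n, s.var varV = u := ⟨⟨_, hr'.1⟩, rfl⟩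
    obtain ⟨w, hw⟩ : ∃ u : Fin n, s.var varW = u := ⟨⟨_, hr'.2.1⟩, rfl⟩
    obtain ⟨x, hx⟩ : ∃ u : Fin n, s.var varX = u := ⟨⟨_, hr'.2.2.1⟩, rfl⟩
    obtain ⟨d, hd⟩ : ∃ d, s.var varD = d := ⟨_, rfl⟩
    rw [hd] at hr'
    have hL := hfr varL (by decide) (by decide)
    rw [hl] at hL
    simp only [hv, hw, hx, hd] at hr ⊢
    obtain ⟨keep, hOK⟩ := extendEntry_spec (G := G) (color := color) s (hin.of_agreeOff hI) hL hv hw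
      hx hd hr'.2.2.2 (fun u c hc e he => by
        rw [hI.2 _ _ _ _ _ _ _ (by simp), hI.2 _ _ _ _ _ _ _ (by simp)]
        exact hle u v w c hc e he)
    generalize extendEntry.exec 24 n s = ρ at *
    refine ⟨⟨fun a ha => ?_, fun t k u' v' w' d' z hT => ?_⟩, ?_, ?_⟩
    · rw [keep a (fun h => ?_) (fun z h => ?_), hI.1 a ha]
      · have := le_cell n 0 (l + 1) v w x d 0
        omega
      · have := le_cell n 1 (l + 1) v w x d z
        omega
    · rw [keep _ (fun h => ?_) (fun z h => ?_), hI.2 _ _ _ _ _ _ _ hT]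
      · rw [cell_inj] at h
        exact hT ⟨.inl h.1, h.2.1⟩
      · rw [cell_inj] at h
        exact hT ⟨.inr h.1, h.2.1⟩
    · intro v' w' x' d' h
      simp only [List.cons.injEq, Fin.val_inj, and_true] at h
      obtain ⟨rfl, rfl, rfl, rfl⟩ := h
      exact hOK
    · intro l' hl' hne h v' w' x' d' h'
      have hne' : ¬ ((v' : ℕ) = v ∧ (w' : ℕ) = w ∧ (x' : ℕ) = x ∧ d' = d) := by
        rintro ⟨h1, h2, h3, h4⟩
        rw [h', h1, h2, h3, h4] at hne
        exact hne rfl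
      have keep' : ∀ t k a b c e z : ℕ,
          ¬ ((t = 0 ∨ t = 1) ∧ k = l + 1 ∧ a = v ∧ b = w ∧ c = x ∧ e = d) →
          ρ.mem (cell n t k a b c e z) = s.mem (cell n t k a b c e z) := by
        intro t k a b c e z ht
        refine keep _ (fun h => ht ?_) (fun z h => ht ?_)
        · obtain ⟨h1, h2, h3, h4, h5, h6, -⟩ := cell_inj.1 h
          exact ⟨.inl h1, h2, h3, h4, h5, h6⟩
        · obtain ⟨h1, h2, h3, h4, h5, h6, -⟩ := cell_inj.1 h
          exact ⟨.inr h1, h2, h3, h4, h5, h6⟩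
      have e0 := keep' 0 (l + 1) v' w' x' d' 0 fun h => hne' h.2.2
      have e1 := fun z => keep' 1 (l + 1) v' w' x' d' z fun h => hne' h.2.2
      have e2 := fun t u v w e z => keep' t l u v w e z fun h => by omega
      simpa only [ExtendOK, e0, e1, e2] using h v' w' x' d' h'

/-! ### The layers of the tables -/

theorem isColor_blue (color : Fin n → VertexColor) (x : Fin n) :
    isColor color .blue x = 1 - isColor color .red x ∧ isColor color .red x ≤ 1 := by
  unfold isColor
  cases color x <;> simp

/-- The vertex set recorded in table `1`. -/
def storedSet (n : ℕ) (m : ℕ → ℕ) (l u v w d : ℕ) : Set (Fin n) :=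
  {z | m (cell n 1 l u v w d z) ≠ 0}

/-- Table `0` holds the maximum sizes of the sets along chains with `l + 1` vertices, and table
`1` the vertex sets of the chains that attain them. -/
def LayerOK (G : SimpleGraph (Fin n)) (color : Fin n → VertexColor) (l : ℕ) (m : ℕ → ℕ) : Prop :=
  ∀ (u v w : Fin n), ∀ d < 4 * n + 3,
    (m (cell n 0 l u v w d 0) ≠ 0 →
      Attains G color (2 * n + 1) l u v w (storedSet n m l u v w d) d (m (cell n 0 l u v w d 0))) ∧
    ∀ P k, Attains G color (2 * n + 1) l u v w P d k → k ≤ m (cell n 0 l u v w d 0)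

/-- Table `4` holds the numbers of new neighbors of each color. -/
def CountOK (G : SimpleGraph (Fin n)) (color : Fin n → VertexColor) (m : ℕ → ℕ) : Prop :=
  ∀ u v w : Fin n, m (cell n 4 1 u v w 0 0) = newCount G color .red u v w ∧
    m (cell n 4 0 u v w 0 0) = newCount G color .blue u v w

theorem LayerOK.of_agreeOff {l : ℕ} {m m' : ℕ → ℕ} {T : ℕ → ℕ → Prop} (h : LayerOK G color l m)
    (h' : AgreeOff n T m m') (hT : ¬ T 0 l ∧ ¬ T 1 l) : LayerOK G color l m' := by
  have e0 : ∀ u v w d z, m' (cell n 0 l u v w d z) = m (cell n 0 l u v w d z) :=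
    fun _ _ _ _ _ => h'.2 _ _ _ _ _ _ _ hT.1
  have e1 : ∀ u v w d z, m' (cell n 1 l u v w d z) = m (cell n 1 l u v w d z) :=
    fun _ _ _ _ _ => h'.2 _ _ _ _ _ _ _ hT.2
  simpa only [LayerOK, storedSet, e0, e1] using h

theorem CountOK.of_agreeOff {m m' : ℕ → ℕ} {T : ℕ → ℕ → Prop} (h : CountOK G color m)
    (h' : AgreeOff n T m m') (hT : ∀ l, ¬ T 4 l) : CountOK G color m' := by
  have e : ∀ l u v w d z, m' (cell n 4 l u v w d z) = m (cell n 4 l u v w d z) :=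
    fun _ _ _ _ _ _ => h'.2 _ _ _ _ _ _ _ (hT _)
  simpa only [CountOK, e] using h

theorem FreeOK.of_agreeOff {l u v w c d : ℕ} {m m' : ℕ → ℕ} {T : ℕ → ℕ → Prop}
    (h : FreeOK n l u v w c d m) (h' : AgreeOff n T m m') (hT : ∀ t l', T t l' → t ≤ 1 ∧ l' ≠ l) :
    FreeOK n l u v w c d m' := by
  have e0 : ∀ u v w d z, m' (cell n 0 l u v w d z) = m (cell n 0 l u v w d z) :=
    fun _ _ _ _ _ => h'.2 _ _ _ _ _ _ _ fun h => (hT _ _ h).2 rfl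
  have e2 : ∀ u v w d z, m' (cell n 2 l u v w d z) = m (cell n 2 l u v w d z) :=
    fun _ _ _ _ _ => h'.2 _ _ _ _ _ _ _ fun h => (hT _ _ h).2 rfl
  have e3 : ∀ u v w d z, m' (cell n 3 l u v w d z) = m (cell n 3 l u v w d z) :=
    fun _ _ _ _ _ => h'.2 _ _ _ _ _ _ _ fun h => (hT _ _ h).2 rfl
  have e4 : ∀ l u v w d z, m' (cell n 4 l u v w d z) = m (cell n 4 l u v w d z) :=
    fun _ _ _ _ _ _ => h'.2 _ _ _ _ _ _ _ fun h => absurd (hT _ _ h).1 (by omega)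
  simpa only [FreeOK, e0, e2, e3, e4] using h

theorem LayerOK.entry_le {l : ℕ} {m : ℕ → ℕ} (h : LayerOK G color l m) (u v w : Fin n) {d : ℕ}
    (hd : d < 4 * n + 3) : m (cell n 0 l u v w d 0) ≤ n := by
  by_cases h0 : m (cell n 0 l u v w d 0) = 0
  · omega
  · have := (((h u v w d hd).1 h0).le).1
    rwa [Nat.card_fin] at this

theorem LayerOK.entry_zero {l : ℕ} {m : ℕ → ℕ} (h : LayerOK G color l m) (u v w : Fin n) :
    m (cell n 0 l u v w 0 0) = 0 := by
  by_contra h0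
  have := (((h u v w 0 (by omega)).1 h0).le).2.2
  rw [Nat.card_fin] at this
  omega

/-- The recurrence: the tables of one layer determine the next layer. -/
theorem LayerOK.succ {r : Fin n → Fin n → Prop} (hr : IsCocomparability G r) {l : ℕ} {m : ℕ → ℕ}
    (h : LayerOK G color l m) (hc : CountOK G color m)
    (hf : ∀ u v w : Fin n, ∀ c < 3, ∀ d < 4 * n + 3, FreeOK n l u v w c d m)
    (he : ∀ v w x : Fin n, ∀ d < 4 * n + 3, ExtendOK G color l v w x d m) :
    LayerOK G color (l + 1) m := by
  intro v w x d hd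
  obtain ⟨e, hed, hs, hcomp⟩ := he v w x d hd
  obtain ⟨hblue, hred⟩ := isColor_blue color x
  have hif1 : (if isColor color .red x = 1 then 1 else 0) = isColor color .red x := by
    split_ifs <;> omega
  have hif0 : (if isColor color .red x = 0 then 1 else 0) = isColor color .blue x := by
    split_ifs <;> omega
  refine ⟨fun hne => ?_, fun P' k hP' => ?_⟩
  · obtain ⟨u, hnew, heD, hF, hval, hset⟩ := hs hne
    clear hs hcomp
    obtain ⟨h1, h2, i, j, hi, hj, h3, h4⟩ := (hf u v w _ (by omega) e heD).1 hF
    rw [(hc u v w).1, hif1] at hi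
    rw [(hc u v w).2, hif0] at hj
    have hA := (h u v w _ h1).1 h2
    have hle := hA.le
    rw [Nat.card_fin] at hle
    have hjn : newCount G color .blue u v w ≤ n := colorCount_le _ _
    -- The bounds on the differences show that the subtraction in `e` has not been truncated.
    have := hA.step hr hnew (e := d) hi hj (by omega)
    rw [hval, h4]
    convert this using 1
    ext z
    exact (hset z).trans or_comm
  · clear hs
    obtain ⟨u, P, d', m', i, j, hA, hnew, hi, hj, hd', hk⟩ :=
      hP'.exists_of_succ hr (by rw [Nat.card_fin]; omega)
    have hle := hA.le
    rw [Nat.card_fin] at hle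
    have hin : newCount G color .red u v w ≤ n := colorCount_le _ _
    have hjn : newCount G color .blue u v w ≤ n := colorCount_le _ _
    have h1 := (h u v w d' (by omega)).2 P m' hA
    have h2 := hA.pos
    have h3 := (hf u v w (isColor color .red x) (by omega) e (by omega)).2 d' (by omega)
      (by omega) i j
      (by rw [(hc u v w).1, hif1]; exact hi) (by rw [(hc u v w).2, hif0]; exact hj) (by omega)
    have h4 := hcomp u hnew (by omega) (by omega)
    omega

/-- Enter the chain that consists of the vertex `U`. -/
def initStep : Cmd := block [
  set varD (num 2 * size + num 2 * Expr.color (var varU)),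
  store (Expr.cell 0 (num 0) (var varU) (var varU) (var varU) (var varD) (num 0)) (num 1),
  store (Expr.cell 1 (num 0) (var varU) (var varU) (var varU) (var varD) (var varU)) (num 1)]

/-- Enter the chains with one vertex. -/
def initTable : Cmd := loop varU 1 0 initStep

theorem initTable_spec (σ : Store) (hin : HasInput G color σ.mem)
    (hz : ∀ t u v w d z, σ.mem (cell n t 0 u v w d z) = 0 ∨ 4 ≤ t) :
    AgreeOff n (fun t l => (t = 0 ∨ t = 1) ∧ l = 0) σ.mem (initTable.exec 24 n σ).mem ∧
      LayerOK G color 0 (initTable.exec 24 n σ).mem := by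
  have hcut := cutoff n
  have key := loop_rule (J := 24) (n := n) (x := varU) (a := 1) (b := 0) (c := initStep) (σ := σ)
    (fun j s => AgreeOff n (fun t l => (t = 0 ∨ t = 1) ∧ l = 0) σ.mem s.mem ∧
      ∀ u v w : Fin n, ∀ d, s.mem (cell n 0 0 u v w d 0) =
          (if u = v ∧ u = w ∧ (u : ℕ) < j ∧ d = 2 * n + 2 * isColor color .red u then 1 else 0) ∧
        ∀ z : Fin n, s.mem (cell n 1 0 u v w d z) =
          (if z = u ∧ u = v ∧ u = w ∧ (u : ℕ) < j ∧ d = 2 * n + 2 * isColor color .red u then 1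
            else 0))
    (fun j s v h => h) ⟨.refl _, fun u v w d => ⟨?_, fun z => ?_⟩⟩ ?_
  · obtain ⟨hA, hT⟩ := key
    rw [← initTable] at hA hT
    refine ⟨hA, fun u v w d hd => ?_⟩
    generalize (initTable.exec 24 n σ).mem = m at *
    obtain ⟨hblue, hred⟩ := isColor_blue color u
    have hval := (hT u v w d).1
    refine ⟨fun h => ?_, ?_⟩
    · by_cases hcond : u = v ∧ u = w ∧ (u : ℕ) < 1 * n + 0 ∧ d = 2 * n + 2 * isColor color .red u
      · rw [if_pos hcond] at hval
        have hset : storedSet n m 0 u v w d = {u} := by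
          ext z
          have := (hT u v w d).2 z
          simp only [storedSet, Set.mem_ofPred_eq, Set.mem_singleton_iff]
          refine ⟨fun h => ?_, fun hz => by rw [this, if_pos ⟨hz, hcond⟩]; exact one_ne_zero⟩
          by_contra hz
          exact h (by rw [this, if_neg fun hh => hz hh.1])
        obtain ⟨rfl, rfl, -, hd'⟩ := hcond
        refine ⟨{u}, isColor color .red u, isColor color .blue u, ?_⟩
        rw [hset, colorCount_singleton, colorCount_singleton, ← isColor_eq, ← isColor_eq, hval]
        exact ⟨.single u, le_rfl, le_rfl, le_rfl, le_rfl, by omega, by omega⟩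
      · rw [if_neg hcond] at hval
        exact absurd hval h
    · rintro P k ⟨N, a, b, hc, h1, h2, h3, h4, h5, h6⟩
      cases hc
      rw [colorCount_singleton, ← isColor_eq] at h1 h2 h3 h4
      rw [if_pos ⟨rfl, rfl, by have := u.2; omega, by omega⟩] at hval
      omega
  · simpa using hz 0 u v w d 0
  · simpa using hz 1 u v w d z
  · rintro j s hj hU hfr hm ⟨hA, hT⟩
    obtain ⟨a, rfl⟩ : ∃ a : Fin n, j = a := ⟨⟨j, by omega⟩, rfl⟩
    obtain ⟨hblue, hred⟩ := isColor_blue color a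
    have hcol := eval_color (σ := s) (a := var varU) (u := a) (hin.of_agreeOff hA) (by simp [hU])
    obtain ⟨e, he⟩ : ∃ e, e = 2 * n + 2 * isColor color .red a := ⟨_, rfl⟩
    have hrun : initStep.exec 24 n s =
        ((s.set varD e).put (cell n 0 0 a a a e 0) 1).put (cell n 1 0 a a a e a) 1 := by
      rw [initStep, exec_set_cons (v := e) (by simp [hcol, he]) (by omega),
        exec_store_cons (a := cell n 0 0 a a a e 0) (v := 1) (by simp [hU]) (by simp) (by omega),
        exec_store_cons (a := cell n 1 0 a a a e a) (v := 1) (by simp [hU]) (by simp) (by omega),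
        exec_nil]
    rw [hrun]
    have hA' : AgreeOff n (fun t l => (t = 0 ∨ t = 1) ∧ l = 0) σ.mem (s.set varD e).mem := hA
    refine ⟨(hA'.put (by simp) _).put (by simp) _, fun u v w d => ⟨?_, fun z => ?_⟩⟩
    · have := (hT u v w d).1
      simp only [Store.put_mem, Store.set_mem, cell_inj, this, Fin.val_inj]
      by_cases hua : u = a
      · subst hua
        by_cases h2 : u = v
        · subst h2
          by_cases h3 : u = w
          · subst h3; simp [he]
          · simp [h3, Ne.symm h3]
        · simp [h2, Ne.symm h2]
      · have : ((u : ℕ) < a + 1) ↔ (u : ℕ) < a := by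
          have : (u : ℕ) ≠ a := fun h => hua (Fin.ext h)
          omega
        simp only [this]
        simp [hua]
    · have := (hT u v w d).2 z
      simp only [Store.put_mem, Store.set_mem, cell_inj, this, Fin.val_inj]
      by_cases hua : u = a
      · subst hua
        by_cases h2 : u = v
        · subst h2
          by_cases h3 : u = w
          · subst h3; simp [he, and_comm]
          · simp [h3, Ne.symm h3]
        · simp [h2, Ne.symm h2]
      · have : ((u : ℕ) < a + 1) ↔ (u : ℕ) < a := by
          have : (u : ℕ) ≠ a := fun h => hua (Fin.ext h)
          omega
        simp only [this]
        simp [hua]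

/-- Process the layers one after the other. -/
def layers : Cmd := loop varL 1 0 (block [freeTable, extendTable])

/-- The situation before layer `l` is processed. -/
structure LayersOK (G : SimpleGraph (Fin n)) (color : Fin n → VertexColor) (l : ℕ) (m : ℕ → ℕ) :
    Prop where
  input : HasInput G color m
  out : ∀ a, n * n + n ≤ a → a < n * n + (n + n) → m a = 0
  count : CountOK G color m
  layer : ∀ k ≤ l, LayerOK G color k m
  free : ∀ k < l, ∀ u v w : Fin n, ∀ c < 3, ∀ d < 4 * n + 3, FreeOK n k u v w c d m

theorem layers_spec {r : Fin n → Fin n → Prop} (hr : IsCocomparability G r) (σ : Store)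
    (h : LayersOK G color 0 σ.mem) : LayersOK G color n (layers.exec 24 n σ).mem := by
  have key := loop_rule (J := 24) (n := n) (x := varL) (a := 1) (b := 0)
    (c := block [freeTable, extendTable]) (σ := σ) (fun j s => LayersOK G color j s.mem)
    (fun j s v h => h) h ?_
  · simpa only [layers, one_mul, add_zero] using key
  · rintro l s hl hL - - h
    rw [exec_cons, exec_cons, exec_nil]
    have hcn : ∀ (u v w : Fin n), newCount G color .red u v w ≤ n ∧
      newCount G color .blue u v w ≤ n := fun u v w => ⟨colorCount_le _ _, colorCount_le _ _⟩
    have hlay := h.layer l le_rfl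
    obtain ⟨hA, hF⟩ := freeTable_spec (n := n) (l := l) s hL
      (fun u hu v hv w hw e he => hlay.entry_le ⟨u, hu⟩ ⟨v, hv⟩ ⟨w, hw⟩ he)
      (fun u hu v hv w hw => hlay.entry_zero ⟨u, hu⟩ ⟨v, hv⟩ ⟨w, hw⟩)
      (fun u hu v hv w hw => ⟨by
        rw [(h.count ⟨u, hu⟩ ⟨v, hv⟩ ⟨w, hw⟩).1]; exact (hcn _ _ _).1, by
        rw [(h.count ⟨u, hu⟩ ⟨v, hv⟩ ⟨w, hw⟩).2]; exact (hcn _ _ _).2⟩)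
    have hL' : (freeTable.exec 24 n s).var varL = l := by
      rw [exec_frame _ _ _ _ (by decide), hL]
    generalize freeTable.exec 24 n s = τ at *
    have hin := h.input.of_agreeOff hA
    have hlay' := hlay.of_agreeOff hA (by simp)
    have hcount := h.count.of_agreeOff hA (by simp)
    have hF' : ∀ u v w : Fin n, ∀ c < 3, ∀ d < 4 * n + 3, FreeOK n l u v w c d τ.mem :=
      fun u v w c hc d hd => hF u u.2 v v.2 w w.2 c hc d hd
    obtain ⟨hB, hE⟩ := extendTable_spec (G := G) (color := color) τ hin hL'
      (fun u v w c hc e he => by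
      obtain ⟨f1, -⟩ := hF' u v w c hc e he
      refine ⟨?_, fun h => (f1 h).1⟩
      by_cases h0 : τ.mem (cell n 2 l u v w e c) = 0
      · omega
      · obtain ⟨g1, g2, i, j, g3, g4, g5, g6⟩ := f1 h0
        have := hlay'.entry_le u v w g1
        rw [(hcount u v w).1] at g3
        rw [(hcount u v w).2] at g4
        have := hcn u v w
        omega)
    generalize extendTable.exec 24 n τ = ρ at *
    have hcount' := hcount.of_agreeOff hB (by simp)
    have hlay'' := hlay'.of_agreeOff hB (by simp)
    have hF'' : ∀ u v w : Fin n, ∀ c < 3, ∀ d < 4 * n + 3, FreeOK n l u v w c d ρ.mem :=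
      fun u v w c hc d hd => (hF' u v w c hc d hd).of_agreeOff hB (by rintro t l' ⟨h, rfl⟩; omega)
    refine ⟨hin.of_agreeOff hB, fun a h1 h2 => ?_, hcount', fun k hk => ?_, fun k hk => ?_⟩
    · rw [hB.1 a h2, hA.1 a h2]
      exact h.out a h1 h2
    · rcases Nat.le_succ_iff.1 hk with hk | rfl
      · exact ((h.layer k hk).of_agreeOff hA (by simp)).of_agreeOff hB (by simp; omega)
      · exact hlay''.succ hr hcount' hF'' hE
    · rcases Nat.lt_succ_iff_lt_or_eq.1 hk with hk | rfl
      · intro u v w c hc d hd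
        refine FreeOK.of_agreeOff ?_ hB (by rintro t l' ⟨h, rfl⟩; omega)
        obtain ⟨e0, e2, e3, e4⟩ : (∀ u v w d z, τ.mem (cell n 0 k u v w d z) =
            s.mem (cell n 0 k u v w d z)) ∧ (∀ u v w d z, τ.mem (cell n 2 k u v w d z) =
            s.mem (cell n 2 k u v w d z)) ∧ (∀ u v w d z, τ.mem (cell n 3 k u v w d z) =
            s.mem (cell n 3 k u v w d z)) ∧ ∀ l u v w d z, τ.mem (cell n 4 l u v w d z) =
            s.mem (cell n 4 l u v w d z) :=
          ⟨fun _ _ _ _ _ => hA.2 _ _ _ _ _ _ _ (by simp),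
            fun _ _ _ _ _ => hA.2 _ _ _ _ _ _ _ (by simp; omega),
            fun _ _ _ _ _ => hA.2 _ _ _ _ _ _ _ (by simp; omega),
            fun _ _ _ _ _ _ => hA.2 _ _ _ _ _ _ _ (by simp)⟩
        simpa only [FreeOK, e0, e2, e3, e4] using h.free k hk u v w c hc d hd
      · exact hF''

/-! ### Search for the maximum -/

/-- Compare the best completion of one entry of the tables with the best solution so far. -/
def searchStep : Cmd := block [
  set varBest (freeE (var varL) (var varU) (var varV) (var varW) (num 2 * size + num 1) (num 2)),
  ite (Expr.lt (var varGoal) (var varBest))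
    (block [
      set varGoal (var varBest),
      set varFoundL (var varL),
      set varFoundU (var varU),
      set varFoundV (var varV),
      set varFoundW (var varW),
      set varFoundD (sourceE (var varL) (var varU) (var varV) (var varW) (num 2 * size + num 1)
        (num 2))])
    skip]

/-- Search the tables for the maximum size of a balanced connected set. -/
def search : Cmd := block [
  set varGoal (num 0),
  loops [(varL, 1, 0), (varU, 1, 0), (varV, 1, 0), (varW, 1, 0)] searchStep]

theorem search_spec (σ : Store) (F S : ℕ → ℕ → ℕ → ℕ → ℕ)
    (hF : ∀ l u v w, σ.mem (cell n 2 l u v w (2 * n + 1) 2) = F l u v w)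
    (hS : ∀ l u v w, σ.mem (cell n 3 l u v w (2 * n + 1) 2) = S l u v w)
    (hle : ∀ l < n, ∀ u < n, ∀ v < n, ∀ w < n, F l u v w ≤ 3 * n ∧
      (F l u v w ≠ 0 → S l u v w < 4 * n + 3)) {τ : Store} (hτ : τ = search.exec 24 n σ) :
    (τ.var varGoal ≠ 0 → ∃ l < n, ∃ u < n, ∃ v < n, ∃ w < n,
      τ.var varFoundL = l ∧ τ.var varFoundU = u ∧ τ.var varFoundV = v ∧ τ.var varFoundW = w ∧
      τ.var varFoundD = S l u v w ∧ τ.var varGoal = F l u v w) ∧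
    ∀ l < n, ∀ u < n, ∀ v < n, ∀ w < n, F l u v w ≤ τ.var varGoal := by
  have hcut := cutoff n
  have key := loops_rule (J := 24) (n := n)
    [(varL, 1, 0), (varU, 1, 0), (varV, 1, 0), (varW, 1, 0)] searchStep (σ.set varGoal 0)
    (fun s => s.mem = σ.mem ∧ (s.var varGoal ≠ 0 → ∃ l < n, ∃ u < n, ∃ v < n, ∃ w < n,
      s.var varFoundL = l ∧ s.var varFoundU = u ∧ s.var varFoundV = v ∧ s.var varFoundW = w ∧
      s.var varFoundD = S l u v w ∧ s.var varGoal = F l u v w))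
    (fun idx s => match idx with
      | [l, u, v, w] => F l u v w ≤ s.var varGoal
      | _ => True) ?_ ?_ (by decide) (by decide) ?_ ⟨rfl, fun h => absurd (by simp) h⟩
  · rw [search, exec_set_cons (v := 0) (by simp) (by omega), exec_cons, exec_nil] at hτ
    rw [← hτ] at key
    refine ⟨key.1.2, fun l hl u hu v hv w hw => key.2 [l, u, v, w] ?_⟩
    simp [InRange, hl, hu, hv, hw]
  · rintro s x v hx ⟨h1, h2⟩
    simp only [List.map_cons, List.map_nil, List.mem_cons, List.not_mem_nil, or_false] at hx
    have h : ∀ y, 17 ≤ y → (s.set x v).var y = s.var y := fun y hy => by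
      rw [Store.set_var, if_neg (by omega)]
    simp only [h varGoal (by omega), h varFoundL (by omega), h varFoundU (by omega),
      h varFoundV (by omega),
      h varFoundW (by omega), h varFoundD (by omega)]
    exact ⟨h1, h2⟩
  · rintro idx s x v hx h
    simp only [List.map_cons, List.map_nil, List.mem_cons, List.not_mem_nil, or_false] at hx
    split at h
    · rwa [Store.set_var, if_neg (by omega)]
    · exact h
  · rintro _ s hr rfl hfr ⟨hm, hI⟩
    simp only [List.map_cons, List.map_nil] at hr ⊢
    obtain ⟨l, hl⟩ : ∃ l, l = s.var varL := ⟨_, rfl⟩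
    obtain ⟨u, hu⟩ : ∃ l, l = s.var varU := ⟨_, rfl⟩
    obtain ⟨v, hv⟩ : ∃ l, l = s.var varV := ⟨_, rfl⟩
    obtain ⟨w, hw⟩ : ∃ l, l = s.var varW := ⟨_, rfl⟩
    simp only [← hl, ← hu, ← hv, ← hw] at hr ⊢
    have hr' : l < n ∧ u < n ∧ v < n ∧ w < n := by simpa [InRange] using hr
    obtain ⟨h1, h2, h3, h4⟩ := hr'
    have hFS := hle l h1 u h2 v h3 w h4
    by_cases hlt : s.var varGoal < F l u v w
    · have hrun : searchStep.exec 24 n s = ((((((s.set varBest (F l u v w)).set varGoal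
          (F l u v w)).set varFoundL l).set varFoundU u).set varFoundV v).set varFoundW
          w).set varFoundD (S l u v w) := by
        have := hFS.2 (by omega)
        rw [searchStep, exec_set_cons (v := F l u v w)
          (by simp [freeE, ← hl, ← hu, ← hv, ← hw, hm, hF]) (by omega), exec_cons, exec_nil, exec,
          if_neg (by simp; omega), exec_set_cons (v := F l u v w) (by simp) (by omega),
          exec_set_cons (v := l) (by simp [hl]) (by omega),
          exec_set_cons (v := u) (by simp [hu]) (by omega),
          exec_set_cons (v := v) (by simp [hv]) (by omega),
          exec_set_cons (v := w) (by simp [hw]) (by omega),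
          exec_set_cons (v := S l u v w)
            (by simp [sourceE, ← hl, ← hu, ← hv, ← hw, hm, hS]) (by omega), exec_nil]
      rw [hrun]
      refine ⟨⟨hm, fun _ => ⟨l, h1, u, h2, v, h3, w, h4, ?_⟩⟩, ?_, ?_⟩
      · simp
      · simp
      · intro l' hl' hne h
        simp only [InRange] at hl'
        obtain ⟨l', _, rfl, -, u', _, rfl, -, v', _, rfl, -, w', _, rfl, -, rfl⟩ := hl'
        simp at h ⊢
        omega
    · have hrun : searchStep.exec 24 n s = s.set varBest (F l u v w) := by
        rw [searchStep, exec_set_cons (v := F l u v w)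
          (by simp [freeE, ← hl, ← hu, ← hv, ← hw, hm, hF]) (by omega), exec_cons, exec_nil, exec,
          if_pos (by simp; omega), exec]
      rw [hrun]
      refine ⟨⟨hm, by simpa using hI⟩, by simpa using hlt, ?_⟩
      intro l' hl' hne h
      simp only [InRange] at hl'
      obtain ⟨l', _, rfl, -, u', _, rfl, -, v', _, rfl, -, w', _, rfl, -, rfl⟩ := hl'
      simpa using h

/-- The search finds the maximum size `g` of a balanced connected set, together with a chain from
which such a set can be completed; it finds `0` if there is none. -/
theorem search_correct {r : Fin n → Fin n → Prop} {f : Fin n → ℕ} (hr : IsCocomparability G r)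
    (hrf : ∀ u v, r u v → f u < f v) (σ : Store) (h : LayersOK G color n σ.mem) {τ : Store}
    (hτ : τ = search.exec 24 n σ) :
    (τ.var varGoal ≠ 0 → ∃ k P N u v w a, Chain G k P N u v w ∧ τ.var varGoal = 2 * a ∧ a ≤ n ∧
      (∀ z : Fin n, z ∈ P ↔ σ.mem (cell n 1 (τ.var varFoundL) (τ.var varFoundU) (τ.var varFoundV)
        (τ.var varFoundW) (τ.var varFoundD) z) ≠ 0) ∧
      ∀ c, colorCount color c P ≤ a ∧
        a ≤ colorCount color c (N ∪ {z | NewNbr G u v w z})) ∧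
    ∀ S, IsBalancedConnected G color S → S.ncard ≤ τ.var varGoal := by
  obtain ⟨hs, hc⟩ := search_spec σ (fun l u v w => σ.mem (cell n 2 l u v w (2 * n + 1) 2))
    (fun l u v w => σ.mem (cell n 3 l u v w (2 * n + 1) 2)) (fun _ _ _ _ => rfl)
    (fun _ _ _ _ => rfl) (fun l hl u hu v hv w hw => by
      obtain ⟨f1, -⟩ := h.free l hl ⟨u, hu⟩ ⟨v, hv⟩ ⟨w, hw⟩ 2 (by omega) (2 * n + 1) (by omega)
      refine ⟨?_, fun h => (f1 h).1⟩
      by_cases h0 : σ.mem (cell n 2 l u v w (2 * n + 1) 2) = 0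
      · omega
      · obtain ⟨g1, g2, i, j, g3, g4, g5, g6⟩ := f1 h0
        have := (h.layer l hl.le).entry_le ⟨u, hu⟩ ⟨v, hv⟩ ⟨w, hw⟩ g1
        rw [(h.count ⟨u, hu⟩ ⟨v, hv⟩ ⟨w, hw⟩).1] at g3
        rw [(h.count ⟨u, hu⟩ ⟨v, hv⟩ ⟨w, hw⟩).2] at g4
        have b1 : newCount G color .red ⟨u, hu⟩ ⟨v, hv⟩ ⟨w, hw⟩ ≤ n := colorCount_le _ _
        have b2 : newCount G color .blue ⟨u, hu⟩ ⟨v, hv⟩ ⟨w, hw⟩ ≤ n := colorCount_le _ _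
        simp only at *
        omega) hτ
  refine ⟨fun hne => ?_, fun S hS => ?_⟩
  · obtain ⟨l, hl, u, hu, v, hv, w, hw, e1, e2, e3, e4, e5, e6⟩ := hs hne
    obtain ⟨f1, -⟩ := h.free l hl ⟨u, hu⟩ ⟨v, hv⟩ ⟨w, hw⟩ 2 (by omega) (2 * n + 1) (by omega)
    rw [e6] at hne
    obtain ⟨g1, g2, i, j, g3, g4, g5, g6⟩ := f1 hne
    rw [(h.count _ _ _).1] at g3
    rw [(h.count _ _ _).2] at g4
    have hA := (h.layer l hl.le _ _ _ _ g1).1 g2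
    obtain ⟨N, a, h1, h2, h3⟩ := hA.exists_final hr (i := i) (j := j) (by simpa using g3)
      (by simpa using g4) (by simpa using g5)
    have := colorCount_le (color := color) .red (N ∪ {z | NewNbr G ⟨u, hu⟩ ⟨v, hv⟩ ⟨w, hw⟩ z})
    have := (h3 .red).2
    refine ⟨l, _, N, _, _, _, a, h1, by rw [e6, g6, ← h2], by omega, fun z => ?_, h3⟩
    rw [e1, e2, e3, e4, e5]
    rfl
  · -- A chain of `S` has at most `n` vertices, so it occurs in one of the layers.
    obtain ⟨k, P, N, u, v, w, hch, hPS, hSN⟩ := exists_chain hr hrf hS.1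
    obtain ⟨d, m, i, j, hA, hi, hj, hd, hm⟩ := hch.exists_attains hr (color := color)
      (K := 2 * n + 1) hPS hSN hS.2 (by rw [Nat.card_fin]; omega)
    have hk : k < n := by
      have h1 := hch.ncard_eq hr
      have h2 := Set.ncard_le_card P
      rw [Nat.card_fin] at h2
      omega
    have hle := hA.le
    rw [Nat.card_fin] at hle
    have hpos := hA.pos
    have h1 := (h.layer k hk.le u v w d (by omega)).2 P m hA
    have h2 := (h.free k hk u v w 2 (by omega) (2 * n + 1) (by omega)).2 d (by omega) (by omega) i j
      (by rw [(h.count u v w).1]; simpa using hi) (by rw [(h.count u v w).2]; simpa using hj)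
      (by omega)
    have h3 := hc k hk u u.2 v v.2 w w.2
    omega

/-! ### The output -/

/-- Add a vertex to the output unless it is there or the output has enough vertices of its color. -/
def addVertex : Cmd :=
  ite (load (Expr.out (var varZ))) skip
    (ite (Expr.color (var varZ))
      (ite (Expr.lt (num 2 * var varRed) (var varGoal))
        (block [store (Expr.out (var varZ)) (num 1), set varRed (var varRed + num 1)]) skip)
      (ite (Expr.lt (num 2 * var varBlue) (var varGoal))
        (block [store (Expr.out (var varZ)) (num 1), set varBlue (var varBlue + num 1)]) skip))

/-- Whether a vertex is on the chain that the search has found. -/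
def onChain (z : Expr) : Expr :=
  load (Expr.cell 1 (var varFoundL) (var varFoundU) (var varFoundV) (var varFoundW)
    (var varFoundD) z)

/-- Look for a vertex of the chain whose closed neighborhood contains `Z`. -/
def nearChain : Cmd :=
  loop varX 1 0 (ite (onChain (var varX) * near (var varX) (var varZ)) (set varBest (num 1)) skip)

/-- Offer the vertex `Z` to the output if it is in the closed neighborhood of the chain. -/
def offerNear : Cmd := block [
  set varBest (num 0),
  nearChain,
  ite (var varBest) addVertex skip]

/-- Write a solution to the output: the vertices of the chain, and vertices of its closed
neighborhood until half of the goal is reached for both colors. -/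
def output : Cmd :=
  ite (var varGoal) (block [
    set varRed (num 0),
    set varBlue (num 0),
    loop varZ 1 0 (ite (onChain (var varZ)) addVertex skip),
    loop varZ 1 0 offerNear]) skip

theorem HasInput.congr {m m' : ℕ → ℕ} (h : HasInput G color m)
    (h' : ∀ a < n * n + n, m' a = m a) : HasInput G color m' := by
  refine ⟨fun i j => ?_, fun i => ?_⟩
  · rw [h' _ (by have := mul_add_lt_mul_self i j; omega)]
    exact h.1 i j
  · rw [h' _ (by omega)]
    exact h.2 i

open Classical in
/-- The output is the set `X`, its vertices are counted, and the rest of the memory is `m`. -/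
structure Selected (color : Fin n → VertexColor) (m : ℕ → ℕ) (X : Set (Fin n)) (s : Store) :
    Prop where
  out : ∀ z : Fin n, s.mem (n * n + n + z) = if z ∈ X then 1 else 0
  red : s.var varRed = colorCount color .red X
  blue : s.var varBlue = colorCount color .blue X
  mem : ∀ a, a < n * n + n ∨ n * n + (n + n) ≤ a → s.mem a = m a

/-- The vertices `z < j` of `C` have been added to `X₀` as long as there were fewer than `a`
vertices of their color. -/
def Offered (color : Fin n → VertexColor) (m : ℕ → ℕ) (a : ℕ) (X₀ C : Set (Fin n)) (j : ℕ)
    (s : Store) : Prop :=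
  ∃ X, Selected color m X s ∧ X₀ ⊆ X ∧ X ⊆ X₀ ∪ C ∧
    ∀ c, colorCount color c X ≤ a ∧
      (colorCount color c X < a → ∀ z : Fin n, (z : ℕ) < j → z ∈ C → color z = c → z ∈ X)

section Offer

variable {m : ℕ → ℕ} {a j : ℕ} {X₀ C X : Set (Fin n)} {s s' : Store}

theorem Offered.congr (h : Offered color m a X₀ C j s) (hm : s'.mem = s.mem)
    (hr : s'.var varRed = s.var varRed) (hb : s'.var varBlue = s.var varBlue) :
    Offered color m a X₀ C j s' := by
  obtain ⟨X, h1, h2⟩ := h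
  exact ⟨X, ⟨by rw [hm]; exact h1.out, by rw [hr]; exact h1.red, by rw [hb]; exact h1.blue,
    by rw [hm]; exact h1.mem⟩, h2⟩

theorem Offered.set (h : Offered color m a X₀ C j s) {x : ℕ} (hr : x ≠ varRed) (hb : x ≠ varBlue)
    (v : ℕ) : Offered color m a X₀ C j (s.set x v) :=
  h.congr rfl (by rw [Store.set_var, if_neg hr.symm]) (by rw [Store.set_var, if_neg hb.symm])

theorem Offered.skip {z : Fin n} (h : Offered color m a X₀ C z s) (hz : z ∉ C) :
    Offered color m a X₀ C (z + 1) s := by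
  obtain ⟨X, h1, h2, h3, h4⟩ := h
  refine ⟨X, h1, h2, h3, fun c => ⟨(h4 c).1, fun hlt y hy hyC hc => (h4 c).2 hlt y ?_ hyC hc⟩⟩
  have : (y : ℕ) ≠ z := fun h => hz (Fin.ext h ▸ hyC)
  omega

theorem addVertex_spec (hin : HasInput G color m) (h : Selected color m X s) {z : Fin n}
    (hz : s.var varZ = z) (hg : s.var varGoal = 2 * a) :
    (Selected color m X (addVertex.exec 24 n s) ∧ (z ∈ X ∨ a ≤ colorCount color (color z) X)) ∨
      (Selected color m (insert z X) (addVertex.exec 24 n s) ∧ z ∉ X ∧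
        colorCount color (color z) X < a) := by
  classical
  have hcut := cutoff n
  have hcol := eval_color (σ := s) (a := var varZ) (u := z)
    (hin.congr fun a ha => h.mem a (.inl ha)) (by simp [hz])
  have hout : (load (Expr.out (var varZ))).eval n s = if z ∈ X then 1 else 0 := by
    simpa [Expr.out, hz] using h.out z
  have haddr : (Expr.out (var varZ)).eval n s = n * n + n + z := by simp [Expr.out, hz]
  have b1 := colorCount_le (color := color) .red X
  have b2 := colorCount_le (color := color) .blue X
  have hins : z ∉ X → ∀ x v, Selected color m X s →
      (colorCount color .red (insert z X) =
        if varRed = x then v else colorCount color .red X) →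
      (colorCount color .blue (insert z X) =
        if varBlue = x then v else colorCount color .blue X) →
      Selected color m (insert z X) ((s.put (n * n + n + z) 1).set x v) := by
    intro hzX x v h e1 e2
    refine ⟨fun y => ?_, by simp [h.red, e1], by simp [h.blue, e2], fun b hb => ?_⟩
    · rw [Store.set_mem, Store.put_mem]
      by_cases hyz : y = z
      · simp [hyz]
      · have : (y : ℕ) ≠ z := fun h => hyz (Fin.ext h)
        rw [if_neg (by omega), h.out y]
        simp [hyz]
    · rw [Store.set_mem, Store.put_mem, if_neg (by omega), h.mem b hb]
  simp only [addVertex, exec]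
  by_cases hzX : z ∈ X
  · rw [if_neg (by rw [hout, if_pos hzX]; omega)]
    exact .inl ⟨h, .inl hzX⟩
  rw [if_pos (by rw [hout, if_neg hzX])]
  have i1 := colorCount_insert color .red hzX
  have i2 := colorCount_insert color .blue hzX
  rcases hc : color z with _ | _
  · rw [if_neg (by rw [hcol]; simp [isColor, hc])]
    by_cases hlt : colorCount color .red X < a
    · rw [if_neg (by simp [hg, h.red]; omega), exec_store_cons (v := 1) haddr (by simp) (by omega),
        exec_set_cons (v := colorCount color .red X + 1) (by simp [h.red]) (by omega), exec_nil]
      exact .inr ⟨hins hzX _ _ h (by simp [i1, hc]) (by simp [i2, hc]), hzX, hlt⟩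
    · rw [if_pos (by simp [hg, h.red]; omega)]
      exact .inl ⟨h, .inr (by omega)⟩
  · rw [if_pos (by rw [hcol]; simp [isColor, hc])]
    by_cases hlt : colorCount color .blue X < a
    · rw [if_neg (by simp [hg, h.blue]; omega), exec_store_cons (v := 1) haddr (by simp) (by omega),
        exec_set_cons (v := colorCount color .blue X + 1) (by simp [h.blue]) (by omega), exec_nil]
      exact .inr ⟨hins hzX _ _ h (by simp [i1, hc]) (by simp [i2, hc]), hzX, hlt⟩
    · rw [if_pos (by simp [hg, h.blue]; omega)]
      exact .inl ⟨h, .inr (by omega)⟩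

theorem Offered.add {z : Fin n} (h : Offered color m a X₀ C z s) (hin : HasInput G color m)
    (hz : s.var varZ = z) (hg : s.var varGoal = 2 * a) (hzC : z ∈ C) :
    Offered color m a X₀ C (z + 1) (addVertex.exec 24 n s) := by
  classical
  obtain ⟨X, h1, h2, h3, h4⟩ := h
  rcases addVertex_spec hin h1 hz hg with ⟨h5, h6⟩ | ⟨h5, h6, h7⟩
  · refine ⟨X, h5, h2, h3, fun c => ⟨(h4 c).1, fun hlt y hy hyC hc => ?_⟩⟩
    rcases Nat.lt_succ_iff_lt_or_eq.1 hy with hy | hy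
    · exact (h4 c).2 hlt y hy hyC hc
    · rw [Fin.ext hy] at hc ⊢
      rw [hc] at h6
      exact h6.resolve_right (by omega)
  · refine ⟨insert z X, h5, h2.trans (Set.subset_insert z X), Set.insert_subset (.inr hzC) h3,
      fun c => ?_⟩
    have hle : colorCount color c X ≤ colorCount color c (insert z X) :=
      colorCount_mono _ _ (Set.subset_insert z X)
    refine ⟨?_, fun hlt y hy hyC hc => ?_⟩
    · have := (h4 c).1
      rw [colorCount_insert _ _ h6]
      split_ifs with hc
      · rw [hc] at h7
        omega
      · exact this
    · rcases Nat.lt_succ_iff_lt_or_eq.1 hy with hy | hy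
      · exact .inr ((h4 c).2 (by omega) y hy hyC hc)
      · exact .inl (Fin.ext hy)

/-- When `C` has enough vertices of each color, then so has the output at the end. -/
theorem Offered.exists_eq (h : Offered color m a X₀ C n s) (ha : ∀ c, a ≤ colorCount color c C) :
    ∃ X, Selected color m X s ∧ X₀ ⊆ X ∧ X ⊆ X₀ ∪ C ∧ ∀ c, colorCount color c X = a := by
  obtain ⟨X, h1, h2, h3, h4⟩ := h
  refine ⟨X, h1, h2, h3, fun c => le_antisymm (h4 c).1 ?_⟩
  by_contra hlt
  refine hlt ((ha c).trans (Set.ncard_le_ncard ?_ (Set.toFinite _)))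
  exact fun z hz => ⟨(h4 c).2 (by omega) z z.2 hz.1 hz.2, hz.2⟩

/-- When `C` has few vertices of each color, then all of them are in the output at the end. -/
theorem Offered.selected (h : Offered color m a ∅ C n s) (ha : ∀ c, colorCount color c C ≤ a) :
    Selected color m C s := by
  classical
  obtain ⟨X, h1, -, h3, h4⟩ := h
  rw [Set.empty_union] at h3
  convert h1
  refine Set.Subset.antisymm (fun z hz => ?_) h3
  by_contra hzX
  have e1 := colorCount_insert color (color z) hzX
  rw [if_pos rfl] at e1
  have e2 := colorCount_mono color (color z) (Set.insert_subset hz h3)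
  have e3 := ha (color z)
  exact hzX ((h4 _).2 (by omega) z z.2 hz rfl)

theorem onChain_eval {m' : ℕ → ℕ} {l u v w d : ℕ} {P : Set (Fin n)}
    (hP : ∀ z : Fin n, z ∈ P ↔ m (cell n 1 l u v w d z) ≠ 0)
    (hm : ∀ a, n * n + (n + n) ≤ a → m' a = m a) (hsm : s.mem = m') (hl : s.var varFoundL = l)
    (hu : s.var varFoundU = u) (hv : s.var varFoundV = v) (hw : s.var varFoundW = w)
    (hd : s.var varFoundD = d)
    {e : Expr} {z : Fin n} (he : e.eval n s = z) : (onChain e).eval n s = 0 ↔ z ∉ P := by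
  rw [hP, not_not]
  simp [onChain, hl, hu, hv, hw, hd, he, hsm, hm _ (le_cell n 1 l u v w d z)]

theorem nearChain_spec (t : Store) (hin : HasInput G color t.mem) {z : Fin n} (hZ : t.var varZ = z)
    (h0 : t.var varBest = 0) {P : Set (Fin n)}
    (hchain : ∀ (q : Store) (e : Expr) (x : Fin n), q.mem = t.mem →
      (∀ y, 18 ≤ y → q.var y = t.var y) → e.eval n q = x → ((onChain e).eval n q = 0 ↔ x ∉ P))
    {ν : Store} (hν : ν = nearChain.exec 24 n t) :
    ν.var varBest = 0 ↔ ¬ ∃ x ∈ P, Near G x z := by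
  have := loop_rule (J := 24) (n := n) (x := varX) (a := 1) (b := 0)
    (c := ite (onChain (var varX) * near (var varX) (var varZ)) (Cmd.set varBest (num 1)) skip)
    (σ := t) (fun j s => s.var varBest = 0 ↔ ¬ ∃ x : Fin n, (x : ℕ) < j ∧ x ∈ P ∧ Near G x z)
    (fun j s v h => by simpa using h) (by simp [h0]) ?_
  · rw [← nearChain, ← hν] at this
    rw [this]
    simp
  · intro i q hi hX hfr hqm hq
    obtain ⟨x, rfl⟩ : ∃ x : Fin n, i = x := ⟨⟨i, by omega⟩, rfl⟩
    have hqm' : q.mem = t.mem := hqm (by rfl)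
    have h1 := hchain q (var varX) x hqm'
      (fun y hy => hfr y (by omega) (by simp [Cmd.writes]; omega)) hX
    have h2 := eval_near (σ := q) (a := var varX) (b := var varZ) (u := x) (v := z)
      (by rw [hqm']; exact hin) hX (by rw [eval_var, hfr _ (by decide) (by decide), hZ])
    have hsucc : (∃ y : Fin n, (y : ℕ) < x + 1 ∧ y ∈ P ∧ Near G y z) ↔
        (∃ y : Fin n, (y : ℕ) < x ∧ y ∈ P ∧ Near G y z) ∨ (x ∈ P ∧ Near G x z) := by
      constructor
      · rintro ⟨y, hy, hh⟩
        rcases Nat.lt_succ_iff_lt_or_eq.1 hy with hy | hy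
        · exact .inl ⟨y, hy, hh⟩
        · rw [Fin.ext hy] at hh
          exact .inr hh
      · rintro (⟨y, hy, hh⟩ | hh)
        · exact ⟨y, by omega, hh⟩
        · exact ⟨x, by omega, hh⟩
    rw [hsucc, exec]
    by_cases hcond : x ∈ P ∧ Near G x z
    · rw [if_neg (by rw [eval_mul, Nat.mul_eq_zero, h1, h2]; tauto)]
      simp [exec, hcond]
    · rw [if_pos (by rw [eval_mul, Nat.mul_eq_zero, h1, h2]; tauto), exec, hq, or_iff_left hcond]

theorem output_spec (σ : Store) (hin : HasInput G color σ.mem)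
    (hout : ∀ b, n * n + n ≤ b → b < n * n + (n + n) → σ.mem b = 0) {P : Set (Fin n)}
    (hP : ∀ z : Fin n, z ∈ P ↔ σ.mem (cell n 1 (σ.var varFoundL) (σ.var varFoundU) (σ.var varFoundV)
      (σ.var varFoundW) (σ.var varFoundD) z) ≠ 0) (hg : σ.var varGoal = 2 * a) (ha : a ≠ 0)
    (hC : ∀ z, z ∈ C ↔ ∃ p ∈ P, Near G p z) (hle : ∀ c, colorCount color c P ≤ a)
    (hge : ∀ c, a ≤ colorCount color c C) :
    ∃ X, Selected color σ.mem X (output.exec 24 n σ) ∧ P ⊆ X ∧ X ⊆ C ∧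
      ∀ c, colorCount color c X = a := by
  have hcut := cutoff n
  have hchain : ∀ (t : Store) (e : Expr) (z : Fin n),
      (∀ b, b < n * n + n ∨ n * n + (n + n) ≤ b → t.mem b = σ.mem b) →
      (∀ y, 18 ≤ y → t.var y = σ.var y) → e.eval n t = z → ((onChain e).eval n t = 0 ↔ z ∉ P) :=
    fun t e z h1 h2 he => onChain_eval hP (fun b hb => h1 b (.inr hb)) rfl
      (h2 _ (by omega)) (h2 _ (by omega)) (h2 _ (by omega)) (h2 _ (by omega)) (h2 _ (by omega)) he
  rw [output, exec, if_neg (by simp [hg, ha]), exec_set_cons (v := 0) (by simp) (by omega),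
    exec_set_cons (v := 0) (by simp) (by omega), exec_cons, exec_cons, exec_nil]
  have writes : ∀ (c : Cmd) (t : Store), (∀ y ∈ c.writes, y < 17) →
      ∀ y, 17 ≤ y → (c.exec 24 n t).var y = t.var y := fun c t h y hy =>
    exec_frame _ _ _ _ fun h' => by have := h y h'; omega
  have hw : ∀ y ∈ (ite (onChain (var varZ)) addVertex skip).writes, y < 17 := by decide
  have hw' : ∀ y ∈ offerNear.writes, y < 17 := by decide
  obtain ⟨ρ, hρ⟩ : ∃ ρ, ρ = (σ.set varRed 0).set varBlue 0 := ⟨_, rfl⟩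
  have hρv : ∀ y, 17 ≤ y → ρ.var y = σ.var y := fun y hy => by
    rw [hρ, Store.set_var, if_neg (by omega), Store.set_var, if_neg (by omega)]
  rw [← hρ]
  have pass1 : Offered color σ.mem a ∅ P n
      ((loop varZ 1 0 (ite (onChain (var varZ)) addVertex skip)).exec 24 n ρ) := by
    have := loop_rule (J := 24) (n := n) (x := varZ) (a := 1) (b := 0)
      (c := ite (onChain (var varZ)) addVertex skip) (σ := ρ)
      (fun j s => Offered color σ.mem a ∅ P j s)
      (fun j s v h => h.set (by decide) (by decide) v) ?_ ?_
    · simpa using this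
    · refine ⟨∅, ⟨fun z => ?_, by simp [hρ, colorCount], by simp [hρ, colorCount],
        fun b _ => by rw [hρ]; rfl⟩, le_rfl, Set.empty_subset _, fun c => ⟨by simp [colorCount],
        fun _ z hz => absurd hz (by omega)⟩⟩
      rw [hρ, if_neg (Set.notMem_empty z)]
      exact hout _ (by omega) (by omega)
    · intro j t hj hZ hfr _ h
      have hm : ∀ b, b < n * n + n ∨ n * n + (n + n) ≤ b → t.mem b = σ.mem b := by
        obtain ⟨X, hX, -⟩ := h
        exact hX.mem
      obtain ⟨z, rfl⟩ : ∃ z : Fin n, j = z := ⟨⟨j, by omega⟩, rfl⟩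
      have hv : ∀ y, 17 ≤ y → t.var y = σ.var y := fun y hy => by
        rw [hfr y (by omega) fun h => by have := hw y h; omega, hρv y hy]
      have hc := hchain t (var varZ) z hm (fun y hy => hv y (by omega)) hZ
      rw [exec]
      by_cases hz : z ∈ P
      · rw [if_neg (by rw [hc]; exact not_not.2 hz)]
        exact h.add hin hZ (by rw [hv _ le_rfl, hg]) hz
      · rw [if_pos (hc.2 hz), exec]
        exact h.skip hz
  have hτv : ∀ y, 17 ≤ y →
      ((loop varZ 1 0 (ite (onChain (var varZ)) addVertex skip)).exec 24 n ρ).var y = σ.var y :=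
    fun y hy => by rw [writes _ _ (by decide) y hy, hρv y hy]
  generalize (loop varZ 1 0 (ite (onChain (var varZ)) addVertex skip)).exec 24 n ρ = τ at *
  have hsel := pass1.selected hle
  have hPC : P ⊆ C := fun p hp => (hC p).2 ⟨p, hp, .inl rfl⟩
  have pass2 : Offered color σ.mem a P C n ((loop varZ 1 0 offerNear).exec 24 n τ) := by
    have := loop_rule (J := 24) (n := n) (x := varZ) (a := 1) (b := 0) (c := offerNear) (σ := τ)
      (fun j s => Offered color σ.mem a P C j s) (fun j s v h => h.set (by decide) (by decide) v)
      ⟨P, hsel, le_rfl, Set.subset_union_left, fun c =>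
        ⟨hle c, fun _ z hz => absurd hz (by omega)⟩⟩ ?_
    · simpa using this
    · intro j t hj hZ hfr _ h
      have hm : ∀ b, b < n * n + n ∨ n * n + (n + n) ≤ b → t.mem b = σ.mem b := by
        obtain ⟨X, hX, -⟩ := h
        exact hX.mem
      obtain ⟨z, rfl⟩ : ∃ z : Fin n, j = z := ⟨⟨j, by omega⟩, rfl⟩
      have hv : ∀ y, 17 ≤ y → t.var y = σ.var y := fun y hy => by
        rw [hfr y (by omega) fun h => by have := hw' y h; omega, hτv y hy]
      obtain ⟨ν, hν⟩ : ∃ ν, ν = nearChain.exec 24 n (t.set varBest 0) := ⟨_, rfl⟩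
      have hνm : ν.mem = t.mem := by rw [hν, exec_pure _ _ _ _ (by rfl)]; rfl
      have hνv : ∀ y, y ≠ varX → y ≠ varBest → ν.var y = t.var y := fun y h1 h2 => by
        rw [hν, exec_frame _ _ _ _ (by simp [nearChain, Cmd.writes, h1, h2]), Store.set_var,
          if_neg h2]
      have hflag : ν.var varBest = 0 ↔ z ∉ C := by
        rw [hC]
        exact nearChain_spec (t.set varBest 0) (hin.congr fun b hb => hm b (.inl hb)) hZ rfl
          (fun q e x h1 h2 he => hchain q e x (fun b hb => by rw [h1]; exact hm b hb)
            (fun y hy => by rw [h2 y hy, Store.set_var, if_neg (by omega), hv y (by omega)]) he) hν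
      have hν' : Offered color σ.mem a P C z ν :=
        h.congr hνm (hνv _ (by decide) (by decide)) (hνv _ (by decide) (by decide))
      rw [offerNear, exec_set_cons (v := 0) (by simp) (by omega), exec_cons, ← hν, exec_cons,
        exec_nil, exec]
      by_cases hz : z ∈ C
      · rw [if_neg (by rw [eval_var, hflag]; exact not_not.2 hz)]
        exact hν'.add hin (by rw [hνv _ (by decide) (by decide), hZ])
          (by rw [hνv _ (by decide) (by decide), hv _ le_rfl, hg]) hz
      · rw [if_pos (by rw [eval_var, hflag]; exact hz), exec]
        exact hν'.skip hz
  obtain ⟨X, h1, h2, h3, h4⟩ := pass2.exists_eq hge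
  exact ⟨X, h1, h2, h3.trans (Set.union_subset hPC le_rfl), h4⟩

end Offer

/-! ### The algorithm -/

/-- The whole algorithm. -/
def program : Cmd := block [countTable, initTable, layers, search, output]

theorem program_depth : program.depth = 6 := by decide

theorem program_slope : program.slope ≤ 24 := by decide

theorem program_spec (hG : IsPermutationGraph G) (σ : Store) (hσ : σ.mem = (bcsInput G color).mem) :
    IsBCSSolution G color {i | (program.exec 24 n σ).mem (n * n + n + i) = 1} := by
  obtain ⟨r, f, hr, hrf⟩ := hG.exists_isCocomparability
  have hin : HasInput G color σ.mem := by rw [hσ]; exact hasInput_bcsInput G color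
  have hzero : ∀ b, n * n + n ≤ b → σ.mem b = 0 := fun b hb => by
    rw [hσ]; exact bcsInput_eq_zero G color hb
  rw [program, exec_cons, exec_cons, exec_cons, exec_cons, exec_cons, exec_nil]
  obtain ⟨hA, hcount⟩ := countTable_spec σ hin
  generalize countTable.exec 24 n σ = σ₁ at *
  have hin₁ := hin.of_agreeOff hA
  obtain ⟨hB, hlay⟩ := initTable_spec σ₁ hin₁ fun t u v w d z => by
    by_cases ht : t = 4
    · omega
    · left
      rw [hA.2 _ _ _ _ _ _ _ ht]
      have := le_cell n t 0 u v w d z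
      exact hzero _ (by omega)
  generalize initTable.exec 24 n σ₁ = σ₂ at *
  have hL₂ : LayersOK G color 0 σ₂.mem := by
    refine ⟨hin₁.of_agreeOff hB, fun b h1 h2 => ?_, CountOK.of_agreeOff hcount hB (by simp),
      fun k hk => ?_, fun k hk => absurd hk (by omega)⟩
    · rw [hB.1 b h2, hA.1 b h2, hzero b h1]
    · obtain rfl : k = 0 := by omega
      exact hlay
  have hL := layers_spec hr σ₂ hL₂
  generalize layers.exec 24 n σ₂ = σ₃ at *
  obtain ⟨τ, hτ⟩ : ∃ τ, τ = search.exec 24 n σ₃ := ⟨_, rfl⟩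
  obtain ⟨hs, hc⟩ := search_correct hr hrf σ₃ hL hτ
  have hτm : τ.mem = σ₃.mem := by rw [hτ, exec_pure _ _ _ _ (by rfl)]
  rw [← hτ]
  by_cases hg : τ.var varGoal = 0
  · right
    refine ⟨?_, fun S hS => ?_⟩
    · ext i
      rw [output, exec, if_pos (by simpa using hg), exec, hτm]
      simp only [Set.mem_ofPred_eq, Set.mem_empty_iff_false, iff_false]
      rw [hL.out _ (by omega) (by omega)]
      exact zero_ne_one
    · have := hc S hS
      obtain ⟨⟨x, hx⟩⟩ := hS.1.nonempty
      have := (Set.ncard_pos (Set.toFinite S)).2 ⟨x, hx⟩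
      omega
  · -- The chain found by the search, completed to `a` vertices of each color, has size `2 * a`.
    left
    obtain ⟨k, P, N, u, v, w, a, hch, hga, -, hP, hcc⟩ := hs hg
    obtain ⟨X, hX, h1, h2, h3⟩ := output_spec (a := a) (C := N ∪ {z | NewNbr G u v w z}) (P := P) τ
      (by rw [hτm]; exact hL.input) (by rw [hτm]; exact hL.out) (by rw [hτm]; exact hP) hga
      (by omega) (fun z => ⟨hch.exists_near z, fun ⟨p, hp, hpz⟩ => hch.near_mem hp hpz⟩)
      (fun c => (hcc c).1) fun c => (hcc c).2
    have hset : {i : Fin n | (output.exec 24 n τ).mem (n * n + n + i) = 1} = X := by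
      ext i
      rw [Set.mem_ofPred_eq, hX.out i]
      split_ifs with h <;> simp [h]
    rw [hset]
    refine ⟨⟨hch.connected h1 h2, (h3 .red).trans (h3 .blue).symm⟩, fun S hS => ?_⟩
    have := hc S hS
    rw [← colorCount_add color X, h3, h3]
    omega

end RAM

theorem mainTheorem3 :
    ∃ (p : RAM.Prog) (k : ℕ) (T : ℕ → ℕ),
      (fun n : ℕ => (T n : ℝ)) =O[atTop] (fun n : ℕ => (n : ℝ) ^ 6) ∧
      ∀ (n : ℕ) (G : SimpleGraph (Fin n)) (color : Fin n → VertexColor),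
        IsPermutationGraph G →
          ∃ (t : ℕ) (s : RAM.State),
            RAM.Runs ((n + 2) ^ k) p (bcsInput G color) t s ∧
            t ≤ T n ∧
            IsBCSSolution G color (bcsOutput n s) := by
  refine ⟨RAM.program.compile 24 0, RAM.program.deg 24 + 1, RAM.program.cost 24, ?_,
    fun n G color hG => ?_⟩
  · obtain ⟨C, hC⟩ := RAM.program.cost_le 24
    rw [RAM.program_depth] at hC
    -- For `1 ≤ n`, `n + 1` is at most `2 * n`.
    refine IsBigO.of_bound (C * 2 ^ 6) (eventually_atTop.2 ⟨1, fun n hn => ?_⟩)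
    have h1 : RAM.program.cost 24 n ≤ C * (2 * n) ^ 6 :=
      (hC n).trans (Nat.mul_le_mul_left _ (Nat.pow_le_pow_left (by omega) 6))
    have h2 : ((RAM.program.cost 24 n : ℕ) : ℝ) ≤ C * (2 * n) ^ 6 := by exact_mod_cast h1
    rw [Real.norm_of_nonneg (by positivity), Real.norm_of_nonneg (by positivity)]
    calc ((RAM.program.cost 24 n : ℕ) : ℝ) ≤ C * (2 * n) ^ 6 := h2
      _ = C * 2 ^ 6 * n ^ 6 := by ring
  · let σ : RAM.Store := ⟨fun _ => 0, (bcsInput G color).mem⟩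
    have hone : 1 ≤ (n + 2) ^ 24 := Nat.one_le_pow _ _ (by omega)
    obtain ⟨t, s, hrun, ht, hs, -⟩ := RAM.Cmd.compile_runs RAM.program (lt_add_one _)
      RAM.program_slope 0 σ (bcsInput G color) (n := n)
      ⟨fun _ => Nat.zero_le _, fun a => by
        simp only [σ, bcsInput]
        split_ifs <;> omega⟩
      ⟨by simp [bcsInput], fun x => by simp [bcsInput, RAM.regVar, σ], rfl⟩
    refine ⟨t, s, hrun, ht, ?_⟩
    have := RAM.program_spec hG σ rfl
    rwa [← hs.2.2] at this
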